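/- Let $n\ge 1$ and $\lambda\ge 2$ be integers, let $\Lambda=\{0,\dots,\lambda-1\}^n$, $\Gamma=\frac{2\pi}{\lambda}\{0,\dots,\lambda-1\}^n$, and let $N\le\lambda^n$. A rational trigonometric polynomial is a quotient $r=r_1/r_2$ of trigonometric polynomials in lowest terms with $r_2\not\equiv0$; it is defined at the points where $r_2\neq0$. The Fourier transform is normalised by $\widehat f(\xi)=\int_{\mathbb R^n}f(x)e^{-ix\cdot\xi}\,dx$. Let $S$ be a rational trigonometric polynomial that is nonnegative on $\mathbb T^n$ (where defined), continuous at $0$ with $S(0)=1$, and such that $S,1/S\in L^\infty(\mathbb T^n)$. For $1\le l\le N$ let $p_l,g_l$ be rational trigonometric polynomials with $p_l(0)=1$ and $$\frac1{S(\xi)}-|p_l(\xi)|^2=\lambda^n|g_l(\xi)|^2$$ at all $\xi$ where both sides are defined. Let $s$ be a rational trigonometric polynomial with $|s|^2=1/S$ and $s(0)=1$. For $N<l\le\lambda^n$ let $p_l$ be a rational trigonometric polynomial with $|p_l|^2=1/S$. Let $\nu_1,\dots,\nu_{\lambda^n}$ be the distinct elements of $\Lambda$ and put $$\tau(\xi)=\Big(\lambda^{-n}\sum_{l=1}^{\lambda^n}p_l(\lambda\xi)e^{i\nu_l\cdot\xi}\Big)\Big/\overline{s(\xi)},$$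 where it is assumed that $\tau(0)=1$, all functions in the formula for $\tau(0)$ being defined there (that is, $p_l(0)=1$ also for $N<l\le\lambda^n$). Define $$q_{1,l}(\xi)=S(\lambda\xi)\tau(\xi)\overline{g_l(\lambda\xi)}\quad(1\le l\le N),$$ $$q_{2,m}(\xi)=\lambda^{-n/2}\big(S(\xi)s(\xi)e^{i\nu_m\cdot\xi}-S(\lambda\xi)\tau(\xi)\overline{p_m(\lambda\xi)}\big)\quad(1\le m\le\lambda^n),$$ and denote these $N+\lambda^n$ functions by $q_k$. Then the product $\prod_{j\ge1}\tau(\lambda^{-j}\xi)$ converges for almost every $\xi$ and is the Fourier transform of a function $\phi_\tau\in L^2(\mathbb R^n)$ with $\widehat{\phi_\tau}(\lambda\xi)=\tau(\xi)\widehat{\phi_\tau}(\xi)$ a.e.; the conditions of the oblique extension principle hold: $\tau$ and all $q_k$ belong to $L^\infty(\mathbb T^n)$, $\lim_{\xi\to0}\widehat{\phi_\tau}(\xi)=1$, $\sum_{k\in\mathbb Z^n}|\widehat{\phi_\tau}(\cdot+2\pi k)|^2\in L^\infty(\mathbb T^n)$, and for almost every $\xi$ such that $\widehat{\phi_\tau}(\xi+2\pi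 k)\ne0$ for some $k\in\mathbb Z^n$, and every $\gamma\in\Gamma$, $$S(\lambda\xi)\tau(\xi)\overline{\tau(\xi+\gamma)}+\sum_k q_k(\xi)\overline{q_k(\xi+\gamma)}=\begin{cases}S(\xi),&\gamma=0,\\0,&\gamma\ne0;\end{cases}$$ there are $\psi_k\in L^2(\mathbb R^n)$ with $\widehat{\psi_k}(\lambda\xi)=q_k(\xi)\widehat{\phi_\tau}(\xi)$ a.e.; and the wavelet system they generate is a tight wavelet frame of $L^2(\mathbb R^n)$: $$\sum_k\sum_{j\in\mathbb Z}\sum_{m\in\mathbb Z^n}\big|\langle f,\lambda^{jn/2}\psi_k(\lambda^j\cdot-m)\rangle\big|^2=\|f\|^2\qquad\text{for all }f\in L^2(\mathbb R^n).$$ -/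

import Mathlib

open MeasureTheory Filter Topology
open scoped ENNReal NNReal FourierTransform ComplexConjugate

noncomputable section

namespace ObliqueTWF

/-- Euclidean space `ℝⁿ`, used for both the space and the frequency variable. -/
abbrev RSpace (n : ℕ) : Type := EuclideanSpace ℝ (Fin n)

/-- The Hilbert space `L²(ℝⁿ)` of complex-valued functions. -/
abbrev L2Space (n : ℕ) : Type := Lp (α := RSpace n) ℂ 2 volume

/-- The integer vector `k`, viewed as a point of `ℝⁿ`. -/
def intVec {n : ℕ} (k : Fin n → ℤ) : RSpace n := WithLp.toLp 2 fun i => (k i : ℝ)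

/-! ### Trigonometric polynomials and their quotients -/

/-- The ring of trigonometric polynomials in `n` variables: the element with coefficients `c k`
stands for `ξ ↦ ∑ₖ c k · exp(i k·ξ)`, a finite sum over `k ∈ ℤⁿ`. -/
abbrev TrigPoly (n : ℕ) : Type := AddMonoidAlgebra ℂ (Fin n → ℤ)

/-- The exponential `exp(i k·ξ)`. -/
def expi {n : ℕ} (k : Fin n → ℤ) (ξ : RSpace n) : ℂ :=
  Complex.exp (Complex.I * ∑ i, (k i : ℂ) * (ξ i : ℂ))

/-- The value of a trigonometric polynomial at `ξ`. -/
def TrigPoly.eval {n : ℕ} (P : TrigPoly n) (ξ : RSpace n) : ℂ :=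
  P.coeff.sum fun k c => c * expi k ξ

/-- A rational trigonometric polynomial: a quotient of two trigonometric polynomials in lowest
terms (their only common divisors are the units of the ring, i.e. the nonzero constants times
exponentials). -/
structure RatTrigPoly (n : ℕ) where
  /-- the numerator -/
  num : TrigPoly n
  /-- the denominator -/
  den : TrigPoly n
  den_ne_zero : den ≠ 0
  isRelPrime : IsRelPrime num den

/-- The points at which a rational trigonometric polynomial is defined. -/
def RatTrigPoly.DefinedAt {n : ℕ} (r : RatTrigPoly n) (ξ : RSpace n) : Prop :=
  TrigPoly.eval r.den ξ ≠ 0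

/-- The value of a rational trigonometric polynomial. At the points where it is not defined
(a null set) the value is `0` by convention. -/
def RatTrigPoly.eval {n : ℕ} (r : RatTrigPoly n) (ξ : RSpace n) : ℂ :=
  TrigPoly.eval r.num ξ / TrigPoly.eval r.den ξ

instance {n : ℕ} : CoeFun (RatTrigPoly n) fun _ => RSpace n → ℂ := ⟨RatTrigPoly.eval⟩

/-- Membership in `L^∞(𝕋ⁿ)`; it is used for `2π`-periodic functions only, for which essential
boundedness on `𝕋ⁿ` and on `ℝⁿ` are the same. -/
def EssBounded {n : ℕ} (f : RSpace n → ℂ) : Prop := MemLp f ∞ volume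

/-! ### Wavelet systems and tight frames -/

/-- The Fourier transform on `L²(ℝⁿ)`, normalised so that `f̂(ξ) = ∫ f(x) exp(-i x·ξ) dx` for
`f ∈ L¹ ∩ L²`. Mathlib's `𝓕` has the kernel `exp(-2πi x·ξ)`, hence the factor `1/(2π)`. -/
def fourierHat {n : ℕ} (f : L2Space n) (ξ : RSpace n) : ℂ :=
  (𝓕 f : L2Space n) ((2 * Real.pi)⁻¹ • ξ)

/-- The function `ψ_{j,k}(x) = λ^{jn/2} ψ(λ^j x - k)`. -/
def waveletAtom {n : ℕ} (lam : ℕ) (ψ : L2Space n) (j : ℤ) (k : Fin n → ℤ) (x : RSpace n) : ℂ :=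
  (((lam : ℝ) ^ ((j : ℝ) * (n : ℝ) / 2) : ℝ) : ℂ) * ψ (((lam : ℝ) ^ j) • x - intVec k)

/-- The wavelet system generated by the finite family `Ψ` (with multiplicities) is a tight frame:
`∑_ψ ∑_{j,k} |⟨f, ψ_{j,k}⟩|² = ‖f‖²` for all `f ∈ L²(ℝⁿ)`. -/
def IsTightWaveletFrame {n : ℕ} {ι : Type} (lam : ℕ) (Ψ : ι → L2Space n) : Prop :=
  ∀ f : L2Space n,
    HasSum (fun a : ι × ℤ × (Fin n → ℤ) =>
      ‖∫ x, f x * conj (waveletAtom lam (Ψ a.1) a.2.1 a.2.2 x)‖ ^ 2) (‖f‖ ^ 2)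

/-- The infinite product `∏_{j ≥ 1} τ(λ^{-j} ξ)`, the Fourier transform of `φ_τ`. -/
def phiHat {n : ℕ} (lam : ℕ) (τ : RSpace n → ℂ) (ξ : RSpace n) : ℂ :=
  ∏' j : ℕ, τ (((lam : ℝ) ^ (j + 1))⁻¹ • ξ)

/-- `φ ∈ L²(ℝⁿ)` is the refinable function `φ_τ` with refinement mask `τ`: the infinite product
converges almost everywhere, it is the Fourier transform of `φ`, and
`φ̂(λξ) = τ(ξ) φ̂(ξ)`. -/
structure IsRefinableFunction {n : ℕ} (lam : ℕ) (τ : RSpace n → ℂ) (φ : L2Space n) : Prop where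
  multipliable : ∀ᵐ ξ : RSpace n, Multipliable fun j : ℕ => τ (((lam : ℝ) ^ (j + 1))⁻¹ • ξ)
  hat_eq : fourierHat φ =ᵐ[volume] phiHat lam τ
  refinable : ∀ᵐ ξ : RSpace n, fourierHat φ ((lam : ℝ) • ξ) = τ ξ * fourierHat φ ξ

/-- The wavelet system `X(τ, (q_l))` is a tight wavelet frame of `L²(ℝⁿ)`: the refinable function
`φ_τ` exists in `L²(ℝⁿ)`, the mother wavelets `ψ_l` given by `ψ̂_l(λξ) = q_l(ξ) φ̂_τ(ξ)` exist in
`L²(ℝⁿ)` (both are then unique), and the wavelet system they generate is a tight frame. -/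
def IsTightWaveletFrameOfMasks {n : ℕ} {ι : Type} (lam : ℕ) (τ : RSpace n → ℂ)
    (q : ι → RSpace n → ℂ) : Prop :=
  ∃ φ : L2Space n, IsRefinableFunction lam τ φ ∧
    ∃ Ψ : ι → L2Space n,
      (∀ l, ∀ᵐ ξ : RSpace n, fourierHat (Ψ l) ((lam : ℝ) • ξ) = q l ξ * fourierHat φ ξ) ∧
      IsTightWaveletFrame lam Ψ

/-! ### The conditions of the oblique extension principle -/

/-- The set `Γ = (2π/λ) {0, …, λ-1}ⁿ`. -/
def gammaSet (n lam : ℕ) : Set (RSpace n) :=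
  {γ | ∃ m : Fin n → Fin lam, ∀ i, γ i = 2 * Real.pi / lam * ((m i : ℕ) : ℝ)}

/-- The conditions of the oblique extension principle on the masks `τ, (q_l)` and the
vanishing-moment recovery function `S`, with the refinable function `φ_τ`. The identity is
required at almost every point of
`σ(φ_τ) = {ξ : φ̂_τ(ξ + 2πk) ≠ 0 for some k ∈ ℤⁿ}`. -/
structure SatisfiesOEP {n : ℕ} {ι : Type} [Fintype ι] (lam : ℕ) (S τ : RSpace n → ℂ)
    (q : ι → RSpace n → ℂ) : Prop where
  bounded_tau : EssBounded τ
  bounded_q : ∀ l, EssBounded (q l)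
  phiHat_tendsto : Tendsto (phiHat lam τ) (𝓝 0) (𝓝 1)
  bracket_bounded : ∃ C : ℝ≥0, ∀ᵐ ξ : RSpace n,
    ∑' k : Fin n → ℤ, ‖phiHat lam τ (ξ + (2 * Real.pi) • intVec k)‖ₑ ^ 2 ≤ C
  identity : ∀ᵐ ξ : RSpace n,
    (∃ k : Fin n → ℤ, phiHat lam τ (ξ + (2 * Real.pi) • intVec k) ≠ 0) →
    ∀ γ ∈ gammaSet n lam,
      (γ = 0 →
        S ((lam : ℝ) • ξ) * τ ξ * conj (τ (ξ + γ)) + ∑ l, q l ξ * conj (q l (ξ + γ)) = S ξ) ∧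
      (γ ≠ 0 →
        S ((lam : ℝ) • ξ) * τ ξ * conj (τ (ξ + γ)) + ∑ l, q l ξ * conj (q l (ξ + γ)) = 0)

/-! ### The masks of the construction -/

/-- `exp(i ν·ξ)` for `ν ∈ Λ = {0, …, λ-1}ⁿ`. -/
def expLam {n lam : ℕ} (ν : Fin n → Fin lam) (ξ : RSpace n) : ℂ :=
  expi (fun i => ((ν i : ℕ) : ℤ)) ξ

/-- The refinement mask `τ(ξ) = (λ^{-n} ∑_l p_l(λξ) exp(i ν_l·ξ)) / conj (s(ξ))`. -/
def refinementMask {n lam : ℕ} (s : RatTrigPoly n) (p : Fin (lam ^ n) → RatTrigPoly n)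
    (ν : Fin (lam ^ n) → Fin n → Fin lam) (ξ : RSpace n) : ℂ :=
  (((lam : ℂ) ^ n)⁻¹ * ∑ l, p l ((lam : ℝ) • ξ) * expLam (ν l) ξ) / conj (s ξ)

/-- The masks `q_{1,l}(ξ) = S(λξ) τ(ξ) conj (g_l(λξ))`. -/
def mask₁ {n : ℕ} (lam : ℕ) (S : RatTrigPoly n) (τ : RSpace n → ℂ) (gl : RatTrigPoly n)
    (ξ : RSpace n) : ℂ :=
  S ((lam : ℝ) • ξ) * τ ξ * conj (gl ((lam : ℝ) • ξ))

/-- The masks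
`q_{2,m}(ξ) = λ^{-n/2} (S(ξ) s(ξ) exp(i ν_m·ξ) - S(λξ) τ(ξ) conj (p_m(λξ)))`. -/
def mask₂ {n lam : ℕ} (S s : RatTrigPoly n) (τ : RSpace n → ℂ) (pm : RatTrigPoly n)
    (νm : Fin n → Fin lam) (ξ : RSpace n) : ℂ :=
  (((lam : ℝ) ^ (-(n : ℝ) / 2) : ℝ) : ℂ) *
    (S ξ * s ξ * expLam νm ξ - S ((lam : ℝ) • ξ) * τ ξ * conj (pm ((lam : ℝ) • ξ)))

/-- The family of all `N + λⁿ` wavelet masks: first the `q_{1,l}`, then the `q_{2,m}`. -/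
def waveletMasks {n lam N : ℕ} (S s : RatTrigPoly n) (p : Fin (lam ^ n) → RatTrigPoly n)
    (g : Fin N → RatTrigPoly n) (ν : Fin (lam ^ n) → Fin n → Fin lam) :
    Fin N ⊕ Fin (lam ^ n) → RSpace n → ℂ :=
  Sum.elim (fun l => mask₁ lam S (refinementMask s p ν) (g l))
    (fun m => mask₂ S s (refinementMask s p ν) (p m) (ν m))

end ObliqueTWF

end

open ObliqueTWF

/-!
The proof has two halves: the masks satisfy the identity of the oblique extension principle (OEP)
almost everywhere, and the OEP holds.

*The mask identity.* Fix `ξ` and two points `ξ', ξ''` of the fibre `ξ + Γ`. All `λξ'` agree modulo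
periods, so `S, p_l, g_l` take the same values at them. Put `A = S s`, so that `A · conj s = 1`.
Expanding `∑ q(ξ') conj q(ξ'')`, the terms containing `exp(i ν_m·ξ)` to the first power are
evaluated by the definition `∑ p_m(λξ) exp(i ν_m·ξ) = λⁿ τ conj s`, and the terms without
exponentials by `S (∑ |g_l|² + λ^{-n} ∑ |p_m|²) = 1`, which is the sum of the relations between
`S`, `p_l` and `g_l`. What remains is `λ^{-n} A(ξ') conj A(ξ'') ∑_ν exp(i ν·(ξ' - ξ''))`, that is
`S(ξ')` if the points agree modulo `2πℤⁿ` and `0` otherwise, by orthogonality of the characters of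
`(ℤ/λ)ⁿ` (`mask_identity`). The diagonal case bounds the masks (`mask_energy`).

*The refinable function.* Since `|p_l(0)| ≤ 1` for all `l`, `τ(0) = 1` forces all `p_l` to be
defined at `0`, so `τ` is differentiable there and the infinite product converges everywhere
(`refinementMask_sub_one_isBigO`, `multipliable_dilate`). Testing the quadratic form of the
identity with the vector `τ/S` shows that `1/S` is a supersolution of the transfer operator of
`|τ|²` (`sum_mask_sq_div_le`); iterating this operator from a cut-off and passing to the limit
gives `∑ₖ |φ̂(ξ + 2πk)|² ≤ 1/S(ξ)` (`ae_perSq_phiHat_le`), hence `φ ∈ L²(ℝⁿ)` and a bounded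
bracket.

*The oblique extension principle.* Let `[h, Φ](ξ) = ∑ₖ h(ξ + k) conj Φ(ξ + k)` be the bracket
product, in the frequency variable `ξ/(2π)`. By Parseval's identity on the cube, the squared
coefficients of `f` against the atoms of level `j` sum to the integral of the squared bracket of
the dilated `𝓕 f` with `𝓕 ψ`. The identity, read as an equality of quadratic forms in the brackets
at the points of a fibre, says that the energy `∫ S |[h, 𝓕 φ]|²` at level `j` plus the
coefficients at level `j` is the energy at level `j + 1` (`FourierOEP.energy_dil_succ`). The
energy tends to `‖f‖²` as `j → ∞`, because `S |𝓕 φ|²` tends to `1` at the origin and brackets of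
functions supported near the origin have one term (`FourierOEP.tendsto_energy`). It tends to `0`
as `j → -∞`, because there it is dominated by the coefficients of `f` against coarse dilates of
`φ` (`tendsto_tsum_coarse`). Telescoping gives the tight frame identity
(`FourierOEP.isTightWaveletFrame`).
-/

namespace ObliqueTWF

/-! ### Trigonometric polynomials: periodicity, regularity and zero sets -/

section Trig

variable {n : ℕ}

lemma intVec_add (k l : Fin n → ℤ) : intVec (k + l) = intVec k + intVec l := by
  ext i; simp [intVec]

lemma intVec_neg (k : Fin n → ℤ) : intVec (-k) = -intVec k := by
  ext i; simp [intVec]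

lemma intVec_zero : intVec (0 : Fin n → ℤ) = 0 := by
  ext i; simp [intVec]

lemma intVec_sub (k l : Fin n → ℤ) : intVec (k - l) = intVec k - intVec l := by
  ext i; simp [intVec]

lemma smul_intVec (a : ℕ) (k : Fin n → ℤ) : (a : ℝ) • intVec k = intVec (a • k) := by
  ext i; simp [intVec]

lemma expi_add_right (k : Fin n → ℤ) (ξ η : RSpace n) : expi k (ξ + η) = expi k ξ * expi k η := by
  simp only [expi, ← Complex.exp_add]
  congr 1
  rw [← mul_add, ← Finset.sum_add_distrib]
  congr 2; ext i; push_cast [PiLp.add_apply]; ring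

lemma expi_zero_right (k : Fin n → ℤ) : expi k (0 : RSpace n) = 1 := by
  simp [expi]

lemma expi_intVec (k m : Fin n → ℤ) : expi k ((2 * Real.pi) • intVec m) = 1 := by
  rw [expi, Complex.exp_eq_one_iff]
  refine ⟨∑ i, k i * m i, ?_⟩
  push_cast [intVec, Finset.mul_sum, Finset.sum_mul, PiLp.smul_apply, smul_eq_mul]
  exact Finset.sum_congr rfl fun i _ => by ring

lemma norm_expi (k : Fin n → ℤ) (ξ : RSpace n) : ‖expi k ξ‖ = 1 := by
  have : (Complex.I * ∑ i, (k i : ℂ) * (ξ i : ℂ)) =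
      ((∑ i, (k i : ℝ) * ξ i : ℝ) : ℂ) * Complex.I := by
    push_cast; ring
  rw [expi, this, Complex.norm_exp_ofReal_mul_I]

lemma conj_expi (k : Fin n → ℤ) (ξ : RSpace n) : conj (expi k ξ) = expi k (-ξ) := by
  rw [expi, expi, ← Complex.exp_conj]
  simp

lemma contDiff_expi (k : Fin n → ℤ) : ContDiff ℝ 1 (expi k : RSpace n → ℂ) := by
  unfold expi
  refine ContDiff.cexp (contDiff_const.mul (ContDiff.sum fun i _ => contDiff_const.mul ?_))
  exact Complex.ofRealCLM.contDiff.comp (contDiff_euclidean.1 contDiff_id i)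

lemma TrigPoly.contDiff_eval (P : TrigPoly n) : ContDiff ℝ 1 (TrigPoly.eval P) := by
  unfold TrigPoly.eval Finsupp.sum
  exact ContDiff.sum fun k _ => contDiff_const.mul (contDiff_expi k)

lemma TrigPoly.eval_add_period (P : TrigPoly n) (ξ : RSpace n) (m : Fin n → ℤ) :
    TrigPoly.eval P (ξ + (2 * Real.pi) • intVec m) = TrigPoly.eval P ξ := by
  simp only [TrigPoly.eval, expi_add_right, expi_intVec, mul_one]

/-- A direction in which finitely many distinct frequencies stay distinct. -/
lemma exists_direction_injOn (s : Finset (Fin n → ℤ)) :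
    ∃ v : RSpace n, Set.InjOn (fun k : Fin n → ℤ => ∑ i, (k i : ℝ) * v i) s := by
  classical
  let ι := {x : s × s // x.1 ≠ x.2}
  let f : ι → Module.Dual ℝ (Fin n → ℝ) := fun x =>
    ∑ i, (((x.1.1.1 i : ℤ) : ℝ) - ((x.1.2.1 i : ℤ) : ℝ)) • LinearMap.proj i
  obtain ⟨v, hv⟩ := Module.Dual.exists_forall_ne_zero_of_forall_exists f (by
    rintro ⟨⟨k, l⟩, hkl⟩
    obtain ⟨i, hi⟩ : ∃ i, k.1 i ≠ l.1 i := by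
      by_contra! h
      exact hkl (Subtype.ext (funext h))
    refine ⟨Pi.single i 1, ?_⟩
    simp only [f, LinearMap.sum_apply, LinearMap.smul_apply, LinearMap.proj_apply, smul_eq_mul]
    rw [Finset.sum_eq_single i (fun j _ hj => by simp [hj]) (by simp)]
    simpa [sub_eq_zero] using hi)
  refine ⟨WithLp.toLp 2 v, fun k hk l hl hkl => ?_⟩
  by_contra hne
  refine hv ⟨(⟨k, hk⟩, ⟨l, hl⟩), fun h => hne (congrArg Subtype.val h)⟩ ?_
  simp only [f, LinearMap.sum_apply, LinearMap.smul_apply, LinearMap.proj_apply, smul_eq_mul,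
    sub_mul, Finset.sum_sub_distrib]
  exact sub_eq_zero.2 hkl

/-- The character `t ↦ exp(i a t)` of the real line. -/
noncomputable def lineChar (a : ℝ) : Multiplicative ℝ →* ℂ where
  toFun t := Complex.exp (Complex.I * (a * (t.toAdd : ℝ)))
  map_one' := by simp
  map_mul' s t := by
    rw [← Complex.exp_add]; congr 1; push_cast [toAdd_mul]; ring

lemma lineChar_injective : Function.Injective lineChar := by
  intro a b hab
  have h : ∀ t : ℝ, Complex.exp (Complex.I * (a * t)) = Complex.exp (Complex.I * (b * t)) :=
    fun t => DFunLike.congr_fun hab (Multiplicative.ofAdd t)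
  have hd : ∀ c : ℝ, HasDerivAt (fun t : ℝ => Complex.exp (Complex.I * (c * t)))
      (Complex.I * c) 0 := by
    intro c
    have h1 : HasDerivAt (fun t : ℝ => Complex.I * ((c : ℂ) * (t : ℂ))) (Complex.I * (c * 1)) 0 :=
      ((Complex.ofRealCLM.hasDerivAt (x := 0)).const_mul (c : ℂ)).const_mul Complex.I
    simpa using h1.cexp
  have h2 := hd a
  rw [funext h] at h2
  have h3 := h2.unique (hd b)
  have h4 := mul_left_cancel₀ Complex.I_ne_zero h3
  exact_mod_cast h4

/-- An exponential sum with distinct real frequencies, not all of whose coefficients vanish, is not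
identically zero by independence of characters; being analytic, it has a null set of zeros. -/
lemma ae_expSum_ne_zero {ι : Type*} (s : Finset ι) (a : ι → ℝ) (ha : Set.InjOn a s) (c : ι → ℂ)
    (hc : ∃ k ∈ s, c k ≠ 0) :
    ∀ᵐ t : ℝ, ∑ k ∈ s, c k * Complex.exp (Complex.I * (a k * t)) ≠ 0 := by
  set f : ℝ → ℂ := fun t => ∑ k ∈ s, c k * Complex.exp (Complex.I * (a k * t)) with hf
  obtain ⟨t₀, ht₀⟩ : ∃ t, f t ≠ 0 := by
    by_contra! h
    obtain ⟨k, hk, hck⟩ := hc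
    have hli := (linearIndependent_monoidHom (Multiplicative ℝ) ℂ).comp
      (fun k : s => lineChar (a k)) (fun k l hkl =>
        Subtype.ext (ha k.2 l.2 (lineChar_injective hkl)))
    rw [Fintype.linearIndependent_iff] at hli
    refine hck (hli (fun k => c k) ?_ ⟨k, hk⟩)
    ext t
    have := h t.toAdd
    rw [hf] at this
    simp only [Function.comp_apply, Finset.sum_apply, Pi.smul_apply, smul_eq_mul, Pi.zero_apply]
    rw [← this]
    exact Finset.sum_coe_sort s fun k =>
      c k * Complex.exp (Complex.I * ((a k : ℂ) * ((t.toAdd : ℝ) : ℂ)))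
  have han : AnalyticOnNhd ℝ f Set.univ := by
    intro t _
    refine Finset.analyticAt_fun_sum _ fun k _ => analyticAt_const.mul ?_
    have h1 : AnalyticAt ℝ (fun t : ℝ => Complex.I * ((a k : ℂ) * (t : ℂ))) t :=
      analyticAt_const.mul (analyticAt_const.mul (Complex.ofRealCLM.analyticAt t))
    exact (analyticAt_cexp.restrictScalars (𝕜 := ℝ)).comp h1
  have h1 := han.preimage_zero_mem_codiscrete ht₀
  have h2 := ae_restrict_le_codiscreteWithin (μ := (volume : Measure ℝ)) MeasurableSet.univ h1
  rw [Measure.restrict_univ] at h2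
  filter_upwards [h2] with t ht using ht

/-- A nonzero trigonometric polynomial vanishes only on a null set: by Fubini it suffices to
consider the lines in a direction along which its frequencies stay distinct. -/
lemma TrigPoly.ae_eval_ne_zero (P : TrigPoly n) (hP : P ≠ 0) :
    ∀ᵐ ξ : RSpace n, TrigPoly.eval P ξ ≠ 0 := by
  obtain ⟨v, hv⟩ := exists_direction_injOn P.coeff.support
  have hmeas : MeasurableSet {ξ : RSpace n | TrigPoly.eval P ξ ≠ 0} :=
    (isOpen_ne_fun P.contDiff_eval.continuous continuous_const).measurableSet
  refine ae_mem_of_ae_add_linearMap_mem (LinearMap.toSpanSingleton ℝ (RSpace n) v)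
    (volume : Measure ℝ) volume hmeas fun y => ?_
  obtain ⟨k, hk⟩ := Finsupp.support_nonempty_iff.2 (by simpa using hP : P.coeff ≠ 0)
  change ∀ᵐ t : ℝ, TrigPoly.eval P (y + LinearMap.toSpanSingleton ℝ (RSpace n) v t) ≠ 0
  filter_upwards [ae_expSum_ne_zero P.coeff.support _ hv (fun k => P.coeff k * expi k y)
    ⟨k, hk, mul_ne_zero (Finsupp.mem_support_iff.1 hk)
      (norm_ne_zero_iff.1 (by simp [norm_expi]))⟩] with t ht
  convert ht using 1
  refine Finset.sum_congr rfl fun k _ => ?_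
  beta_reduce
  rw [expi_add_right, mul_assoc]
  congr 2
  simp only [expi, LinearMap.toSpanSingleton_apply, PiLp.smul_apply, smul_eq_mul]
  push_cast [Finset.sum_mul]
  congr 2
  exact Finset.sum_congr rfl fun i _ => by ring

lemma RatTrigPoly.ae_definedAt (r : RatTrigPoly n) : ∀ᵐ ξ : RSpace n, r.DefinedAt ξ :=
  TrigPoly.ae_eval_ne_zero _ r.den_ne_zero

lemma RatTrigPoly.eval_add_period (r : RatTrigPoly n) (ξ : RSpace n) (m : Fin n → ℤ) :
    r (ξ + (2 * Real.pi) • intVec m) = r ξ := by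
  simp only [RatTrigPoly.eval, TrigPoly.eval_add_period]

lemma RatTrigPoly.measurable_eval (r : RatTrigPoly n) : Measurable (r : RSpace n → ℂ) :=
  r.num.contDiff_eval.continuous.measurable.div r.den.contDiff_eval.continuous.measurable

lemma RatTrigPoly.definedAt_of_ne_zero (r : RatTrigPoly n) {ξ : RSpace n} (h : r ξ ≠ 0) :
    r.DefinedAt ξ := by
  intro h0
  exact h (by simp [RatTrigPoly.eval, h0])

/-- A rational trigonometric polynomial with a nonzero value is nonzero almost everywhere. -/
lemma RatTrigPoly.ae_ne_zero (r : RatTrigPoly n) {ξ₀ : RSpace n} (h : r ξ₀ ≠ 0) :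
    ∀ᵐ ξ : RSpace n, r ξ ≠ 0 := by
  have hnum : r.num ≠ 0 := by
    intro h0
    exact h (by simp [RatTrigPoly.eval, h0, TrigPoly.eval])
  filter_upwards [r.ae_definedAt, TrigPoly.ae_eval_ne_zero _ hnum] with ξ h1 h2
  exact div_ne_zero h2 h1

lemma RatTrigPoly.contDiffAt (r : RatTrigPoly n) {ξ : RSpace n} (h : r.DefinedAt ξ) :
    ContDiffAt ℝ 1 (r : RSpace n → ℂ) ξ :=
  r.num.contDiff_eval.contDiffAt.mul (r.den.contDiff_eval.contDiffAt.inv h)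

end Trig

/-! ### Orthogonality of the characters of `Λ` -/

section Characters

variable {n lam : ℕ}

/-- The sum of the powers of the `λ`-th root of unity `exp(2πi m/λ)`. -/
lemma sum_range_exp_eq (hlam : 0 < lam) (m : ℤ) :
    ∑ a : Fin lam, Complex.exp (Complex.I * ((a : ℕ) * (2 * Real.pi / lam * m))) =
      if (lam : ℤ) ∣ m then (lam : ℂ) else 0 := by
  have hl : (lam : ℂ) ≠ 0 := by exact_mod_cast hlam.ne'
  set z : ℂ := Complex.exp (Complex.I * (2 * Real.pi / lam * m)) with hz
  have h1 : ∀ a : ℕ, Complex.exp (Complex.I * (a * (2 * Real.pi / lam * m))) = z ^ a := by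
    intro a; rw [hz, ← Complex.exp_nat_mul]; congr 1; ring
  simp only [h1]
  rw [Fin.sum_univ_eq_sum_range (fun a => z ^ a)]
  have hone : z = 1 ↔ (lam : ℤ) ∣ m := by
    rw [hz, Complex.exp_eq_one_iff]
    have hpi : (2 * (Real.pi : ℂ) * Complex.I) ≠ 0 := Complex.two_pi_I_ne_zero
    constructor
    · rintro ⟨k, hk⟩
      refine ⟨k, ?_⟩
      have : (m : ℂ) = lam * k := by
        have h2 : (2 * (Real.pi : ℂ) * Complex.I) * (m / lam - k) = 0 := by
          rw [mul_sub]; linear_combination hk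
        have h3 := (mul_eq_zero.1 h2).resolve_left hpi
        field_simp at h3
        linear_combination h3
      exact_mod_cast this
    · rintro ⟨k, rfl⟩
      refine ⟨k, ?_⟩
      push_cast
      field_simp
  split_ifs with h
  · rw [hone.2 h]; simp
  · have hz1 : z ≠ 1 := fun h' => h (hone.1 h')
    rw [geom_sum_eq hz1]
    have : z ^ lam = 1 := by
      rw [← h1, Complex.exp_eq_one_iff]
      exact ⟨m, by field_simp⟩
    simp [this]

/-- Orthogonality of the characters of `(ℤ/λ)ⁿ`: the sum over `ν ∈ Λ` of `exp(i ν·γ)` at the point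
`γ = 2πm/λ`. -/
lemma sum_expLam_eq (hlam : 0 < lam) (m : Fin n → ℤ) :
    ∑ ν : Fin n → Fin lam, expLam ν ((2 * Real.pi / lam) • intVec m) =
      if ∀ i, (lam : ℤ) ∣ m i then (lam : ℂ) ^ n else 0 := by
  have h : ∀ ν : Fin n → Fin lam, expLam ν ((2 * Real.pi / lam) • intVec m) =
      ∏ i, Complex.exp (Complex.I * ((ν i : ℕ) * (2 * Real.pi / lam * m i))) := by
    intro ν
    rw [← Complex.exp_sum, expLam, expi, Finset.mul_sum]
    congr 1
    refine Finset.sum_congr rfl fun i _ => ?_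
    push_cast [intVec, PiLp.smul_apply, smul_eq_mul]; rfl
  simp only [h]
  rw [← Fintype.prod_sum (fun i (a : Fin lam) =>
    Complex.exp (Complex.I * (((a : ℕ) : ℂ) * (2 * Real.pi / lam * m i))))]
  simp only [sum_range_exp_eq hlam]
  split_ifs with h
  · simp [h]
  · push Not at h
    obtain ⟨i, hi⟩ := h
    exact Finset.prod_eq_zero (Finset.mem_univ i) (if_neg hi)

end Characters

/-! ### Periodic functions, the fundamental cube and unfolding -/

section Periodic

variable {n : ℕ}

/-- The half-open cube `(-1/2, 1/2]ⁿ`, a fundamental domain for `ℤⁿ`. It is centred at the origin,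
so that a function supported near `0` meets only one of its translates. -/
def cube (n : ℕ) : Set (RSpace n) := {ξ | ∀ i, ξ i ∈ Set.Ioc (-(1 / 2) : ℝ) (-(1 / 2) + 1)}

lemma measurableSet_cube : MeasurableSet (cube n) := by
  have : cube n = ⋂ i, (fun ξ : RSpace n => ξ i) ⁻¹' Set.Ioc (-(1 / 2) : ℝ) (-(1 / 2) + 1) := by
    ext ξ; simp [cube]
  rw [this]
  exact MeasurableSet.iInter fun i =>
    measurableSet_Ioc.preimage
      (contDiff_euclidean.1 (contDiff_id (𝕜 := ℝ) (n := 1)) i).continuous.measurable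

lemma existsUnique_add_intVec_mem_cube (ξ : RSpace n) :
    ∃! k : Fin n → ℤ, ξ + intVec k ∈ cube n := by
  choose k hk hk' using fun i : Fin n =>
    existsUnique_add_zsmul_mem_Ioc (zero_lt_one (α := ℝ)) (ξ i) (-(1 / 2))
  refine ⟨k, fun i => ?_, fun l hl => funext fun i => hk' i (l i) ?_⟩
  · simpa [intVec] using hk i
  · simpa [intVec] using hl i

lemma mem_cube_of_norm_lt {ξ : RSpace n} (h : ‖ξ‖ < 1 / 2) : ξ ∈ cube n := by
  intro i
  have := (abs_lt.1 ((PiLp.norm_apply_le ξ i).trans_lt h))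
  exact ⟨this.1, by linarith [this.2]⟩

lemma tsum_indicator_cube (ξ : RSpace n) :
    ∑' k : Fin n → ℤ, (cube n).indicator (1 : RSpace n → ℝ≥0∞) (ξ + intVec k) = 1 := by
  obtain ⟨k, hk, hk'⟩ := existsUnique_add_intVec_mem_cube ξ
  rw [tsum_eq_single k fun l hl => Set.indicator_of_notMem (fun h => hl (hk' l h)) _]
  simp [Set.indicator_of_mem hk]

lemma qmp_add (a : RSpace n) :
    Measure.QuasiMeasurePreserving (fun ξ : RSpace n => ξ + a) volume volume :=
  quasiMeasurePreserving_add_right volume a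

lemma qmp_smul {r : ℝ} (hr : r ≠ 0) :
    Measure.QuasiMeasurePreserving (fun ξ : RSpace n => r • ξ) volume volume :=
  Measure.quasiMeasurePreserving_smul volume hr

lemma ae_forall_add_intVec {p : RSpace n → Prop} (h : ∀ᵐ ξ, p ξ) :
    ∀ᵐ ξ, ∀ k : Fin n → ℤ, p (ξ + intVec k) :=
  ae_all_iff.2 fun k => (qmp_add (intVec k)).ae h

/-- Unfolding: integrating over space is integrating the periodization over the cube. -/
lemma lintegral_eq_setLIntegral_cube {G : RSpace n → ℝ≥0∞} (hG : AEMeasurable G) :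
    ∫⁻ ξ, G ξ = ∫⁻ ξ in cube n, ∑' k : Fin n → ℤ, G (ξ + intVec k) := by
  have hGk : ∀ k : Fin n → ℤ, AEMeasurable fun ξ => G (ξ + intVec k) := fun k =>
    hG.comp_quasiMeasurePreserving (qmp_add _)
  have hI : ∀ k : Fin n → ℤ, AEMeasurable fun ξ : RSpace n =>
      (cube n).indicator (1 : RSpace n → ℝ≥0∞) (ξ + intVec k) := fun k =>
    ((measurable_one.indicator measurableSet_cube).comp (measurable_add_const _)).aemeasurable
  calc ∫⁻ ξ, G ξ
      = ∫⁻ ξ, ∑' k : Fin n → ℤ, (cube n).indicator (1 : RSpace n → ℝ≥0∞) (ξ + intVec k) * G ξ := by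
        simp_rw [ENNReal.tsum_mul_right, tsum_indicator_cube, one_mul]
    _ = ∑' k : Fin n → ℤ, ∫⁻ ξ, (cube n).indicator (1 : RSpace n → ℝ≥0∞) (ξ + intVec k) * G ξ :=
        lintegral_tsum fun k => (hI k).mul hG
    _ = ∑' k : Fin n → ℤ, ∫⁻ ξ in cube n, G (ξ + intVec (-k)) := by
        refine tsum_congr fun k => ?_
        rw [← lintegral_add_right_eq_self _ (intVec (-k)), ← lintegral_indicator measurableSet_cube]
        refine lintegral_congr fun ξ => ?_
        rw [add_assoc, intVec_neg, neg_add_cancel, add_zero]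
        by_cases h : ξ ∈ cube n <;> simp [h]
    _ = ∑' k : Fin n → ℤ, ∫⁻ ξ in cube n, G (ξ + intVec k) :=
        (Equiv.neg (Fin n → ℤ)).tsum_eq fun k => ∫⁻ ξ in cube n, G (ξ + intVec k)
    _ = _ := (lintegral_tsum fun k => (hGk k).restrict).symm

/-- Unfolding for a periodic function times a function whose periodization is constant. -/
lemma lintegral_mul_of_tsum_eq {w A : RSpace n → ℝ≥0∞} (hw : AEMeasurable w)
    (hA : AEMeasurable A) (hper : ∀ ξ (k : Fin n → ℤ), w (ξ + intVec k) = w ξ) {c : ℝ≥0∞}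
    (hc : ∀ ξ, ∑' k : Fin n → ℤ, A (ξ + intVec k) = c) :
    ∫⁻ ξ, w ξ * A ξ = c * ∫⁻ ξ in cube n, w ξ := by
  rw [lintegral_eq_setLIntegral_cube (G := fun ξ => w ξ * A ξ) (hw.mul hA)]
  simp_rw [hper, ENNReal.tsum_mul_left, hc]
  rw [lintegral_mul_const'' _ hw.restrict, mul_comm]

lemma setLIntegral_cube_add {w : RSpace n → ℝ≥0∞} (hw : AEMeasurable w)
    (hper : ∀ ξ (k : Fin n → ℤ), w (ξ + intVec k) = w ξ) (a : RSpace n) :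
    ∫⁻ ξ in cube n, w (ξ + a) = ∫⁻ ξ in cube n, w ξ := by
  have h1 : ∫⁻ ξ in cube n, w (ξ + a) =
      ∫⁻ ξ, w (ξ + a) * (cube n).indicator (1 : RSpace n → ℝ≥0∞) ξ := by
    rw [← lintegral_indicator measurableSet_cube]
    refine lintegral_congr fun ξ => ?_
    by_cases h : ξ ∈ cube n <;> simp [h]
  rw [h1, ← lintegral_add_right_eq_self _ (-a)]
  simp only [neg_add_cancel_right]
  have hA : Measurable fun ξ : RSpace n => (cube n).indicator (1 : RSpace n → ℝ≥0∞) (ξ + -a) :=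
    (measurable_one.indicator measurableSet_cube).comp (measurable_add_const _)
  rw [lintegral_mul_of_tsum_eq hw hA.aemeasurable hper (c := 1), one_mul]
  intro ξ
  simp only [add_right_comm ξ _ (-a)]
  exact tsum_indicator_cube _

/-- Base-`λ` division with remainder on `ℤⁿ`: `(m, k) ↦ λ k + m` for `m ∈ {0, …, λ-1}ⁿ`. -/
def digitEquiv (n lam : ℕ) [NeZero lam] : (Fin n → Fin lam) × (Fin n → ℤ) ≃ (Fin n → ℤ) :=
  ((Equiv.prodComm _ _).trans (Equiv.arrowProdEquivProdArrow _ _ _).symm).trans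
    (Equiv.arrowCongr (Equiv.refl _) (Int.divModEquiv lam).symm)

/-- The vector `m / λ` attached to `m ∈ {0, …, λ-1}ⁿ`. -/
noncomputable def digitVec {n lam : ℕ} (m : Fin n → Fin lam) : RSpace n :=
  (lam : ℝ)⁻¹ • intVec fun i => ((m i : ℕ) : ℤ)

lemma digitEquiv_apply {lam : ℕ} [NeZero lam] (m : Fin n → Fin lam) (k : Fin n → ℤ) :
    intVec (digitEquiv n lam (m, k)) = (lam : ℝ) • (digitVec m + intVec k) := by
  have hl : (lam : ℝ) ≠ 0 := by exact_mod_cast NeZero.ne lam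
  ext i
  simp [digitEquiv, digitVec, intVec, Int.divModEquiv, hl, Equiv.arrowCongr,
    Equiv.arrowProdEquivProdArrow]
  field_simp
  ring

lemma smul_add_digit {lam : ℕ} [NeZero lam] (ξ : RSpace n) (m : Fin n → Fin lam)
    (k : Fin n → ℤ) : (lam : ℝ) • ξ + intVec (digitEquiv n lam (m, k)) =
      (lam : ℝ) • (ξ + digitVec m + intVec k) := by
  rw [digitEquiv_apply, ← smul_add, add_assoc]

/-- Splitting a sum over `ℤⁿ` into residue classes modulo `λ`. -/
lemma tsum_smul_add_intVec {lam : ℕ} [NeZero lam] (f : RSpace n → ℝ≥0∞) (ξ : RSpace n) :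
    ∑' k : Fin n → ℤ, f ((lam : ℝ) • ξ + intVec k) =
      ∑ m : Fin n → Fin lam, ∑' k : Fin n → ℤ, f ((lam : ℝ) • (ξ + digitVec m + intVec k)) := by
  rw [← (digitEquiv n lam).tsum_eq, ← tsum_fintype (L := .unconditional _), ← ENNReal.tsum_prod]
  exact tsum_congr fun p => by rw [← smul_add_digit]

/-- The dilation `ξ ↦ λξ` preserves the mean of a periodic function. -/
lemma setLIntegral_cube_smul {lam : ℕ} [NeZero lam] {w : RSpace n → ℝ≥0∞} (hw : AEMeasurable w)
    (hper : ∀ ξ (k : Fin n → ℤ), w (ξ + intVec k) = w ξ) :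
    ∫⁻ ξ in cube n, w ((lam : ℝ) • ξ) = ∫⁻ ξ in cube n, w ξ := by
  have hl : (lam : ℝ) ≠ 0 := by exact_mod_cast NeZero.ne lam
  have h1 : ∫⁻ ξ in cube n, w ((lam : ℝ) • ξ) = ∫⁻ ξ, w ((lam : ℝ) • ξ) *
      (cube n).indicator (1 : RSpace n → ℝ≥0∞) ((lam : ℝ)⁻¹ • (lam : ℝ) • ξ) := by
    rw [← lintegral_indicator measurableSet_cube]
    refine lintegral_congr fun ξ => ?_
    rw [inv_smul_smul₀ hl]
    by_cases h : ξ ∈ cube n <;> simp [h]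
  have hA : Measurable fun ξ : RSpace n =>
      (cube n).indicator (1 : RSpace n → ℝ≥0∞) ((lam : ℝ)⁻¹ • ξ) :=
    (measurable_one.indicator measurableSet_cube).comp (measurable_const_smul _)
  have hwA := hw.mul hA.aemeasurable
  rw [h1]
  have h2 := Measure.map_addHaar_smul (volume : Measure (RSpace n)) hl
  rw [← lintegral_map' (f := fun ξ => w ξ *
      (cube n).indicator (1 : RSpace n → ℝ≥0∞) ((lam : ℝ)⁻¹ • ξ)) (by
        rw [h2]; exact hwA.smul_measure _) (measurable_const_smul _).aemeasurable, h2,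
    lintegral_smul_measure,
    lintegral_mul_of_tsum_eq hw hA.aemeasurable hper (c := (lam : ℝ≥0∞) ^ n), ← smul_eq_mul,
    smul_smul, smul_eq_mul]
  · have h3 : ENNReal.ofReal |((lam : ℝ) ^ Module.finrank ℝ (RSpace n))⁻¹| =
        ((lam : ℝ≥0∞) ^ n)⁻¹ := by
      rw [finrank_euclideanSpace_fin, abs_of_nonneg (by positivity),
        ENNReal.ofReal_inv_of_pos (by positivity), ENNReal.ofReal_pow (by positivity),
        ENNReal.ofReal_natCast]
    rw [h3, ENNReal.inv_mul_cancel, one_mul]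
    · simpa using fun h => absurd h (NeZero.ne lam)
    · exact ENNReal.pow_ne_top (ENNReal.natCast_ne_top _)
  · -- the `ℤⁿ`-translates of the dilated cube cover every point `λⁿ` times
    intro ξ
    obtain ⟨η, rfl⟩ : ∃ η : RSpace n, ξ = (lam : ℝ) • η :=
      ⟨(lam : ℝ)⁻¹ • ξ, (smul_inv_smul₀ hl ξ).symm⟩
    rw [tsum_smul_add_intVec (fun ξ : RSpace n =>
      (cube n).indicator (1 : RSpace n → ℝ≥0∞) ((lam : ℝ)⁻¹ • ξ))]
    simp_rw [inv_smul_smul₀ hl, tsum_indicator_cube]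
    simp

/-- Unfolding of the integral of an integrable function. -/
lemma integral_eq_setIntegral_cube {G : RSpace n → ℂ} (hG : Integrable G) :
    ∫ ξ, G ξ = ∫ ξ in cube n, ∑' k : Fin n → ℤ, G (ξ + intVec k) := by
  have hfin : ∫⁻ ξ, ‖G ξ‖ₑ ≠ ∞ := hG.2.ne
  have hI : ∀ k : Fin n → ℤ, Measurable fun ξ : RSpace n =>
      (cube n).indicator (1 : RSpace n → ℂ) (ξ + intVec k) := fun k =>
    (measurable_one.indicator measurableSet_cube).comp (measurable_add_const _)
  have hone : ∀ ξ : RSpace n, ∑' k : Fin n → ℤ,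
      (cube n).indicator (1 : RSpace n → ℂ) (ξ + intVec k) * G ξ = G ξ := by
    intro ξ
    obtain ⟨k, hk, hk'⟩ := existsUnique_add_intVec_mem_cube ξ
    rw [tsum_eq_single k fun l hl => by
      rw [Set.indicator_of_notMem (fun h => hl (hk' l h)), zero_mul]]
    simp [Set.indicator_of_mem hk]
  have hGk : ∀ k : Fin n → ℤ, Integrable fun ξ => G (ξ + intVec k) := fun k =>
    hG.comp_add_right _
  have hfin2 : ∑' k : Fin n → ℤ, ∫⁻ ξ in cube n, ‖G (ξ + intVec k)‖ₑ ≠ ∞ := by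
    rw [← lintegral_tsum fun k => (hGk k).1.enorm.restrict,
      ← lintegral_eq_setLIntegral_cube hG.1.enorm]
    exact hfin
  have hterm : ∀ (k : Fin n → ℤ), ∀ ξ : RSpace n,
      (cube n).indicator (1 : RSpace n → ℂ) (ξ + intVec (-k) + intVec k) * G (ξ + intVec (-k)) =
      (cube n).indicator (fun ξ => G (ξ + intVec (-k))) ξ := by
    intro k ξ
    rw [add_assoc, intVec_neg, neg_add_cancel, add_zero]
    by_cases h : ξ ∈ cube n <;> simp [h]
  calc ∫ ξ, G ξ
      = ∫ ξ, ∑' k : Fin n → ℤ, (cube n).indicator (1 : RSpace n → ℂ) (ξ + intVec k) * G ξ := by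
        simp_rw [hone]
    _ = ∑' k : Fin n → ℤ, ∫ ξ, (cube n).indicator (1 : RSpace n → ℂ) (ξ + intVec k) * G ξ := by
        refine integral_tsum (fun k => (hI k).aestronglyMeasurable.mul hG.1) ?_
        rw [← (Equiv.neg (Fin n → ℤ)).tsum_eq] at hfin2
        convert hfin2 using 3 with k
        rw [← lintegral_add_right_eq_self _ (intVec (-k)), ← lintegral_indicator measurableSet_cube]
        refine lintegral_congr fun ξ => ?_
        rw [hterm, enorm_indicator_eq_indicator_enorm]
        rfl
    _ = ∑' k : Fin n → ℤ, ∫ ξ in cube n, G (ξ + intVec (-k)) := by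
        refine tsum_congr fun k => ?_
        rw [← integral_add_right_eq_self _ (intVec (-k)), ← integral_indicator measurableSet_cube]
        exact integral_congr_ae (Eventually.of_forall fun ξ => hterm k ξ)
    _ = ∑' k : Fin n → ℤ, ∫ ξ in cube n, G (ξ + intVec k) :=
        (Equiv.neg (Fin n → ℤ)).tsum_eq fun k => ∫ ξ in cube n, G (ξ + intVec k)
    _ = _ := (integral_tsum (fun k => (hGk k).1.restrict) hfin2).symm

end Periodic

/-! ### Parseval's identity on the cube -/

section Parseval

variable {n : ℕ}

/-- The circle carries its probability Haar measure, for which Mathlib states Parseval's identity on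
the torus. -/
noncomputable local instance : MeasureSpace UnitAddCircle := ⟨AddCircle.haarAddCircle⟩

/-- The section `ℝⁿ/ℤⁿ → (-1/2, 1/2]ⁿ` of the quotient map. -/
noncomputable def torusRep (n : ℕ) (t : UnitAddTorus (Fin n)) : RSpace n :=
  WithLp.toLp 2 (UnitAddTorus.measurableEquivPiIoc (fun _ : Fin n => (-(1 / 2) : ℝ)) t : Fin n → ℝ)

lemma measurePreserving_torusRep :
    MeasurePreserving (torusRep n) volume (volume.restrict (cube n)) := by
  have h1 := UnitAddTorus.measurePreserving_equivPiIoc (fun _ : Fin n => (-(1 / 2) : ℝ))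
  have hs : MeasurableSet
      {x : Fin n → ℝ | ∀ i, x i ∈ Set.Ioc (-(1 / 2) : ℝ) (-(1 / 2) + 1)} :=
    MeasurableSet.univ_pi' fun i => measurableSet_Ioc
  have h2 := measurePreserving_subtype_coe (μa := (volume : Measure (Fin n → ℝ))) hs
  have h3 := (PiLp.volume_preserving_toLp (Fin n)).restrict_preimage (measurableSet_cube (n := n))
  exact h3.comp (h2.comp h1)

lemma volume_cube : volume (cube n) = 1 := by
  rw [← Measure.restrict_apply_univ, ← measurePreserving_torusRep.map_eq,
    Measure.map_apply measurePreserving_torusRep.measurable MeasurableSet.univ, Set.preimage_univ]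
  have : IsProbabilityMeasure (volume : Measure UnitAddCircle) :=
    inferInstanceAs (IsProbabilityMeasure AddCircle.haarAddCircle)
  exact measure_univ

/-- Lifted to the cube, the characters of the torus are the exponentials `exp(2πi m·ξ)`. -/
lemma mFourier_eq_expi (m : Fin n → ℤ) (t : UnitAddTorus (Fin n)) :
    UnitAddTorus.mFourier m t = expi m ((2 * Real.pi) • torusRep n t) := by
  have ht : t = fun i => ((torusRep n t i : ℝ) : UnitAddCircle) :=
    ((UnitAddTorus.measurableEquivPiIoc (fun _ : Fin n => (-(1 / 2) : ℝ))).symm_apply_apply t).symm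
  conv_lhs => rw [ht]
  simp only [UnitAddTorus.mFourier, ContinuousMap.coe_mk, fourier_coe_apply, expi]
  rw [← Complex.exp_sum, Finset.mul_sum]
  congr 1
  refine Finset.sum_congr rfl fun i _ => ?_
  push_cast [PiLp.smul_apply, smul_eq_mul]
  ring

/-- **Parseval's identity** for Fourier series on the cube. -/
lemma tsum_enorm_sq_fourierCoeff {u : RSpace n → ℂ} (hu : MemLp u 2 (volume.restrict (cube n))) :
    ∑' m : Fin n → ℤ, ‖∫ ξ in cube n, expi m ((2 * Real.pi) • ξ) * u ξ‖ₑ ^ 2 =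
      ∫⁻ ξ in cube n, ‖u ξ‖ₑ ^ 2 := by
  have hR := measurePreserving_torusRep (n := n)
  have hU : MemLp (u ∘ torusRep n) 2 volume := hu.comp_measurePreserving hR
  have hP := UnitAddTorus.hasSum_sq_mFourierCoeff hU.toLp
  have hcoef : ∀ m, UnitAddTorus.mFourierCoeff hU.toLp m =
      ∫ ξ in cube n, expi (-m) ((2 * Real.pi) • ξ) * u ξ := by
    intro m
    rw [UnitAddTorus.mFourierCoeff, ← hR.map_eq, integral_map hR.aemeasurable]
    · refine integral_congr_ae ?_
      filter_upwards [hU.coeFn_toLp] with t ht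
      rw [ht, mFourier_eq_expi, smul_eq_mul, Function.comp_apply]
    · rw [hR.map_eq]
      refine (Continuous.aestronglyMeasurable ?_).mul hu.1
      exact (contDiff_expi _).continuous.comp (continuous_const_smul _)
  have hnorm : ∫ t, ‖hU.toLp (u ∘ torusRep n) t‖ ^ 2 = (∫⁻ ξ in cube n, ‖u ξ‖ₑ ^ 2).toReal := by
    rw [integral_eq_lintegral_of_nonneg_ae (f := fun t => ‖hU.toLp (u ∘ torusRep n) t‖ ^ 2)
      (Eventually.of_forall fun _ => by positivity)
      ((Lp.aestronglyMeasurable _).norm.pow 2)]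
    congr 1
    rw [← hR.map_eq, lintegral_map' _ hR.aemeasurable]
    · refine lintegral_congr_ae ?_
      filter_upwards [hU.coeFn_toLp] with t ht
      rw [ht, ENNReal.ofReal_pow (norm_nonneg _), ofReal_norm, Function.comp_apply]
    · rw [hR.map_eq]
      exact hu.1.enorm.pow_const 2
  have hfin : ∫⁻ ξ in cube n, ‖u ξ‖ₑ ^ 2 ≠ ∞ := by
    have := hu.2
    rw [eLpNorm_lt_top_iff_lintegral_rpow_enorm_lt_top (by norm_num) (by norm_num)] at this
    simpa using this.ne
  rw [← ENNReal.ofReal_toReal hfin, ← hnorm, ← hP.tsum_eq,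
    ENNReal.ofReal_tsum_of_nonneg (fun _ => by positivity) hP.summable,
    ← (Equiv.neg (Fin n → ℤ)).tsum_eq]
  refine tsum_congr fun m => ?_
  rw [hcoef, ENNReal.ofReal_pow (norm_nonneg _), ofReal_norm]
  rfl

end Parseval

/-! ### Bracket products -/

section Bracket

variable {n : ℕ}

/-- The bracket product `[h, Φ](ξ) = ∑ₖ h(ξ + k) conj Φ(ξ + k)`. -/
noncomputable def bracket (h Φ : RSpace n → ℂ) (ξ : RSpace n) : ℂ :=
  ∑' k : Fin n → ℤ, h (ξ + intVec k) * conj (Φ (ξ + intVec k))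

/-- The periodized square `[h, h](ξ) = ∑ₖ |h(ξ + k)|²`, with values in `[0, ∞]`. -/
noncomputable def perSq (h : RSpace n → ℂ) (ξ : RSpace n) : ℝ≥0∞ :=
  ∑' k : Fin n → ℤ, ‖h (ξ + intVec k)‖ₑ ^ 2

lemma tsum_shift_intVec {α : Type*} [AddCommMonoid α] [TopologicalSpace α]
    (f : RSpace n → α) (ξ : RSpace n) (l : Fin n → ℤ) :
    ∑' k : Fin n → ℤ, f (ξ + intVec l + intVec k) = ∑' k : Fin n → ℤ, f (ξ + intVec k) := by
  rw [← (Equiv.addLeft l).tsum_eq fun k => f (ξ + intVec k)]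
  exact tsum_congr fun k => by rw [Equiv.coe_addLeft, intVec_add, add_assoc]

lemma bracket_add_intVec (h Φ : RSpace n → ℂ) (ξ : RSpace n) (l : Fin n → ℤ) :
    bracket h Φ (ξ + intVec l) = bracket h Φ ξ :=
  tsum_shift_intVec (fun η => h η * conj (Φ η)) ξ l

lemma perSq_add_intVec (h : RSpace n → ℂ) (ξ : RSpace n) (l : Fin n → ℤ) :
    perSq h (ξ + intVec l) = perSq h ξ :=
  tsum_shift_intVec (fun η => ‖h η‖ₑ ^ 2) ξ l

lemma aemeasurable_perSq {h : RSpace n → ℂ} (hh : AEStronglyMeasurable h) :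
    AEMeasurable (perSq h) :=
  AEMeasurable.tsum fun k =>
    ((hh.enorm.pow_const 2).comp_quasiMeasurePreserving (qmp_add (intVec k)))

lemma aestronglyMeasurable_bracket {h Φ : RSpace n → ℂ} (hh : AEStronglyMeasurable h)
    (hΦ : AEStronglyMeasurable Φ) : AEStronglyMeasurable (bracket h Φ) := by
  have : ∀ k : Fin n → ℤ, AEStronglyMeasurable fun ξ : RSpace n =>
      h (ξ + intVec k) * conj (Φ (ξ + intVec k)) := fun k =>
    (hh.comp_quasiMeasurePreserving (qmp_add (intVec k))).mul
      (Complex.continuous_conj.comp_aestronglyMeasurable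
        (hΦ.comp_quasiMeasurePreserving (qmp_add (intVec k))))
  choose g hg hg' using this
  refine ⟨fun ξ => ∑' k, g k ξ, ?_, ?_⟩
  · exact (Measurable.tsum fun k => (hg k).measurable).stronglyMeasurable
  · filter_upwards [ae_all_iff.2 hg'] with ξ hξ
    exact tsum_congr hξ

lemma lintegral_perSq {h : RSpace n → ℂ} (hh : AEStronglyMeasurable h) :
    ∫⁻ ξ in cube n, perSq h ξ = ∫⁻ ξ, ‖h ξ‖ₑ ^ 2 :=
  (lintegral_eq_setLIntegral_cube (hh.enorm.pow_const 2)).symm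

lemma ae_of_ae_cube {p : RSpace n → Prop} (hper : ∀ ξ (k : Fin n → ℤ), p (ξ + intVec k) → p ξ)
    (h : ∀ᵐ ξ ∂(volume.restrict (cube n)), p ξ) : ∀ᵐ ξ, p ξ := by
  rw [ae_restrict_iff' measurableSet_cube] at h
  filter_upwards [ae_forall_add_intVec h] with ξ hξ
  obtain ⟨k, hk, -⟩ := existsUnique_add_intVec_mem_cube ξ
  exact hper ξ k (hξ k hk)

lemma lintegral_enorm_sq_ne_top {h : RSpace n → ℂ} (hh : MemLp h 2) :
    ∫⁻ ξ, ‖h ξ‖ₑ ^ 2 ≠ ∞ := by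
  have := hh.2
  rw [eLpNorm_lt_top_iff_lintegral_rpow_enorm_lt_top (by norm_num) (by norm_num)] at this
  simpa using this.ne

lemma ae_perSq_ne_top {h : RSpace n → ℂ} (hh : MemLp h 2) : ∀ᵐ ξ, perSq h ξ ≠ ∞ := by
  refine ae_of_ae_cube (fun ξ k hk => by rwa [perSq_add_intVec] at hk) ?_
  have := ae_lt_top' (aemeasurable_perSq hh.1).restrict (by
    rw [lintegral_perSq hh.1]; exact lintegral_enorm_sq_ne_top hh)
  filter_upwards [this] with ξ hξ using hξ.ne

/-- The **Cauchy–Schwarz inequality** for sums in `[0, ∞]`. -/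
lemma tsum_mul_sq_le {ι : Type*} (a b : ι → ℝ≥0∞) :
    (∑' i, a i * b i) ^ 2 ≤ (∑' i, a i ^ 2) * ∑' i, b i ^ 2 := by
  rw [ENNReal.tsum_eq_iSup_sum]
  have key : ∀ s : Finset ι, (∑ i ∈ s, a i * b i) ≤
      ((∑' i, a i ^ 2) * ∑' i, b i ^ 2) ^ (1 / 2 : ℝ) := by
    intro s
    refine (ENNReal.inner_le_Lp_mul_Lq s a b Real.HolderConjugate.two_two).trans ?_
    rw [ENNReal.mul_rpow_of_nonneg _ _ (by norm_num)]
    simp only [ENNReal.rpow_two]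
    gcongr <;> exact ENNReal.sum_le_tsum s
  calc _ ≤ (((∑' i, a i ^ 2) * ∑' i, b i ^ 2) ^ (1 / 2 : ℝ)) ^ 2 := by
        gcongr; exact iSup_le key
    _ = _ := by
        rw [← ENNReal.rpow_natCast, ← ENNReal.rpow_mul]; norm_num

lemma tsum_enorm_bracket_sq_le (h Φ : RSpace n → ℂ) (ξ : RSpace n) :
    (∑' k : Fin n → ℤ, ‖h (ξ + intVec k) * conj (Φ (ξ + intVec k))‖ₑ) ^ 2 ≤
      perSq h ξ * perSq Φ ξ := by
  simp only [enorm_mul, RCLike.enorm_conj]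
  exact tsum_mul_sq_le _ _

lemma enorm_bracket_sq_le (h Φ : RSpace n → ℂ) (ξ : RSpace n) :
    ‖bracket h Φ ξ‖ₑ ^ 2 ≤ perSq h ξ * perSq Φ ξ := by
  refine le_trans ?_ (tsum_enorm_bracket_sq_le h Φ ξ)
  gcongr
  exact enorm_tsum_le_tsum_enorm

lemma summable_bracket {h Φ : RSpace n → ℂ} {ξ : RSpace n} (hh : perSq h ξ ≠ ∞)
    (hΦ : perSq Φ ξ ≠ ∞) :
    Summable fun k : Fin n → ℤ => h (ξ + intVec k) * conj (Φ (ξ + intVec k)) := by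
  have h1 := (tsum_enorm_bracket_sq_le h Φ ξ).trans_lt (ENNReal.mul_lt_top hh.lt_top hΦ.lt_top)
  refine Summable.of_enorm fun h0 => ?_
  rw [h0] at h1
  simp at h1

/-- The `m`-th Fourier coefficient of a bracket product is an inner product with a modulation. -/
lemma integral_mul_conj_mul_expi {h Ψ : RSpace n → ℂ} (hh : MemLp h 2) (hΨ : MemLp Ψ 2)
    (m : Fin n → ℤ) :
    ∫ ξ, h ξ * conj (Ψ ξ) * expi m ((2 * Real.pi) • ξ) =
      ∫ ξ in cube n, expi m ((2 * Real.pi) • ξ) * bracket h Ψ ξ := by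
  have hint : Integrable fun ξ => h ξ * conj (Ψ ξ) := hh.integrable_mul hΨ.star
  have hint2 : Integrable fun ξ => h ξ * conj (Ψ ξ) * expi m ((2 * Real.pi) • ξ) := by
    refine hint.mul_bdd (c := 1) ?_ (Eventually.of_forall fun ξ => (norm_expi _ _).le)
    exact ((contDiff_expi m).continuous.comp (continuous_const_smul _)).aestronglyMeasurable
  rw [integral_eq_setIntegral_cube hint2]
  refine integral_congr_ae (Eventually.of_forall fun ξ => ?_)
  simp only [smul_add, expi_add_right, expi_intVec, mul_one, bracket]
  rw [tsum_mul_right, mul_comm]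

/-- The coefficients of `h` against the modulations of `Ψ` have the energy of the bracket. -/
lemma tsum_enorm_sq_coeff {h Ψ : RSpace n → ℂ} (hh : MemLp h 2) (hΨ : MemLp Ψ 2)
    (hb : ∫⁻ ξ in cube n, ‖bracket h Ψ ξ‖ₑ ^ 2 ≠ ∞) :
    ∑' m : Fin n → ℤ, ‖∫ ξ, h ξ * conj (Ψ ξ) * expi m ((2 * Real.pi) • ξ)‖ₑ ^ 2 =
      ∫⁻ ξ in cube n, ‖bracket h Ψ ξ‖ₑ ^ 2 := by
  simp_rw [integral_mul_conj_mul_expi hh hΨ]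
  refine tsum_enorm_sq_fourierCoeff
    ⟨(aestronglyMeasurable_bracket hh.1 hΨ.1).restrict, ?_⟩
  rw [eLpNorm_lt_top_iff_lintegral_rpow_enorm_lt_top (by norm_num) (by norm_num)]
  simpa using hb.lt_top

lemma setLIntegral_bracket_le {h Φ : RSpace n → ℂ} (hh : AEStronglyMeasurable h) {C : ℝ≥0}
    (hΦ : ∀ᵐ ξ, perSq Φ ξ ≤ C) :
    ∫⁻ ξ in cube n, ‖bracket h Φ ξ‖ₑ ^ 2 ≤ C * ∫⁻ ξ, ‖h ξ‖ₑ ^ 2 := by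
  rw [← lintegral_perSq hh, ← lintegral_const_mul' _ _ ENNReal.coe_ne_top]
  refine lintegral_mono_ae (ae_restrict_of_ae ?_)
  filter_upwards [hΦ] with ξ hξ
  rw [mul_comm]
  exact (enorm_bracket_sq_le _ _ _).trans (by gcongr)

end Bracket

/-! ### Bound on the bracket of the refinable function -/

section TransferOperator

variable {n lam : ℕ} [NeZero lam]

/-- The cut-off iterate `∏_{j<J} t(λ^{-j-1}ξ) · v(λ^{-J}ξ) · 1_{cube}(λ^{-J}ξ)`. -/
noncomputable def cutoffIterate (lam : ℕ) (t v : RSpace n → ℝ≥0∞) (J : ℕ) (ξ : RSpace n) : ℝ≥0∞ :=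
  (∏ j ∈ Finset.range J, t (((lam : ℝ) ^ (j + 1))⁻¹ • ξ)) * v (((lam : ℝ) ^ J)⁻¹ • ξ) *
    (cube n).indicator 1 (((lam : ℝ) ^ J)⁻¹ • ξ)

/-- If `v` is a supersolution of the transfer operator with weight `t`, then the cut-off
iterates have periodizations bounded by `v`. -/
lemma ae_tsum_iterate_le {t v : RSpace n → ℝ≥0∞}
    (ht : ∀ ξ (k : Fin n → ℤ), t (ξ + intVec k) = t ξ)
    (hv : ∀ ξ (k : Fin n → ℤ), v (ξ + intVec k) = v ξ)
    (hsub : ∀ᵐ ξ, ∑ m : Fin n → Fin lam, t (ξ + digitVec m) * v (ξ + digitVec m) ≤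
      v ((lam : ℝ) • ξ)) (J : ℕ) :
    ∀ᵐ ξ, ∑' k : Fin n → ℤ, cutoffIterate lam t v J (ξ + intVec k) ≤ v ξ := by
  have hl : (lam : ℝ) ≠ 0 := by exact_mod_cast NeZero.ne lam
  induction J with
  | zero =>
    refine Eventually.of_forall fun ξ => ?_
    simp only [cutoffIterate, Finset.range_zero, Finset.prod_empty, one_mul, pow_zero, inv_one,
      one_smul, hv, ENNReal.tsum_mul_left, tsum_indicator_cube, mul_one, le_refl]
  | succ J ih =>
    have h1 : ∀ᵐ η : RSpace n, ∀ m : Fin n → Fin lam, _ :=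
      ae_all_iff.2 fun m => (qmp_add (digitVec m)).ae ih
    have h2 := (qmp_smul (n := n) (inv_ne_zero hl)).ae (h1.and hsub)
    filter_upwards [h2] with ξ hξ
    obtain ⟨η, rfl⟩ : ∃ η : RSpace n, ξ = (lam : ℝ) • η :=
      ⟨(lam : ℝ)⁻¹ • ξ, (smul_inv_smul₀ hl ξ).symm⟩
    rw [inv_smul_smul₀ hl] at hξ
    -- summing over residue classes modulo `λ` exhibits one step of the transfer operator
    rw [tsum_smul_add_intVec (cutoffIterate lam t v (J + 1))]
    refine le_trans (Finset.sum_le_sum fun m _ => ?_) hξ.2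
    have hdil : ∀ (j : ℕ) (ζ : RSpace n),
        ((lam : ℝ) ^ (j + 1))⁻¹ • (lam : ℝ) • ζ = ((lam : ℝ) ^ j)⁻¹ • ζ := by
      intro j ζ
      rw [smul_smul, pow_succ]; congr 1; field_simp
    refine le_trans (le_of_eq ?_) (mul_le_mul_right (hξ.1 m) (t (η + digitVec m)))
    rw [← ENNReal.tsum_mul_left]
    refine tsum_congr fun k => ?_
    simp only [cutoffIterate, hdil]
    rw [Finset.prod_range_succ', pow_zero, inv_one, one_smul, ht]
    ring

/-- The bracket of a refinable function is bounded by a supersolution of the transfer operator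
which is continuous and normalised at the origin. The cut-offs tend to `1` pointwise, so this is
Fatou's lemma for the iterates. -/
lemma ae_tsum_limit_le {t v F : RSpace n → ℝ≥0∞}
    (ht : ∀ ξ (k : Fin n → ℤ), t (ξ + intVec k) = t ξ)
    (hv : ∀ ξ (k : Fin n → ℤ), v (ξ + intVec k) = v ξ)
    (hsub : ∀ᵐ ξ, ∑ m : Fin n → Fin lam, t (ξ + digitVec m) * v (ξ + digitVec m) ≤
      v ((lam : ℝ) • ξ)) (hlam : 2 ≤ lam) (hv0 : Tendsto v (𝓝 0) (𝓝 1))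
    (hF : ∀ ξ, Tendsto (fun J => ∏ j ∈ Finset.range J, t (((lam : ℝ) ^ (j + 1))⁻¹ • ξ)) atTop
      (𝓝 (F ξ))) :
    ∀ᵐ ξ, ∑' k : Fin n → ℤ, F (ξ + intVec k) ≤ v ξ := by
  filter_upwards [ae_all_iff.2 (ae_tsum_iterate_le ht hv hsub)] with ξ hξ
  have hz : ∀ η : RSpace n, Tendsto (fun J : ℕ => ((lam : ℝ) ^ J)⁻¹ • η) atTop (𝓝 0) := by
    intro η
    have h1 : Tendsto (fun J : ℕ => ((lam : ℝ) ^ J)⁻¹) atTop (𝓝 0) :=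
      tendsto_inv_atTop_zero.comp (tendsto_pow_atTop_atTop_of_one_lt
        (by exact_mod_cast hlam))
    simpa using h1.smul_const η
  rw [ENNReal.tsum_eq_iSup_sum]
  refine iSup_le fun s => ?_
  refine le_of_tendsto (x := atTop) (f := fun J => ∑ k ∈ s, cutoffIterate lam t v J (ξ + intVec k))
    (tendsto_finsetSum s fun k _ => ?_) (Eventually.of_forall fun J =>
    (ENNReal.sum_le_tsum s).trans (hξ J))
  have h1 : Tendsto (fun J : ℕ => (cube n).indicator (1 : RSpace n → ℝ≥0∞)
      (((lam : ℝ) ^ J)⁻¹ • (ξ + intVec k))) atTop (𝓝 1) := by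
    refine tendsto_const_nhds.congr' ?_
    filter_upwards [(hz (ξ + intVec k)).eventually
      (Metric.ball_mem_nhds 0 (by norm_num : (0 : ℝ) < 1 / 2))] with J hJ
    rw [Set.indicator_of_mem (mem_cube_of_norm_lt (by simpa using hJ))]
    rfl
  have h2 := ENNReal.Tendsto.mul (hF (ξ + intVec k)) (Or.inr ENNReal.one_ne_top)
    (hv0.comp (hz (ξ + intVec k))) (Or.inl one_ne_zero)
  have h3 := ENNReal.Tendsto.mul h2 (Or.inr ENNReal.one_ne_top) h1 (Or.inl one_ne_zero)
  simpa [cutoffIterate] using h3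

end TransferOperator

/-! ### Dilations on the Fourier side -/

section Dilation

variable {n : ℕ}

lemma lintegral_comp_smul {r : ℝ} (hr : 0 < r) {g : RSpace n → ℝ≥0∞} (hg : AEMeasurable g) :
    ENNReal.ofReal (r ^ n) * ∫⁻ ξ, g (r • ξ) = ∫⁻ ξ, g ξ := by
  have h := Measure.map_addHaar_smul (volume : Measure (RSpace n)) hr.ne'
  rw [← lintegral_map' (f := g) (by rw [h]; exact hg.smul_measure _)
    (measurable_const_smul _).aemeasurable, h, lintegral_smul_measure, smul_eq_mul, ← mul_assoc,
    ← ENNReal.ofReal_mul (by positivity), finrank_euclideanSpace_fin,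
    abs_of_nonneg (by positivity), mul_inv_cancel₀ (by positivity), ENNReal.ofReal_one, one_mul]

/-- The dilation `h ↦ λ^{jn/2} h(λ^j ·)`, a unitary operator of `L²(ℝⁿ)`. -/
noncomputable def dil (lam : ℕ) (j : ℤ) (h : RSpace n → ℂ) (ξ : RSpace n) : ℂ :=
  (((lam : ℝ) ^ ((j : ℝ) * (n : ℝ) / 2) : ℝ) : ℂ) * h (((lam : ℝ) ^ j) • ξ)

lemma zpow_rpow_half_sq {lam : ℕ} (hl : 0 < lam) (j : ℤ) :
    ((lam : ℝ) ^ ((j : ℝ) * (n : ℝ) / 2)) ^ 2 = ((lam : ℝ) ^ j) ^ n := by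
  have hl' : (0 : ℝ) < lam := by exact_mod_cast hl
  rw [← Real.rpow_natCast, ← Real.rpow_mul hl'.le, ← Real.rpow_intCast, ← Real.rpow_natCast,
    ← Real.rpow_mul hl'.le]
  congr 1
  push_cast; ring

variable {lam : ℕ} [NeZero lam]

lemma lam_pos : (0 : ℝ) < lam := by exact_mod_cast Nat.pos_of_ne_zero (NeZero.ne lam)

lemma enorm_dil_sq (j : ℤ) (h : RSpace n → ℂ) (ξ : RSpace n) :
    ‖dil lam j h ξ‖ₑ ^ 2 =
      ENNReal.ofReal (((lam : ℝ) ^ j) ^ n) * ‖h (((lam : ℝ) ^ j) • ξ)‖ₑ ^ 2 := by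
  rw [dil, enorm_mul, mul_pow, ← zpow_rpow_half_sq (Nat.pos_of_ne_zero (NeZero.ne lam)),
    ← ofReal_norm, Complex.norm_real, ENNReal.ofReal_pow (by positivity),
    Real.norm_of_nonneg (by positivity)]

lemma zpow_smul_zpow_neg_smul (j : ℤ) (ξ : RSpace n) :
    ((lam : ℝ) ^ (-j)) • ((lam : ℝ) ^ j) • ξ = ξ := by
  rw [smul_smul, ← zpow_add₀ lam_pos.ne', neg_add_cancel, zpow_zero, one_smul]

/-- Change of variables for dilations. -/
lemma lintegral_mul_enorm_dil_sq (j : ℤ) {h : RSpace n → ℂ} (hh : AEStronglyMeasurable h)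
    {g : RSpace n → ℝ≥0∞} (hg : AEMeasurable g) :
    ∫⁻ ξ, g ξ * ‖dil lam j h ξ‖ₑ ^ 2 = ∫⁻ ξ, g (((lam : ℝ) ^ (-j)) • ξ) * ‖h ξ‖ₑ ^ 2 := by
  have hlj : (0 : ℝ) < (lam : ℝ) ^ j := zpow_pos lam_pos j
  have hlj' : (0 : ℝ) < (lam : ℝ) ^ (-j) := zpow_pos lam_pos (-j)
  rw [← lintegral_comp_smul hlj (g := fun ξ => g (((lam : ℝ) ^ (-j)) • ξ) * ‖h ξ‖ₑ ^ 2)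
      ((hg.comp_quasiMeasurePreserving (qmp_smul hlj'.ne')).mul (hh.enorm.pow_const 2)),
    ← lintegral_const_mul' _ _ ENNReal.ofReal_ne_top]
  refine lintegral_congr fun ξ => ?_
  rw [enorm_dil_sq, zpow_smul_zpow_neg_smul]
  ring

lemma lintegral_enorm_dil_sq (j : ℤ) {h : RSpace n → ℂ} (hh : AEStronglyMeasurable h) :
    ∫⁻ ξ, ‖dil lam j h ξ‖ₑ ^ 2 = ∫⁻ ξ, ‖h ξ‖ₑ ^ 2 := by
  simpa using lintegral_mul_enorm_dil_sq (lam := lam) j hh (g := fun _ => 1) aemeasurable_const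

lemma aestronglyMeasurable_dil (j : ℤ) {h : RSpace n → ℂ} (hh : AEStronglyMeasurable h) :
    AEStronglyMeasurable (dil lam j h) :=
  (hh.comp_quasiMeasurePreserving (qmp_smul (zpow_pos lam_pos j).ne')).const_mul _

lemma memLp_two_of_lintegral {h : RSpace n → ℂ} (hh : AEStronglyMeasurable h)
    (hfin : ∫⁻ ξ, ‖h ξ‖ₑ ^ 2 ≠ ∞) : MemLp h 2 := by
  refine ⟨hh, ?_⟩
  rw [eLpNorm_lt_top_iff_lintegral_rpow_enorm_lt_top (by norm_num) (by norm_num)]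
  simpa using hfin.lt_top

lemma memLp_dil (j : ℤ) {h : RSpace n → ℂ} (hh : MemLp h 2) : MemLp (dil lam j h) 2 :=
  memLp_two_of_lintegral (aestronglyMeasurable_dil j hh.1) (by
    rw [lintegral_enorm_dil_sq j hh.1]; exact lintegral_enorm_sq_ne_top hh)

lemma dil_succ (j : ℤ) (h : RSpace n → ℂ) (ξ : RSpace n) :
    dil lam (j + 1) h ξ = (((lam : ℝ) ^ ((n : ℝ) / 2) : ℝ) : ℂ) * dil lam j h ((lam : ℝ) • ξ) := by
  rw [dil, dil, ← mul_assoc, ← Complex.ofReal_mul, ← Real.rpow_add lam_pos, smul_smul,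
    zpow_add_one₀ lam_pos.ne']
  congr 4
  push_cast; ring

end Dilation

/-! ### The energy identity of the oblique extension principle -/

section Energy

variable {n lam : ℕ} {ι : Type} [Fintype ι]

/-- The hypotheses of the oblique extension principle on the Fourier side, in the frequency
variable `ξ/(2π)`, so that periodic means `ℤⁿ`-periodic. The identity is stated for all pairs of
points of the fibre `ξ + Γ` at once, and almost everywhere on `ℝⁿ`. -/
structure FourierOEP (lam : ℕ) (σ : RSpace n → ℝ≥0) (τ : RSpace n → ℂ) (q : ι → RSpace n → ℂ)
    (Φ : RSpace n → ℂ) (Ψ : ι → RSpace n → ℂ) : Prop where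
  measurable_σ : AEMeasurable σ
  period_σ : ∀ ξ (k : Fin n → ℤ), σ (ξ + intVec k) = σ ξ
  period_τ : ∀ ξ (k : Fin n → ℤ), τ (ξ + intVec k) = τ ξ
  period_q : ∀ l ξ (k : Fin n → ℤ), q l (ξ + intVec k) = q l ξ
  bound_σ : ∃ C : ℝ≥0, ∀ᵐ ξ, σ ξ ≤ C
  bound_Φ : ∃ C : ℝ≥0, ∀ᵐ ξ, perSq Φ ξ ≤ C
  memLp_Φ : MemLp Φ 2
  memLp_Ψ : ∀ l, MemLp (Ψ l) 2
  refine_Φ : ∀ᵐ ξ, Φ ((lam : ℝ) • ξ) = τ ξ * Φ ξ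
  refine_Ψ : ∀ l, ∀ᵐ ξ, Ψ l ((lam : ℝ) • ξ) = q l ξ * Φ ξ
  limit : ∀ᵐ ξ, Tendsto (fun J : ℕ => (σ (((lam : ℝ) ^ (-(J : ℤ))) • ξ) : ℝ≥0∞) *
    ‖Φ (((lam : ℝ) ^ (-(J : ℤ))) • ξ)‖ₑ ^ 2) atTop (𝓝 1)
  identity : ∀ᵐ ξ, ∀ m m' : Fin n → Fin lam,
    (σ ((lam : ℝ) • ξ) : ℂ) * (conj (τ (ξ + digitVec m)) * τ (ξ + digitVec m')) +
      ∑ l, conj (q l (ξ + digitVec m)) * q l (ξ + digitVec m') =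
      if m = m' then (σ (ξ + digitVec m) : ℂ) else 0

/-- The energy `∫ σ |[h, Φ]|²` of `h` at the level `0` of the multiresolution. -/
noncomputable def energy (σ : RSpace n → ℝ≥0) (Φ h : RSpace n → ℂ) : ℝ≥0∞ :=
  ∫⁻ ξ in cube n, σ ξ * ‖bracket h Φ ξ‖ₑ ^ 2

/-- A bracket with a refined function, expressed by brackets at the finer level. -/
lemma bracket_smul_eq [NeZero lam] {h Φ Φ' a : RSpace n → ℂ} {ξ : RSpace n}
    (hper : ∀ ξ (k : Fin n → ℤ), a (ξ + intVec k) = a ξ)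
    (href : ∀ (m : Fin n → Fin lam) (k : Fin n → ℤ),
      Φ' ((lam : ℝ) • (ξ + digitVec m + intVec k)) =
        a (ξ + digitVec m + intVec k) * Φ (ξ + digitVec m + intVec k))
    (hh : perSq h ((lam : ℝ) • ξ) ≠ ∞) (hΦ' : perSq Φ' ((lam : ℝ) • ξ) ≠ ∞) :
    bracket h Φ' ((lam : ℝ) • ξ) = ∑ m : Fin n → Fin lam, conj (a (ξ + digitVec m)) *
      bracket (fun η => h ((lam : ℝ) • η)) Φ (ξ + digitVec m) := by
  have hs := (digitEquiv n lam).summable_iff.2 (summable_bracket hh hΦ')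
  rw [bracket, ← (digitEquiv n lam).tsum_eq]
  change ∑' p, ((fun k : Fin n → ℤ => h ((lam : ℝ) • ξ + intVec k) *
    conj (Φ' ((lam : ℝ) • ξ + intVec k))) ∘ digitEquiv n lam) p = _
  rw [hs.tsum_prod, tsum_fintype]
  refine Finset.sum_congr rfl fun m _ => ?_
  rw [bracket, ← tsum_mul_left]
  refine tsum_congr fun k => ?_
  rw [Function.comp_apply, smul_add_digit, href, hper, map_mul]
  ring

/-- The identity of the oblique extension principle as an identity of quadratic forms. -/
lemma quadratic_identity {κ : Type*} [Fintype κ] [DecidableEq κ] {s₀ : ℝ≥0} {s : κ → ℝ≥0}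
    {t : κ → ℂ} {q : ι → κ → ℂ}
    (hid : ∀ m m', (s₀ : ℂ) * (conj (t m) * t m') + ∑ l, conj (q l m) * q l m' =
      if m = m' then (s m : ℂ) else 0) (H : κ → ℂ) :
    (s₀ : ℝ≥0∞) * ‖∑ m, conj (t m) * H m‖ₑ ^ 2 + ∑ l, ‖∑ m, conj (q l m) * H m‖ₑ ^ 2 =
      ∑ m, (s m : ℝ≥0∞) * ‖H m‖ₑ ^ 2 := by
  have hsq : ∀ u : κ → ℂ, ((‖∑ m, conj (u m) * H m‖₊ ^ 2 : ℝ≥0) : ℂ) =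
      ∑ m, ∑ m', conj (u m) * u m' * (H m * conj (H m')) := by
    intro u
    have : ((‖∑ m, conj (u m) * H m‖₊ ^ 2 : ℝ≥0) : ℂ) =
        (∑ m, conj (u m) * H m) * conj (∑ m, conj (u m) * H m) := by
      rw [Complex.mul_conj, Complex.normSq_eq_norm_sq]; simp
    rw [this, map_sum, Finset.sum_mul_sum]
    refine Finset.sum_congr rfl fun m _ => Finset.sum_congr rfl fun m' _ => ?_
    rw [map_mul, Complex.conj_conj]; ring
  have key : s₀ * ‖∑ m, conj (t m) * H m‖₊ ^ 2 + ∑ l, ‖∑ m, conj (q l m) * H m‖₊ ^ 2 =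
      ∑ m, s m * ‖H m‖₊ ^ 2 := by
    have : ((s₀ * ‖∑ m, conj (t m) * H m‖₊ ^ 2 + ∑ l, ‖∑ m, conj (q l m) * H m‖₊ ^ 2 : ℝ≥0) : ℂ) =
        ((∑ m, s m * ‖H m‖₊ ^ 2 : ℝ≥0) : ℂ) := by
      calc _ = (s₀ : ℂ) * ((‖∑ m, conj (t m) * H m‖₊ ^ 2 : ℝ≥0) : ℂ) +
            ∑ l, ((‖∑ m, conj (q l m) * H m‖₊ ^ 2 : ℝ≥0) : ℂ) := by push_cast; rfl
        _ = ∑ m, ∑ m', ((s₀ : ℂ) * (conj (t m) * t m') + ∑ l, conj (q l m) * q l m') *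
              (H m * conj (H m')) := by
            simp only [hsq, Finset.mul_sum, add_mul, Finset.sum_add_distrib, Finset.sum_mul]
            congr 1
            · refine Finset.sum_congr rfl fun m _ => Finset.sum_congr rfl fun m' _ => by ring
            · rw [Finset.sum_comm]
              exact Finset.sum_congr rfl fun m _ => Finset.sum_comm
        _ = ∑ m, (s m : ℂ) * (H m * conj (H m)) := by
            refine Finset.sum_congr rfl fun m _ => ?_
            simp only [hid, ite_mul, zero_mul, Finset.sum_ite_eq, Finset.mem_univ, if_true]
        _ = _ := by
            push_cast
            refine Finset.sum_congr rfl fun m _ => ?_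
            rw [Complex.mul_conj, Complex.normSq_eq_norm_sq]; simp
    exact_mod_cast this
  simp only [enorm_eq_nnnorm]
  exact_mod_cast congrArg ((↑) : ℝ≥0 → ℝ≥0∞) key

variable {σ : RSpace n → ℝ≥0} {τ : RSpace n → ℂ} {q : ι → RSpace n → ℂ} {Φ : RSpace n → ℂ}
  {Ψ : ι → RSpace n → ℂ}

/-- The pointwise form of the energy identity: the brackets at the points of a fibre are the vector
to which the quadratic form is applied. -/
lemma FourierOEP.ae_pointwise [NeZero lam] (H : FourierOEP lam σ τ q Φ Ψ) {h : RSpace n → ℂ}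
    (hh : MemLp h 2) :
    ∀ᵐ ξ, (σ ((lam : ℝ) • ξ) : ℝ≥0∞) * ‖bracket h Φ ((lam : ℝ) • ξ)‖ₑ ^ 2 +
      ∑ l, ‖bracket h (Ψ l) ((lam : ℝ) • ξ)‖ₑ ^ 2 =
      ∑ m : Fin n → Fin lam, (σ (ξ + digitVec m) : ℝ≥0∞) *
        ‖bracket (fun η => h ((lam : ℝ) • η)) Φ (ξ + digitVec m)‖ₑ ^ 2 := by
  have hall : ∀ {p : RSpace n → Prop}, (∀ᵐ ξ, p ξ) →
      ∀ᵐ ξ, ∀ (m : Fin n → Fin lam) (k : Fin n → ℤ), p (ξ + digitVec m + intVec k) := fun hp =>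
    ae_all_iff.2 fun m => (qmp_add (digitVec m)).ae (ae_forall_add_intVec hp)
  have hsm := qmp_smul (n := n) (r := (lam : ℝ)) lam_pos.ne'
  filter_upwards [H.identity, hall H.refine_Φ, ae_all_iff.2 fun l => hall (H.refine_Ψ l),
    hsm.ae (ae_perSq_ne_top hh), hsm.ae (ae_perSq_ne_top H.memLp_Φ),
    ae_all_iff.2 fun l => hsm.ae (ae_perSq_ne_top (H.memLp_Ψ l))] with ξ hid hΦ hΨ h1 h2 h3
  rw [bracket_smul_eq H.period_τ hΦ h1 h2]
  simp_rw [fun l => bracket_smul_eq (H.period_q l) (hΨ l) h1 (h3 l)]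
  exact quadratic_identity hid _

lemma FourierOEP.aemeasurable_energy (H : FourierOEP lam σ τ q Φ Ψ) {h : RSpace n → ℂ}
    (hh : AEStronglyMeasurable h) :
    AEMeasurable fun ξ => (σ ξ : ℝ≥0∞) * ‖bracket h Φ ξ‖ₑ ^ 2 :=
  H.measurable_σ.coe_nnreal_ennreal.mul
    ((aestronglyMeasurable_bracket hh H.memLp_Φ.1).enorm.pow_const 2)

/-- The energy at level `0` and the energy of the wavelet coefficients add up to the energy at
level `1`. -/
lemma FourierOEP.energy_add [NeZero lam] (H : FourierOEP lam σ τ q Φ Ψ) {h : RSpace n → ℂ}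
    (hh : MemLp h 2) :
    energy σ Φ h + ∑ l, ∫⁻ ξ in cube n, ‖bracket h (Ψ l) ξ‖ₑ ^ 2 =
      (lam : ℝ≥0∞) ^ n * energy σ Φ (fun η => h ((lam : ℝ) • η)) := by
  have hm0 := H.aemeasurable_energy hh.1
  have hml : ∀ l, AEMeasurable fun ξ => ‖bracket h (Ψ l) ξ‖ₑ ^ 2 := fun l =>
    (aestronglyMeasurable_bracket hh.1 (H.memLp_Ψ l).1).enorm.pow_const 2
  have hhd : AEStronglyMeasurable fun η => h ((lam : ℝ) • η) :=
    hh.1.comp_quasiMeasurePreserving (qmp_smul lam_pos.ne')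
  have hmd := H.aemeasurable_energy hhd
  calc energy σ Φ h + ∑ l, ∫⁻ ξ in cube n, ‖bracket h (Ψ l) ξ‖ₑ ^ 2
      = ∫⁻ ξ in cube n, (σ ξ * ‖bracket h Φ ξ‖ₑ ^ 2 + ∑ l, ‖bracket h (Ψ l) ξ‖ₑ ^ 2) := by
        rw [lintegral_add_left' hm0.restrict, lintegral_finsetSum' _ fun l _ => (hml l).restrict]
        rfl
    _ = ∫⁻ ξ in cube n, (σ ((lam : ℝ) • ξ) * ‖bracket h Φ ((lam : ℝ) • ξ)‖ₑ ^ 2 +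
          ∑ l, ‖bracket h (Ψ l) ((lam : ℝ) • ξ)‖ₑ ^ 2) := by
        refine (setLIntegral_cube_smul (lam := lam) (w := fun ξ =>
          σ ξ * ‖bracket h Φ ξ‖ₑ ^ 2 + ∑ l, ‖bracket h (Ψ l) ξ‖ₑ ^ 2) ?_ ?_).symm
        · exact hm0.add (Finset.aemeasurable_fun_sum _ fun l _ => hml l)
        · intro ξ k
          simp only [H.period_σ, bracket_add_intVec]
    _ = ∫⁻ ξ in cube n, ∑ m : Fin n → Fin lam, (σ (ξ + digitVec m) : ℝ≥0∞) *
          ‖bracket (fun η => h ((lam : ℝ) • η)) Φ (ξ + digitVec m)‖ₑ ^ 2 :=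
        lintegral_congr_ae (ae_restrict_of_ae (H.ae_pointwise hh))
    _ = ∑ m : Fin n → Fin lam, ∫⁻ ξ in cube n, (σ (ξ + digitVec m) : ℝ≥0∞) *
          ‖bracket (fun η => h ((lam : ℝ) • η)) Φ (ξ + digitVec m)‖ₑ ^ 2 :=
        lintegral_finsetSum' _ fun m _ =>
          (hmd.comp_quasiMeasurePreserving (qmp_add (digitVec m))).restrict
    _ = ∑ m : Fin n → Fin lam, energy σ Φ (fun η => h ((lam : ℝ) • η)) :=
        Finset.sum_congr rfl fun m _ => setLIntegral_cube_add (w := fun ξ => (σ ξ : ℝ≥0∞) *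
          ‖bracket (fun η => h ((lam : ℝ) • η)) Φ ξ‖ₑ ^ 2) hmd
          (fun ξ k => by simp only [H.period_σ, bracket_add_intVec]) _
    _ = _ := by simp

lemma energy_const_mul (c : ℂ) (h : RSpace n → ℂ) :
    energy σ Φ (fun ξ => c * h ξ) = ‖c‖ₑ ^ 2 * energy σ Φ h := by
  rw [energy, energy, ← lintegral_const_mul' _ _ (by simp)]
  refine lintegral_congr fun ξ => ?_
  have : bracket (fun ξ => c * h ξ) Φ ξ = c * bracket h Φ ξ := by
    simp only [bracket, mul_assoc, tsum_mul_left]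
  rw [this, enorm_mul, mul_pow]
  ring

/-- One telescoping step: passing from level `j` to level `j + 1` adds the energy of the wavelet
coefficients at level `j`. -/
lemma FourierOEP.energy_dil_succ [NeZero lam] (H : FourierOEP lam σ τ q Φ Ψ) {h : RSpace n → ℂ}
    (hh : MemLp h 2) (j : ℤ) :
    energy σ Φ (dil lam j h) + ∑ l, ∫⁻ ξ in cube n, ‖bracket (dil lam j h) (Ψ l) ξ‖ₑ ^ 2 =
      energy σ Φ (dil lam (j + 1) h) := by
  rw [H.energy_add (memLp_dil j hh)]
  have : dil lam (j + 1) h = fun ξ => (((lam : ℝ) ^ ((n : ℝ) / 2) : ℝ) : ℂ) *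
      (fun η => dil lam j h ((lam : ℝ) • η)) ξ := funext (dil_succ j h)
  rw [this, energy_const_mul]
  congr 1
  have h1 := zpow_rpow_half_sq (n := n) (Nat.pos_of_ne_zero (NeZero.ne lam)) 1
  rw [Int.cast_one, one_mul, zpow_one] at h1
  rw [← ofReal_norm, Complex.norm_real, Real.norm_of_nonneg (by positivity),
    ← ENNReal.ofReal_pow (by positivity), h1, ENNReal.ofReal_pow (by positivity),
    ENNReal.ofReal_natCast]

lemma FourierOEP.energy_le (H : FourierOEP lam σ τ q Φ Ψ) :
    ∃ C : ℝ≥0, ∀ h : RSpace n → ℂ, AEStronglyMeasurable h →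
      energy σ Φ h ≤ C * ∫⁻ ξ, ‖h ξ‖ₑ ^ 2 := by
  obtain ⟨C₁, h1⟩ := H.bound_σ
  obtain ⟨C₂, h2⟩ := H.bound_Φ
  refine ⟨C₁ * C₂, fun h hh => ?_⟩
  calc energy σ Φ h ≤ ∫⁻ ξ in cube n, C₁ * ‖bracket h Φ ξ‖ₑ ^ 2 := by
        refine lintegral_mono_ae (ae_restrict_of_ae ?_)
        filter_upwards [h1] with ξ hξ
        gcongr
    _ = C₁ * ∫⁻ ξ in cube n, ‖bracket h Φ ξ‖ₑ ^ 2 := lintegral_const_mul' _ _ ENNReal.coe_ne_top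
    _ ≤ C₁ * (C₂ * ∫⁻ ξ, ‖h ξ‖ₑ ^ 2) := by gcongr; exact setLIntegral_bracket_le hh h2
    _ = _ := by push_cast; ring

/-- Telescoping sums in `[0, ∞]` over `ℤ`. -/
lemma tsum_int_of_telescope {E c : ℤ → ℝ≥0∞} (h : ∀ j, E j + c j = E (j + 1)) {L : ℝ≥0∞}
    (hbot : Tendsto (fun J : ℕ => E (-J)) atTop (𝓝 0))
    (htop : Tendsto (fun J : ℕ => E J) atTop (𝓝 L)) : ∑' j, c j = L := by
  have h1 : ∀ (a : ℤ) (k : ℕ), E a + ∑ j ∈ Finset.Ico a (a + k), c j = E (a + k) := by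
    intro a k
    induction k with
    | zero => simp
    | succ k ih =>
      have : Finset.Ico a (a + (k + 1 : ℕ)) = insert (a + k) (Finset.Ico a (a + k)) := by
        ext x; simp; omega
      rw [this, Finset.sum_insert (by simp), add_left_comm, add_comm (c _), ih, h]
      push_cast; ring_nf
  have h2 : Tendsto (fun J : ℕ => ∑ j ∈ Finset.Ico (-J : ℤ) J, c j) atTop (𝓝 (∑' j, c j)) :=
    ENNReal.summable.hasSum.comp Finset.tendsto_Ico_neg
  have h3 := hbot.add h2
  rw [zero_add] at h3
  refine tendsto_nhds_unique h3 (htop.congr fun J => ?_)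
  have := h1 (-J) (2 * J)
  rw [show (-J : ℤ) + (2 * J : ℕ) = J by push_cast; ring] at this
  exact this.symm

end Energy

/-! ### High frequencies: the energy converges to the norm -/

section HighFrequency

variable {n lam : ℕ} {ι : Type} [Fintype ι]
variable {σ : RSpace n → ℝ≥0} {τ : RSpace n → ℂ} {q : ι → RSpace n → ℂ} {Φ : RSpace n → ℂ}
  {Ψ : ι → RSpace n → ℂ}

/-- The square root of the energy is a seminorm on `L²(ℝⁿ)`. -/
lemma FourierOEP.sqrt_energy_add_le (H : FourierOEP lam σ τ q Φ Ψ) {h₁ h₂ : RSpace n → ℂ}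
    (h1 : MemLp h₁ 2) (h2 : MemLp h₂ 2) :
    energy σ Φ (h₁ + h₂) ^ (1 / 2 : ℝ) ≤
      energy σ Φ h₁ ^ (1 / 2 : ℝ) + energy σ Φ h₂ ^ (1 / 2 : ℝ) := by
  have hsq : ∀ h : RSpace n → ℂ, energy σ Φ h =
      ∫⁻ ξ in cube n, ((σ ξ : ℝ≥0∞) ^ (1 / 2 : ℝ) * ‖bracket h Φ ξ‖ₑ) ^ (2 : ℝ) := by
    intro h
    refine lintegral_congr fun ξ => ?_
    rw [ENNReal.mul_rpow_of_nonneg _ _ (by norm_num), ← ENNReal.rpow_mul]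
    norm_num
  have hm : ∀ {h : RSpace n → ℂ}, AEStronglyMeasurable h → AEMeasurable
      (fun ξ => (σ ξ : ℝ≥0∞) ^ (1 / 2 : ℝ) * ‖bracket h Φ ξ‖ₑ) (volume.restrict (cube n)) :=
    fun hh => ((H.measurable_σ.coe_nnreal_ennreal.pow_const _).mul
      (aestronglyMeasurable_bracket hh H.memLp_Φ.1).enorm).restrict
  rw [hsq h₁, hsq h₂]
  refine le_trans ?_ (ENNReal.lintegral_Lp_add_le (hm h1.1) (hm h2.1) one_le_two)
  rw [hsq]
  refine ENNReal.rpow_le_rpow (lintegral_mono_ae (ae_restrict_of_ae ?_)) (by norm_num)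
  filter_upwards [ae_perSq_ne_top h1, ae_perSq_ne_top h2, ae_perSq_ne_top H.memLp_Φ]
    with ξ e1 e2 e3
  refine ENNReal.rpow_le_rpow ?_ (by norm_num)
  rw [Pi.add_apply, ← mul_add]
  gcongr
  have : bracket (h₁ + h₂) Φ ξ = bracket h₁ Φ ξ + bracket h₂ Φ ξ := by
    rw [bracket, bracket, bracket,
      ← (summable_bracket e1 e3).tsum_add (summable_bracket e2 e3)]
    exact tsum_congr fun k => by rw [Pi.add_apply, add_mul]
  rw [this]
  exact enorm_add_le _ _

/-- The ball of radius `1/2`, which lies inside the fundamental cube. -/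
abbrev halfBall (n : ℕ) : Set (RSpace n) := Metric.ball 0 (1 / 2)

lemma halfBall_subset_cube : halfBall n ⊆ cube n := fun _ h =>
  mem_cube_of_norm_lt (by simpa using h)

/-- For a function supported in the ball of radius `1/2` the bracket has only one term. -/
lemma energy_indicator (h : RSpace n → ℂ) :
    energy σ Φ ((halfBall n).indicator h) =
      ∫⁻ ξ, ((halfBall n).indicator (fun ξ => (σ ξ : ℝ≥0∞) * ‖Φ ξ‖ₑ ^ 2) ξ) * ‖h ξ‖ₑ ^ 2 := by
  rw [energy, ← lintegral_indicator measurableSet_cube]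
  refine lintegral_congr fun ξ => ?_
  by_cases hc : ξ ∈ cube n
  · have hb : bracket ((halfBall n).indicator h) Φ ξ =
        (halfBall n).indicator h ξ * conj (Φ ξ) := by
      rw [bracket, tsum_eq_single 0, intVec_zero, add_zero]
      intro k hk
      rw [Set.indicator_of_notMem, zero_mul]
      intro hmem
      obtain ⟨l, -, hl⟩ := existsUnique_add_intVec_mem_cube ξ
      exact hk ((hl k (halfBall_subset_cube hmem)).trans
        (hl 0 (by simpa [intVec_zero] using hc)).symm)
    rw [Set.indicator_of_mem hc, hb]
    by_cases hξ : ξ ∈ halfBall n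
    · rw [Set.indicator_of_mem hξ, Set.indicator_of_mem hξ, enorm_mul, RCLike.enorm_conj]
      ring
    · rw [Set.indicator_of_notMem hξ, Set.indicator_of_notMem hξ]
      simp
  · rw [Set.indicator_of_notMem hc, Set.indicator_of_notMem fun h => hc (halfBall_subset_cube h),
      zero_mul]

lemma tendsto_zpow_neg_smul (hlam : 2 ≤ lam) (ξ : RSpace n) :
    Tendsto (fun J : ℕ => ((lam : ℝ) ^ (-(J : ℤ))) • ξ) atTop (𝓝 0) := by
  have h1 : Tendsto (fun J : ℕ => ((lam : ℝ) ^ J)⁻¹) atTop (𝓝 0) :=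
    tendsto_inv_atTop_zero.comp (tendsto_pow_atTop_atTop_of_one_lt (by exact_mod_cast hlam))
  simpa using h1.smul_const ξ

lemma eventually_mem_halfBall (hlam : 2 ≤ lam) (ξ : RSpace n) :
    ∀ᶠ J : ℕ in atTop, ((lam : ℝ) ^ (-(J : ℤ))) • ξ ∈ halfBall n :=
  (tendsto_zpow_neg_smul hlam ξ).eventually (Metric.ball_mem_nhds 0 (by norm_num))

/-- The part of `F` inside the dilated half-ball, where `σ |Φ|²` tends to `1` along the dilations,
carries the whole norm in the limit. -/
lemma FourierOEP.tendsto_energy_low_part [NeZero lam] (H : FourierOEP lam σ τ q Φ Ψ)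
    (hlam : 2 ≤ lam) {F : RSpace n → ℂ} (hF : MemLp F 2) :
    Tendsto (fun J : ℕ => energy σ Φ ((halfBall n).indicator (dil lam J F))) atTop
      (𝓝 (∫⁻ ξ, ‖F ξ‖ₑ ^ 2)) := by
  obtain ⟨C₁, h1⟩ := H.bound_σ
  obtain ⟨C₂, h2⟩ := H.bound_Φ
  have hw : AEMeasurable ((halfBall n).indicator fun ξ => (σ ξ : ℝ≥0∞) * ‖Φ ξ‖ₑ ^ 2) :=
    (H.measurable_σ.coe_nnreal_ennreal.mul (H.memLp_Φ.1.enorm.pow_const 2)).indicator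
      Metric.isOpen_ball.measurableSet
  have hle : ∀ᵐ ξ, (halfBall n).indicator (fun ξ => (σ ξ : ℝ≥0∞) * ‖Φ ξ‖ₑ ^ 2) ξ ≤ C₁ * C₂ := by
    filter_upwards [h1, h2] with ξ e1 e2
    refine (Set.indicator_le_self _ _ ξ).trans ?_
    have : ‖Φ ξ‖ₑ ^ 2 ≤ perSq Φ ξ := by
      have := ENNReal.le_tsum (f := fun k : Fin n → ℤ => ‖Φ (ξ + intVec k)‖ₑ ^ 2) 0
      rwa [intVec_zero, add_zero] at this
    gcongr
    exact this.trans e2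
  simp_rw [energy_indicator, lintegral_mul_enorm_dil_sq _ hF.1 hw]
  have hz : ∀ J : ℕ, (lam : ℝ) ^ (-(J : ℤ)) ≠ 0 := fun J => (zpow_pos lam_pos _).ne'
  refine tendsto_lintegral_of_dominated_convergence' (fun ξ => C₁ * C₂ * ‖F ξ‖ₑ ^ 2)
    (fun J => (hw.comp_quasiMeasurePreserving (qmp_smul (hz J))).mul (hF.1.enorm.pow_const 2))
    (fun J => ?_) ?_ ?_
  · filter_upwards [(qmp_smul (hz J)).ae hle] with ξ hξ
    gcongr
  · rw [lintegral_const_mul' _ _ (by finiteness)]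
    exact ENNReal.mul_ne_top (by finiteness) (lintegral_enorm_sq_ne_top hF)
  · filter_upwards [H.limit] with ξ hξ
    have h3 : Tendsto (fun J : ℕ => (halfBall n).indicator (fun ξ => (σ ξ : ℝ≥0∞) * ‖Φ ξ‖ₑ ^ 2)
        (((lam : ℝ) ^ (-(J : ℤ))) • ξ)) atTop (𝓝 1) := by
      refine hξ.congr' ?_
      filter_upwards [eventually_mem_halfBall hlam ξ] with J hJ
      rw [Set.indicator_of_mem hJ]
    simpa using ENNReal.Tendsto.mul_const h3 (Or.inl one_ne_zero) (b := ‖F ξ‖ₑ ^ 2)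

lemma tendsto_lintegral_high_part [NeZero lam] (hlam : 2 ≤ lam) {F : RSpace n → ℂ}
    (hF : MemLp F 2) :
    Tendsto (fun J : ℕ => ∫⁻ ξ, ‖(halfBall n)ᶜ.indicator (dil lam J F) ξ‖ₑ ^ 2) atTop (𝓝 0) := by
  have hw : Measurable ((halfBall n)ᶜ.indicator (1 : RSpace n → ℝ≥0∞)) :=
    measurable_one.indicator Metric.isOpen_ball.measurableSet.compl
  have heq : ∀ J : ℕ, ∫⁻ ξ, ‖(halfBall n)ᶜ.indicator (dil lam J F) ξ‖ₑ ^ 2 =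
      ∫⁻ ξ, (halfBall n)ᶜ.indicator (1 : RSpace n → ℝ≥0∞) (((lam : ℝ) ^ (-(J : ℤ))) • ξ) *
        ‖F ξ‖ₑ ^ 2 := by
    intro J
    rw [← lintegral_mul_enorm_dil_sq _ hF.1 hw.aemeasurable]
    refine lintegral_congr fun ξ => ?_
    by_cases h : ξ ∈ (halfBall n)ᶜ <;> simp only [Set.indicator_of_mem, Set.indicator_of_notMem, h,
      not_false_eq_true, Pi.one_apply, one_mul, zero_mul, enorm_zero, ne_eq, OfNat.ofNat_ne_zero,
      zero_pow]
  simp_rw [heq]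
  have h0 : ∫⁻ _ : RSpace n, (0 : ℝ≥0∞) = 0 := lintegral_zero
  rw [← h0]
  refine tendsto_lintegral_of_dominated_convergence' (fun ξ => ‖F ξ‖ₑ ^ 2)
    (fun J => (hw.comp (measurable_const_smul _)).aemeasurable.mul (hF.1.enorm.pow_const 2))
    (fun J => Eventually.of_forall fun ξ => ?_) (lintegral_enorm_sq_ne_top hF)
    (Eventually.of_forall fun ξ => ?_)
  · refine mul_le_of_le_one_left' ?_
    exact (Set.indicator_le_self _ _ _)
  · refine tendsto_const_nhds.congr' ?_
    filter_upwards [eventually_mem_halfBall hlam ξ] with J hJ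
    rw [Set.indicator_of_notMem (Set.notMem_compl_iff.2 hJ), zero_mul]

/-- As the level tends to infinity the energy exhausts the norm. The half-ball part has the right
limit, the rest has vanishing norm and hence vanishing energy, and the square root of the energy
is a seminorm. -/
lemma FourierOEP.tendsto_energy [NeZero lam] (H : FourierOEP lam σ τ q Φ Ψ)
    (hlam : 2 ≤ lam) {F : RSpace n → ℂ} (hF : MemLp F 2) :
    Tendsto (fun J : ℕ => energy σ Φ (dil lam J F)) atTop (𝓝 (∫⁻ ξ, ‖F ξ‖ₑ ^ 2)) := by
  have hball : MeasurableSet (halfBall n) := Metric.isOpen_ball.measurableSet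
  obtain ⟨C, hC⟩ := H.energy_le
  have hh1 : ∀ J : ℕ, MemLp ((halfBall n).indicator (dil lam J F)) 2 := fun J =>
    (memLp_dil (J : ℤ) hF).indicator hball
  have hh2 : ∀ J : ℕ, MemLp ((halfBall n)ᶜ.indicator (dil lam J F)) 2 := fun J =>
    (memLp_dil (J : ℤ) hF).indicator hball.compl
  have e2 : Tendsto (fun J : ℕ => energy σ Φ ((halfBall n)ᶜ.indicator (dil lam J F))) atTop
      (𝓝 0) := by
    have h := ENNReal.Tendsto.const_mul (a := (C : ℝ≥0∞))
      (tendsto_lintegral_high_part (n := n) (lam := lam) hlam hF) (Or.inr ENNReal.coe_ne_top)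
    rw [mul_zero] at h
    exact tendsto_of_tendsto_of_tendsto_of_le_of_le tendsto_const_nhds h (fun _ => zero_le)
      fun J => hC _ (hh2 J).1
  have r1 := (ENNReal.continuous_rpow_const (y := (1 / 2 : ℝ))).continuousAt.tendsto.comp
    (H.tendsto_energy_low_part hlam hF)
  have r2 := (ENNReal.continuous_rpow_const (y := (1 / 2 : ℝ))).continuousAt.tendsto.comp e2
  rw [ENNReal.zero_rpow_of_pos (by norm_num)] at r2
  have hroot : Tendsto (fun J : ℕ => energy σ Φ (dil lam J F) ^ (1 / 2 : ℝ)) atTop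
      (𝓝 ((∫⁻ ξ, ‖F ξ‖ₑ ^ 2) ^ (1 / 2 : ℝ))) := by
    refine tendsto_of_tendsto_of_tendsto_of_le_of_le (g := fun J : ℕ =>
      energy σ Φ ((halfBall n).indicator (dil lam J F)) ^ (1 / 2 : ℝ) -
        energy σ Φ ((halfBall n)ᶜ.indicator (dil lam J F)) ^ (1 / 2 : ℝ)) (h := fun J : ℕ =>
      energy σ Φ ((halfBall n).indicator (dil lam J F)) ^ (1 / 2 : ℝ) +
        energy σ Φ ((halfBall n)ᶜ.indicator (dil lam J F)) ^ (1 / 2 : ℝ)) ?_ ?_ ?_ ?_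
    · simpa using ENNReal.Tendsto.sub r1 r2 (Or.inr ENNReal.zero_ne_top)
    · simpa using r1.add r2
    · intro J
      refine tsub_le_iff_right.2 ?_
      have h3 := H.sqrt_energy_add_le (memLp_dil (lam := lam) (J : ℤ) hF) (hh2 J).neg
      have h4 : dil lam J F + -(halfBall n)ᶜ.indicator (dil lam J F) =
          (halfBall n).indicator (dil lam J F) := by
        rw [← sub_eq_add_neg, sub_eq_iff_eq_add, Set.indicator_self_add_compl]
      have h5 : energy σ Φ (-(halfBall n)ᶜ.indicator (dil lam J F)) =
          energy σ Φ ((halfBall n)ᶜ.indicator (dil lam J F)) := by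
        have := energy_const_mul (σ := σ) (Φ := Φ) (-1) ((halfBall n)ᶜ.indicator (dil lam J F))
        simpa [← Pi.neg_def] using this
      rwa [h4, h5] at h3
    · intro J
      have h3 := H.sqrt_energy_add_le (hh1 J) (hh2 J)
      rwa [Set.indicator_self_add_compl] at h3
  have hs := (ENNReal.continuous_rpow_const (y := (2 : ℝ))).continuousAt.tendsto.comp hroot
  have hcancel : ∀ x : ℝ≥0∞, (x ^ (1 / 2 : ℝ)) ^ (2 : ℝ) = x := fun x => by
    rw [← ENNReal.rpow_mul]; norm_num
  simpa only [Function.comp_def, hcancel] using hs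

end HighFrequency

/-! ### Low frequencies: coarse-scale coefficients vanish in the limit -/

section LowFrequency

variable {n lam : ℕ}

lemma waveletAtom_eq_dil (ψ : L2Space n) (j : ℤ) (k : Fin n → ℤ) :
    waveletAtom lam ψ j k = dil lam j fun y => ψ (y - intVec k) := rfl

lemma aestronglyMeasurable_sub_intVec (ψ : L2Space n) (k : Fin n → ℤ) :
    AEStronglyMeasurable fun y => ψ (y - intVec k) := by
  simpa [sub_eq_add_neg, Function.comp_def] using
    (Lp.aestronglyMeasurable ψ).comp_quasiMeasurePreserving (qmp_add (-intVec k))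

variable [NeZero lam]

lemma memLp_waveletAtom (ψ : L2Space n) (j : ℤ) (k : Fin n → ℤ) :
    MemLp (waveletAtom lam ψ j k) 2 := by
  rw [waveletAtom_eq_dil]
  refine memLp_dil j ?_
  exact (Lp.memLp ψ).comp_measurePreserving (measurePreserving_sub_right volume (intVec k))

lemma lintegral_mul_enorm_waveletAtom_sq (ψ : L2Space n) (j : ℤ) (k : Fin n → ℤ)
    {g : RSpace n → ℝ≥0∞} (hg : AEMeasurable g) :
    ∫⁻ x, g x * ‖waveletAtom lam ψ j k x‖ₑ ^ 2 =
      ∫⁻ y, g (((lam : ℝ) ^ (-j)) • (y + intVec k)) * ‖ψ y‖ₑ ^ 2 := by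
  rw [waveletAtom_eq_dil, lintegral_mul_enorm_dil_sq j (aestronglyMeasurable_sub_intVec ψ k) hg,
    ← lintegral_add_right_eq_self _ (intVec k)]
  simp

lemma enorm_integral_mul_conj_sq_le {f g : RSpace n → ℂ} (hf : AEStronglyMeasurable f)
    (hg : AEStronglyMeasurable g) :
    ‖∫ x, f x * conj (g x)‖ₑ ^ 2 ≤ (∫⁻ x, ‖f x‖ₑ ^ 2) * ∫⁻ x, ‖g x‖ₑ ^ 2 := by
  have h1 : ‖∫ x, f x * conj (g x)‖ₑ ≤ ∫⁻ x, ((fun x => ‖f x‖ₑ) * fun x => ‖g x‖ₑ) x := by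
    refine (enorm_integral_le_lintegral_enorm _).trans (le_of_eq (lintegral_congr fun x => ?_))
    rw [enorm_mul, RCLike.enorm_conj, Pi.mul_apply]
  have h2 :=
    ENNReal.lintegral_mul_le_Lp_mul_Lq volume Real.HolderConjugate.two_two hf.enorm hg.enorm
  simp only [ENNReal.rpow_two] at h2
  calc _ ≤ ((∫⁻ x, ‖f x‖ₑ ^ 2) ^ (1 / 2 : ℝ) * (∫⁻ x, ‖g x‖ₑ ^ 2) ^ (1 / 2 : ℝ)) ^ 2 := by
        gcongr; exact h1.trans h2
    _ = _ := by
        rw [← ENNReal.mul_rpow_of_nonneg _ _ (by norm_num), ← ENNReal.rpow_natCast,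
          ← ENNReal.rpow_mul]
        norm_num

lemma add_sq_le_two_mul (a b : ℝ≥0∞) : (a + b) ^ 2 ≤ 2 * a ^ 2 + 2 * b ^ 2 := by
  have := ENNReal.rpow_add_le_mul_rpow_add_rpow a b one_le_two
  rw [← mul_add]
  norm_num at this
  exact this

/-- The balls of radius `J λ^{-J}` around the lattice points carry no mass in the limit. They are
disjoint once the radius is below `1/2`, and they shrink to a null set. -/
lemma tendsto_lintegral_lattice_balls (hn : 0 < n) (hlam : 2 ≤ lam) {φ : RSpace n → ℂ}
    (hφ : MemLp φ 2) :
    Tendsto (fun J : ℕ => ∫⁻ y, (∑' k : Fin n → ℤ, (Metric.ball (0 : RSpace n) J).indicator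
      (1 : RSpace n → ℝ≥0∞) (((lam : ℝ) ^ (J : ℤ)) • (y + intVec k))) * ‖φ y‖ₑ ^ 2) atTop
      (𝓝 0) := by
  have : NeZero n := ⟨hn.ne'⟩
  have hr : Tendsto (fun J : ℕ => (J : ℝ) / (lam : ℝ) ^ J) atTop (𝓝 0) := by
    simpa using tendsto_pow_const_div_const_pow_of_one_lt 1 (r := (lam : ℝ))
      (by exact_mod_cast hlam)
  have hmem : ∀ (J : ℕ) (y : RSpace n), ((lam : ℝ) ^ (J : ℤ)) • y ∈ Metric.ball (0 : RSpace n) J ↔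
      ‖y‖ < (J : ℝ) / (lam : ℝ) ^ J := by
    intro J y
    rw [mem_ball_zero_iff, norm_smul, zpow_natCast, Real.norm_of_nonneg (by positivity),
      lt_div_iff₀' (pow_pos lam_pos J)]
  have hsum : ∀ᶠ J : ℕ in atTop, ∀ y : RSpace n, ∀ k : Fin n → ℤ,
      (Metric.ball (0 : RSpace n) J).indicator (1 : RSpace n → ℝ≥0∞)
        (((lam : ℝ) ^ (J : ℤ)) • (y + intVec k)) ≤ (cube n).indicator 1 (y + intVec k) := by
    filter_upwards [hr.eventually (gt_mem_nhds (by norm_num : (0 : ℝ) < 1 / 2))] with J hJ y k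
    by_cases h : ((lam : ℝ) ^ (J : ℤ)) • (y + intVec k) ∈ Metric.ball (0 : RSpace n) J
    · rw [Set.indicator_of_mem h, Set.indicator_of_mem
        (mem_cube_of_norm_lt (((hmem J _).1 h).trans hJ))]
      rfl
    · rw [Set.indicator_of_notMem h]; exact zero_le
  -- for `n = 0` the single point would have positive measure
  have hnull : ∀ᵐ y : RSpace n, ∀ k : Fin n → ℤ, y + intVec k ≠ 0 := by
    refine ae_all_iff.2 fun k => ?_
    have : {y : RSpace n | ¬ (y + intVec k ≠ 0)} = {-intVec k} := by
      ext y; simp [eq_neg_iff_add_eq_zero]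
    rw [ae_iff, this]
    exact measure_singleton _
  have h0 : ∫⁻ _ : RSpace n, (0 : ℝ≥0∞) = 0 := lintegral_zero
  rw [← h0]
  have hmeas : ∀ (J : ℕ) (k : Fin n → ℤ), Measurable fun y : RSpace n =>
      (Metric.ball (0 : RSpace n) J).indicator (1 : RSpace n → ℝ≥0∞)
        (((lam : ℝ) ^ (J : ℤ)) • (y + intVec k)) := fun J k =>
    (measurable_one.indicator Metric.isOpen_ball.measurableSet).comp
      ((measurable_const_smul _).comp (measurable_add_const _))
  obtain ⟨J₀, hJ₀⟩ := eventually_atTop.1 hsum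
  rw [← tendsto_add_atTop_iff_nat J₀]
  refine tendsto_lintegral_of_dominated_convergence' (fun y => ‖φ y‖ₑ ^ 2)
    (fun J => (Measurable.tsum fun k => hmeas (J + J₀) k).aemeasurable.mul
      (hφ.1.enorm.pow_const 2)) (fun J => ?_) (lintegral_enorm_sq_ne_top hφ) ?_
  · refine Eventually.of_forall fun y => mul_le_of_le_one_left' ?_
    rw [← tsum_indicator_cube y]
    exact ENNReal.tsum_le_tsum (hJ₀ (J + J₀) (by omega) y)
  · filter_upwards [hnull] with y hy
    refine (tendsto_add_atTop_iff_nat (f := fun J : ℕ => (∑' k : Fin n → ℤ,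
      (Metric.ball (0 : RSpace n) J).indicator (1 : RSpace n → ℝ≥0∞)
        (((lam : ℝ) ^ (J : ℤ)) • (y + intVec k))) * ‖φ y‖ₑ ^ 2) J₀).2 ?_
    refine tendsto_const_nhds.congr' ?_
    obtain ⟨k₀, -, hk₀⟩ := existsUnique_add_intVec_mem_cube y
    filter_upwards [hsum, hr.eventually (gt_mem_nhds (norm_pos_iff.2 (hy k₀)))] with J hJ hJ'
    rw [ENNReal.tsum_eq_zero.2 fun k => ?_, zero_mul]
    by_cases hk : y + intVec k ∈ cube n
    · rw [hk₀ k hk, Set.indicator_of_notMem]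
      rw [hmem]
      exact not_lt.2 hJ'.le
    · have := hJ y k
      rw [Set.indicator_of_notMem hk] at this
      exact le_antisymm this zero_le

/-- If the shifts of `φ` have bounded coefficients at all coarse scales, then the coarse-scale
coefficients tend to zero: split `f` at the ball of radius `J`, so that the outer part has small
norm, while the inner part only sees `φ` on small balls around the lattice points. -/
lemma tendsto_tsum_coarse (hn : 0 < n) (hlam : 2 ≤ lam) (φ : L2Space n) {C : ℝ≥0}
    (hC : ∀ (h : RSpace n → ℂ) (J : ℕ), MemLp h 2 →
      ∑' k : Fin n → ℤ, ‖∫ x, h x * conj (waveletAtom lam φ (-J) k x)‖ₑ ^ 2 ≤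
        C * ∫⁻ x, ‖h x‖ₑ ^ 2) {f : RSpace n → ℂ} (hf : MemLp f 2) :
    Tendsto (fun J : ℕ => ∑' k : Fin n → ℤ,
      ‖∫ x, f x * conj (waveletAtom lam φ (-J) k x)‖ₑ ^ 2) atTop (𝓝 0) := by
  have hball : ∀ J : ℕ, MeasurableSet (Metric.ball (0 : RSpace n) (J : ℝ)) := fun J =>
    Metric.isOpen_ball.measurableSet
  have hfar : Tendsto (fun J : ℕ =>
      ∫⁻ x, ‖(Metric.ball (0 : RSpace n) (J : ℝ))ᶜ.indicator f x‖ₑ ^ 2) atTop (𝓝 0) := by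
    have h0 : ∫⁻ _ : RSpace n, (0 : ℝ≥0∞) = 0 := lintegral_zero
    rw [← h0]
    refine tendsto_lintegral_of_dominated_convergence' (fun ξ => ‖f ξ‖ₑ ^ 2)
      (fun J => (hf.1.indicator (hball J).compl).enorm.pow_const 2)
      (fun J => Eventually.of_forall fun ξ => ?_) (lintegral_enorm_sq_ne_top hf)
      (Eventually.of_forall fun ξ => ?_)
    · exact pow_le_pow_left' (enorm_indicator_le_enorm_self _ _) 2
    · refine tendsto_const_nhds.congr' ?_
      filter_upwards [tendsto_natCast_atTop_atTop.eventually (eventually_gt_atTop ‖ξ‖)] with J hJ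
      rw [Set.indicator_of_notMem (Set.notMem_compl_iff.2 (by simpa using hJ))]
      simp
  have hnear := tendsto_lintegral_lattice_balls hn hlam (Lp.memLp φ)
  have hnear' := ENNReal.Tendsto.const_mul hnear
    (Or.inr (lintegral_enorm_sq_ne_top hf) : _ ∨ ∫⁻ x, ‖f x‖ₑ ^ 2 ≠ ∞)
  have hfar' := ENNReal.Tendsto.const_mul hfar (Or.inr ENNReal.coe_ne_top : _ ∨ (C : ℝ≥0∞) ≠ ∞)
  have hsum := (ENNReal.Tendsto.const_mul hnear' (Or.inr (by norm_num) : _ ∨ (2 : ℝ≥0∞) ≠ ∞)).add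
    (ENNReal.Tendsto.const_mul hfar' (Or.inr (by norm_num) : _ ∨ (2 : ℝ≥0∞) ≠ ∞))
  simp only [mul_zero, add_zero] at hsum
  refine tendsto_of_tendsto_of_tendsto_of_le_of_le tendsto_const_nhds hsum (fun _ => zero_le)
    fun J => ?_
  have hat := fun k => memLp_waveletAtom (lam := lam) φ (-J) k
  set B := Metric.ball (0 : RSpace n) (J : ℝ) with hB
  have hsplit : ∀ k : Fin n → ℤ, ‖∫ x, f x * conj (waveletAtom lam φ (-J) k x)‖ₑ ^ 2 ≤
      2 * ‖∫ x, B.indicator f x * conj (waveletAtom lam φ (-J) k x)‖ₑ ^ 2 +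
      2 * ‖∫ x, Bᶜ.indicator f x * conj (waveletAtom lam φ (-J) k x)‖ₑ ^ 2 := by
    intro k
    refine le_trans ?_ (add_sq_le_two_mul _ _)
    gcongr
    refine le_trans (le_of_eq ?_) (enorm_add_le _ _)
    have i1 : Integrable fun x => B.indicator f x * conj (waveletAtom lam φ (-J) k x) :=
      (hf.indicator (hball J)).integrable_mul (hat k).star
    have i2 : Integrable fun x => Bᶜ.indicator f x * conj (waveletAtom lam φ (-J) k x) :=
      (hf.indicator (hball J).compl).integrable_mul (hat k).star
    rw [← integral_add i1 i2]
    congr 1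
    refine integral_congr_ae (Eventually.of_forall fun x => ?_)
    simp only [← add_mul]
    rw [← Pi.add_apply (B.indicator f), Set.indicator_self_add_compl]
  refine (ENNReal.tsum_le_tsum hsplit).trans ?_
  rw [ENNReal.tsum_add, ENNReal.tsum_mul_left, ENNReal.tsum_mul_left]
  gcongr
  · have hBm : Measurable (B.indicator (1 : RSpace n → ℝ≥0∞)) := measurable_one.indicator (hball J)
    have hk : ∀ k : Fin n → ℤ, ‖∫ x, B.indicator f x * conj (waveletAtom lam φ (-J) k x)‖ₑ ^ 2 ≤
        (∫⁻ x, ‖f x‖ₑ ^ 2) * ∫⁻ y, B.indicator (1 : RSpace n → ℝ≥0∞)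
          (((lam : ℝ) ^ (J : ℤ)) • (y + intVec k)) * ‖φ y‖ₑ ^ 2 := by
      intro k
      have h1 : ∀ x, B.indicator f x * conj (waveletAtom lam φ (-J) k x) =
          f x * conj (B.indicator (waveletAtom lam φ (-J) k) x) := by
        intro x
        by_cases hx : x ∈ B <;> simp [hx]
      simp_rw [h1]
      refine (enorm_integral_mul_conj_sq_le hf.1 ((hat k).1.indicator (hball J))).trans ?_
      refine mul_le_mul' le_rfl ?_
      have h2 := lintegral_mul_enorm_waveletAtom_sq (lam := lam) φ (-J) k hBm.aemeasurable
      rw [neg_neg] at h2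
      rw [← h2]
      refine lintegral_mono fun x => ?_
      change ‖B.indicator (waveletAtom lam φ (-J) k) x‖ₑ ^ 2 ≤ _
      by_cases hx : x ∈ B <;> simp [hx]
    refine (ENNReal.tsum_le_tsum hk).trans ?_
    rw [ENNReal.tsum_mul_left, ← lintegral_tsum]
    · simp_rw [ENNReal.tsum_mul_right]; rfl
    · intro k
      exact (hBm.comp ((measurable_const_smul _).comp (measurable_add_const _))).aemeasurable.mul
        ((Lp.aestronglyMeasurable φ).enorm.pow_const 2)
  · exact hC _ J (hf.indicator (hball J).compl)

end LowFrequency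

/-! ### Fourier transform of wavelet atoms -/

section FourierAtoms

variable {n : ℕ}

lemma enorm_sq_eq_lintegral (f : L2Space n) : ‖f‖ₑ ^ 2 = ∫⁻ x, ‖f x‖ₑ ^ 2 := by
  rw [Lp.enorm_def, eLpNorm_eq_lintegral_rpow_enorm_toReal (by norm_num) (by norm_num),
    ← ENNReal.rpow_natCast, ← ENNReal.rpow_mul]
  norm_num

lemma memLp_of_preserves {A : (RSpace n → ℂ) → RSpace n → ℂ}
    (hm : ∀ f, AEStronglyMeasurable f → AEStronglyMeasurable (A f))
    (hA : ∀ f, AEStronglyMeasurable f → ∫⁻ x, ‖A f x‖ₑ ^ 2 = ∫⁻ x, ‖f x‖ₑ ^ 2) (f : L2Space n) :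
    MemLp (A f) 2 :=
  memLp_two_of_lintegral (hm f (Lp.aestronglyMeasurable f)) (by
    rw [hA f (Lp.aestronglyMeasurable f)]; exact lintegral_enorm_sq_ne_top (Lp.memLp f))

/-- The linear isometry of `L²(ℝⁿ)` induced by a linear operator on functions which respects
almost everywhere equality and preserves the integral of the squared modulus. -/
noncomputable def isometryOfFun (A : (RSpace n → ℂ) → RSpace n → ℂ)
    (hadd : ∀ f g, A (f + g) = A f + A g) (hsmul : ∀ (c : ℂ) f, A (c • f) = c • A f)
    (hae : ∀ f g, f =ᵐ[volume] g → A f =ᵐ[volume] A g)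
    (hm : ∀ f, AEStronglyMeasurable f → AEStronglyMeasurable (A f))
    (hA : ∀ f, AEStronglyMeasurable f → ∫⁻ x, ‖A f x‖ₑ ^ 2 = ∫⁻ x, ‖f x‖ₑ ^ 2) :
    L2Space n →ₗᵢ[ℂ] L2Space n where
  toFun f := (memLp_of_preserves hm hA f).toLp
  map_add' f g := by
    rw [← MemLp.toLp_add, MemLp.toLp_eq_toLp_iff, ← hadd]
    exact hae _ _ (Lp.coeFn_add f g)
  map_smul' c f := by
    rw [RingHom.id_apply, ← MemLp.toLp_const_smul, MemLp.toLp_eq_toLp_iff, ← hsmul]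
    exact hae _ _ (Lp.coeFn_smul c f)
  norm_map' f := by
    have h : ‖(memLp_of_preserves hm hA f).toLp‖ₑ ^ 2 = ‖f‖ₑ ^ 2 := by
      rw [enorm_sq_eq_lintegral, enorm_sq_eq_lintegral, ← hA f (Lp.aestronglyMeasurable f)]
      refine lintegral_congr_ae ?_
      filter_upwards [(memLp_of_preserves hm hA f).coeFn_toLp] with x hx
      rw [hx]
    have h2 := congrArg ENNReal.toReal h
    rw [ENNReal.toReal_pow, ENNReal.toReal_pow, toReal_enorm, toReal_enorm] at h2
    exact (pow_left_inj₀ (norm_nonneg _) (norm_nonneg _) two_ne_zero).1 h2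

lemma coeFn_isometryOfFun {A : (RSpace n → ℂ) → RSpace n → ℂ} {hadd hsmul hae hm hA}
    (f : L2Space n) : isometryOfFun A hadd hsmul hae hm hA f =ᵐ[volume] A f :=
  (memLp_of_preserves hm hA f).coeFn_toLp

variable {lam : ℕ} [NeZero lam]

lemma dil_congr_ae (j : ℤ) {f g : RSpace n → ℂ} (h : f =ᵐ[volume] g) :
    dil lam j f =ᵐ[volume] dil lam j g := by
  filter_upwards [(qmp_smul (n := n) (zpow_pos (lam_pos (lam := lam)) j).ne').ae h] with x hx
  rw [dil, dil, hx]

variable (lam) in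
/-- The operator `ψ ↦ λ^{jn/2} ψ(λ^j · - k)` on `L²(ℝⁿ)`. -/
noncomputable def atomIsometry (j : ℤ) (k : Fin n → ℤ) : L2Space n →ₗᵢ[ℂ] L2Space n :=
  isometryOfFun (fun f => dil lam j fun x => f (x + -intVec k))
    (fun f g => by ext x; simp [dil, mul_add])
    (fun c f => by ext x; simp [dil]; ring)
    (fun f g h => dil_congr_ae j ((qmp_add (-intVec k)).ae h))
    (fun f hf => aestronglyMeasurable_dil j (hf.comp_quasiMeasurePreserving (qmp_add _)))
    (fun f hf => by
      rw [lintegral_enorm_dil_sq j (h := fun x => f (x + -intVec k))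
        (hf.comp_quasiMeasurePreserving (qmp_add _))]
      exact lintegral_add_right_eq_self (fun x => ‖f x‖ₑ ^ 2) (-intVec k))

lemma continuous_expi_two_pi (k : Fin n → ℤ) :
    Continuous fun η : RSpace n => expi k ((2 * Real.pi) • η) :=
  (contDiff_expi k).continuous.comp (continuous_const_smul _)

variable (lam) in
/-- The operator on the Fourier side corresponding to `atomIsometry`. -/
noncomputable def modIsometry (j : ℤ) (k : Fin n → ℤ) : L2Space n →ₗᵢ[ℂ] L2Space n :=
  isometryOfFun (fun F => dil lam (-j) fun η => expi (-k) ((2 * Real.pi) • η) * F η)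
    (fun f g => by ext x; simp [dil, mul_add])
    (fun c f => by ext x; simp [dil]; ring)
    (fun f g h => dil_congr_ae _ (by filter_upwards [h] with x hx; rw [hx]))
    (fun f hf => aestronglyMeasurable_dil _
      ((continuous_expi_two_pi (-k)).aestronglyMeasurable.mul hf))
    (fun f hf => by
      rw [lintegral_enorm_dil_sq _ (h := fun η => expi (-k) ((2 * Real.pi) • η) * f η)
        ((continuous_expi_two_pi (-k)).aestronglyMeasurable.mul hf)]
      refine lintegral_congr fun x => ?_
      rw [enorm_mul, ← ofReal_norm, norm_expi, ENNReal.ofReal_one, one_mul])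

lemma coeFn_atomIsometry (j : ℤ) (k : Fin n → ℤ) (f : L2Space n) :
    atomIsometry lam j k f =ᵐ[volume] dil lam j fun x => f (x + -intVec k) :=
  coeFn_isometryOfFun f

lemma coeFn_modIsometry (j : ℤ) (k : Fin n → ℤ) (F : L2Space n) :
    modIsometry lam j k F =ᵐ[volume]
      dil lam (-j) fun η => expi (-k) ((2 * Real.pi) • η) * F η :=
  coeFn_isometryOfFun F

lemma waveletAtom_ae_eq (ψ : L2Space n) (j : ℤ) (k : Fin n → ℤ) :
    waveletAtom lam ψ j k =ᵐ[volume] atomIsometry lam j k ψ := by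
  refine EventuallyEq.symm ((coeFn_atomIsometry j k ψ).trans (EventuallyEq.of_eq ?_))
  ext x
  simp [dil, waveletAtom, sub_eq_add_neg]

lemma zpow_rpow_neg_half (j : ℤ) : (lam : ℝ) ^ (((-j : ℤ) : ℝ) * (n : ℝ) / 2) =
    ((lam : ℝ) ^ ((j : ℝ) * (n : ℝ) / 2))⁻¹ := by
  rw [← Real.rpow_neg lam_pos.le]
  congr 1
  push_cast; ring

lemma fourierChar_inner_intVec (k : Fin n → ℤ) (η : RSpace n) :
    ((Real.fourierChar (-(inner ℝ (intVec k) η)) : Circle) : ℂ) =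
      expi (-k) ((2 * Real.pi) • η) := by
  rw [Real.fourierChar_apply, expi, PiLp.inner_apply]
  congr 1
  simp only [intVec, RCLike.inner_apply, conj_trivial, PiLp.smul_apply, smul_eq_mul, Pi.neg_apply]
  push_cast
  simp only [Finset.mul_sum, Finset.sum_mul, mul_neg, neg_mul, Finset.sum_neg_distrib]
  congr 1
  exact Finset.sum_congr rfl fun i _ => by ring

/-- The integral Fourier transform of a translated and dilated function. -/
lemma fourier_dil_sub (g : RSpace n → ℂ) (j : ℤ) (k : Fin n → ℤ) (η : RSpace n) :
    𝓕 (dil lam j fun x => g (x + -intVec k)) η =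
      dil lam (-j) (fun ζ => expi (-k) ((2 * Real.pi) • ζ) * 𝓕 g ζ) η := by
  have ha : (0 : ℝ) < (lam : ℝ) ^ j := zpow_pos lam_pos j
  set a : ℝ := (lam : ℝ) ^ j with ha'
  set c : ℝ := (lam : ℝ) ^ ((j : ℝ) * (n : ℝ) / 2) with hc'
  have hc : 0 < c := Real.rpow_pos_of_pos lam_pos _
  have hca : c ^ 2 = a ^ n := zpow_rpow_half_sq (Nat.pos_of_ne_zero (NeZero.ne lam)) j
  let G : RSpace n → ℂ := fun y => Real.fourierChar (-(inner ℝ y (a⁻¹ • η))) • g y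
  have h1 : ∀ x : RSpace n,
      Real.fourierChar (-(inner ℝ x η)) • dil lam j (fun x => g (x + -intVec k)) x =
      ((c : ℂ) * expi (-k) ((2 * Real.pi) • a⁻¹ • η)) * G (a • x + -intVec k) := by
    intro x
    have h2 : -(inner ℝ x η) =
        -(inner ℝ (a • x + -intVec k) (a⁻¹ • η)) + -(inner ℝ (intVec k) (a⁻¹ • η)) := by
      rw [inner_add_left, inner_neg_left, real_inner_smul_left,
        real_inner_smul_right (y := η) (x := x)]
      field_simp
      ring
    rw [h2, AddChar.map_add_eq_mul, ← fourierChar_inner_intVec]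
    simp only [G, dil, Circle.smul_def, smul_eq_mul, Circle.coe_mul, ← ha', ← hc']
    ring
  rw [Real.fourier_eq]
  simp_rw [h1]
  rw [integral_const_mul, Measure.integral_comp_smul volume (fun y => G (y + -intVec k)) a,
    integral_add_right_eq_self G (-intVec k), finrank_euclideanSpace_fin]
  have h3 : ∫ y, G y = 𝓕 g (a⁻¹ • η) := (Real.fourier_eq _ _).symm
  rw [h3, dil, zpow_rpow_neg_half, ← hc', zpow_neg, ← ha', abs_of_pos (by positivity), ← hca,
    Complex.real_smul]
  have : (c : ℂ) ≠ 0 := by exact_mod_cast hc.ne'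
  push_cast
  field_simp

/-- The Fourier transform intertwines `atomIsometry` and `modIsometry`; both sides are continuous,
so it suffices to check Schwartz functions. -/
lemma fourier_atomIsometry (ψ : L2Space n) (j : ℤ) (k : Fin n → ℤ) :
    𝓕 (atomIsometry lam j k ψ) = modIsometry lam j k (𝓕 ψ) := by
  have ha : (lam : ℝ) ^ j ≠ 0 := (zpow_pos lam_pos j).ne'
  refine DenseRange.induction_on (p := fun ψ : L2Space n =>
      𝓕 (atomIsometry lam j k ψ) = modIsometry lam j k (𝓕 ψ))
    (SchwartzMap.denseRange_toLpCLM (p := 2) ENNReal.ofNat_ne_top) ψ ?_ ?_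
  · exact isClosed_eq
      ((Lp.fourierTransformₗᵢ (RSpace n) ℂ).continuous.comp (atomIsometry lam j k).continuous)
      ((modIsometry lam j k).continuous.comp (Lp.fourierTransformₗᵢ (RSpace n) ℂ).continuous)
  · intro g
    let c : ℂ := (((lam : ℝ) ^ ((j : ℝ) * (n : ℝ) / 2) : ℝ) : ℂ)
    let g' : SchwartzMap (RSpace n) ℂ := c • SchwartzMap.compCLMOfContinuousLinearEquiv ℂ
      (ContinuousLinearEquiv.smulLeft (Units.mk0 _ ha)) (SchwartzMap.compSubConstCLM ℂ (intVec k) g)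
    have hg' : (g' : RSpace n → ℂ) = dil lam j fun x => g (x + -intVec k) := by
      ext x
      simp only [g', c, dil, sub_eq_add_neg, smul_apply,
        SchwartzMap.compCLMOfContinuousLinearEquiv_apply, Function.comp_apply,
        SchwartzMap.compSubConstCLM_apply, smul_eq_mul]
      rfl
    have hg : ∀ᵐ x, g.toLp 2 volume x = g x := g.coeFn_toLp 2 volume
    have hFg : ∀ᵐ x, (𝓕 g).toLp 2 volume x = (𝓕 g) x := (𝓕 g).coeFn_toLp 2 volume
    have h1 : atomIsometry lam j k (g.toLp 2 volume) = g'.toLp 2 volume := by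
      refine Lp.ext ((coeFn_atomIsometry j k _).trans ?_)
      refine (dil_congr_ae j ((qmp_add (-intVec k)).ae hg)).trans ?_
      rw [← hg']
      exact (g'.coeFn_toLp 2 volume).symm
    have h2 : modIsometry lam j k ((𝓕 g).toLp 2 volume) = (𝓕 g').toLp 2 volume := by
      refine Lp.ext ((coeFn_modIsometry j k _).trans ?_)
      have h3 : (fun η => expi (-k) ((2 * Real.pi) • η) * (𝓕 g).toLp 2 volume η) =ᵐ[volume]
          fun η => expi (-k) ((2 * Real.pi) • η) * 𝓕 (g : RSpace n → ℂ) η := by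
        filter_upwards [hFg] with η hη
        rw [hη, SchwartzMap.fourier_coe]
      refine (dil_congr_ae (-j) h3).trans ?_
      have h4 : (𝓕 g' : SchwartzMap (RSpace n) ℂ) = (dil lam (-j) fun η =>
          expi (-k) ((2 * Real.pi) • η) * 𝓕 (g : RSpace n → ℂ) η : RSpace n → ℂ) := by
        ext η
        rw [SchwartzMap.fourier_coe, hg', fourier_dil_sub]
      rw [← h4]
      exact ((𝓕 g').coeFn_toLp 2 volume).symm
    rw [SchwartzMap.toLpCLM_apply, h1, SchwartzMap.toLp_fourier_eq, SchwartzMap.toLp_fourier_eq, h2]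

/-- Wavelet coefficients, computed on the Fourier side. -/
lemma integral_mul_conj_waveletAtom (f ψ : L2Space n) (j : ℤ) (k : Fin n → ℤ) :
    ∫ x, f x * conj (waveletAtom lam ψ j k x) =
      ∫ η, dil lam j (𝓕 f : L2Space n) η * conj ((𝓕 ψ : L2Space n) η) *
        expi k ((2 * Real.pi) • η) := by
  have ha : (0 : ℝ) < (lam : ℝ) ^ j := zpow_pos lam_pos j
  have h1 : ∫ x, f x * conj (waveletAtom lam ψ j k x) =
      inner ℂ (atomIsometry lam j k ψ) f := by
    rw [L2.inner_def]
    refine integral_congr_ae ?_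
    filter_upwards [waveletAtom_ae_eq (lam := lam) ψ j k] with x hx
    rw [hx, RCLike.inner_apply]
  rw [h1, ← Lp.inner_fourier_eq, fourier_atomIsometry, L2.inner_def]
  set F : L2Space n := 𝓕 f
  set P : L2Space n := 𝓕 ψ
  let W : RSpace n → ℂ := fun η => expi (-k) ((2 * Real.pi) • η) * P η
  have h2 : ∫ ξ, inner ℂ (modIsometry lam j k P ξ) (F ξ) = ∫ ξ, F ξ * conj (dil lam (-j) W ξ) := by
    refine integral_congr_ae ?_
    filter_upwards [coeFn_modIsometry (lam := lam) j k P] with ξ hξ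
    rw [RCLike.inner_apply, hξ]
  have h3 := Measure.integral_comp_smul volume (fun ξ => F ξ * conj (dil lam (-j) W ξ))
    ((lam : ℝ) ^ j)
  rw [finrank_euclideanSpace_fin, abs_of_pos (by positivity)] at h3
  have h4 : ∫ ξ, F ξ * conj (dil lam (-j) W ξ) = ((((lam : ℝ) ^ j) ^ n : ℝ) : ℂ) *
      ∫ ξ, F (((lam : ℝ) ^ j) • ξ) * conj (dil lam (-j) W (((lam : ℝ) ^ j) • ξ)) := by
    rw [h3, Complex.real_smul, ← mul_assoc, ← Complex.ofReal_mul, mul_inv_cancel₀ (by positivity),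
      Complex.ofReal_one, one_mul]
  rw [h2, h4, ← integral_const_mul]
  refine integral_congr_ae (Eventually.of_forall fun ξ => ?_)
  simp only [dil, zpow_smul_zpow_neg_smul, W, zpow_rpow_neg_half, map_mul, conj_expi,
    Complex.conj_ofReal]
  rw [← zpow_rpow_half_sq (Nat.pos_of_ne_zero (NeZero.ne lam)) j]
  have hneg : expi (-k) (-((2 * Real.pi) • ξ)) = expi k ((2 * Real.pi) • ξ) := by
    simp [expi]
  have hc : (((lam : ℝ) ^ ((j : ℝ) * (n : ℝ) / 2) : ℝ) : ℂ) ≠ 0 := by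
    exact_mod_cast (Real.rpow_pos_of_pos lam_pos _).ne'
  rw [hneg]
  push_cast at hc ⊢
  field_simp

end FourierAtoms

/-! ### The oblique extension principle -/

section Extension

variable {n lam : ℕ} [NeZero lam] {ι : Type} [Fintype ι]
variable {σ : RSpace n → ℝ≥0} {τ : RSpace n → ℂ} {q : ι → RSpace n → ℂ}

lemma lintegral_enorm_fourier_sq (f : L2Space n) :
    ∫⁻ ξ, ‖(𝓕 f : L2Space n) ξ‖ₑ ^ 2 = ∫⁻ x, ‖f x‖ₑ ^ 2 := by
  rw [← enorm_sq_eq_lintegral, ← enorm_sq_eq_lintegral, ← ofReal_norm, ← ofReal_norm,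
    Lp.norm_fourier_eq]

/-- The coefficients of `f` at level `j` have the energy of a bracket product. -/
lemma tsum_enorm_sq_waveletAtom (f ψ : L2Space n) (j : ℤ)
    (hb : ∫⁻ ξ in cube n, ‖bracket (dil lam j (𝓕 f : L2Space n)) (𝓕 ψ : L2Space n) ξ‖ₑ ^ 2 ≠ ∞) :
    ∑' k : Fin n → ℤ, ‖∫ x, f x * conj (waveletAtom lam ψ j k x)‖ₑ ^ 2 =
      ∫⁻ ξ in cube n, ‖bracket (dil lam j (𝓕 f : L2Space n)) (𝓕 ψ : L2Space n) ξ‖ₑ ^ 2 := by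
  simp_rw [integral_mul_conj_waveletAtom]
  exact tsum_enorm_sq_coeff (memLp_dil j (Lp.memLp _)) (Lp.memLp _) hb

/-- The **oblique extension principle**. The energy telescopes over the levels; it tends to `‖f‖²`
at fine levels, and to `0` at coarse levels, where it is dominated by the coefficients of `f`
against the shifts of `φ`. -/
theorem FourierOEP.isTightWaveletFrame (hn : 0 < n) (hlam : 2 ≤ lam) {φ : L2Space n}
    {Ψ : ι → L2Space n}
    (H : FourierOEP lam σ τ q (𝓕 φ : L2Space n) fun l => (𝓕 (Ψ l) : L2Space n)) :
    IsTightWaveletFrame lam Ψ := by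
  intro f
  set F : L2Space n := 𝓕 f with hF
  have hFL := Lp.memLp F
  have hFfin : ∫⁻ ξ, ‖F ξ‖ₑ ^ 2 ≠ ∞ := lintegral_enorm_sq_ne_top hFL
  set E : ℤ → ℝ≥0∞ := fun j => energy σ (𝓕 φ : L2Space n) (dil lam j F) with hE
  set c : ℤ → ℝ≥0∞ := fun j =>
    ∑ l, ∫⁻ ξ in cube n, ‖bracket (dil lam j F) (𝓕 (Ψ l) : L2Space n) ξ‖ₑ ^ 2 with hc
  have hstep : ∀ j, E j + c j = E (j + 1) := fun j => H.energy_dil_succ hFL j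
  obtain ⟨C, hC⟩ := H.energy_le
  have hEfin : ∀ j, E j ≠ ∞ := by
    intro j
    have := hC _ (memLp_dil (lam := lam) j hFL).1
    rw [lintegral_enorm_dil_sq j hFL.1] at this
    exact (this.trans_lt (ENNReal.mul_lt_top ENNReal.coe_lt_top hFfin.lt_top)).ne
  have hcoef : ∀ j l, ∑' k : Fin n → ℤ, ‖∫ x, f x * conj (waveletAtom lam (Ψ l) j k x)‖ₑ ^ 2 =
      ∫⁻ ξ in cube n, ‖bracket (dil lam j F) (𝓕 (Ψ l) : L2Space n) ξ‖ₑ ^ 2 := by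
    intro j l
    refine tsum_enorm_sq_waveletAtom f (Ψ l) j (ne_top_of_le_ne_top (hEfin (j + 1)) ?_)
    rw [← hstep]
    refine le_trans ?_ le_add_self
    exact Finset.single_le_sum (f := fun l =>
      ∫⁻ ξ in cube n, ‖bracket (dil lam j F) (𝓕 (Ψ l) : L2Space n) ξ‖ₑ ^ 2)
      (fun _ _ => zero_le) (Finset.mem_univ l)
  have htop : Tendsto (fun J : ℕ => E J) atTop (𝓝 (∫⁻ ξ, ‖F ξ‖ₑ ^ 2)) :=
    H.tendsto_energy hlam hFL
  obtain ⟨C₁, h1⟩ := H.bound_σ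
  obtain ⟨C₂, h2⟩ := H.bound_Φ
  have hbr : ∀ (h : L2Space n) (j : ℤ),
      ∫⁻ ξ in cube n, ‖bracket (dil lam j (𝓕 h : L2Space n)) (𝓕 φ : L2Space n) ξ‖ₑ ^ 2 ≤
        C₂ * ∫⁻ x, ‖h x‖ₑ ^ 2 := by
    intro h j
    refine (setLIntegral_bracket_le (memLp_dil j (Lp.memLp _)).1 h2).trans (le_of_eq ?_)
    rw [lintegral_enorm_dil_sq j (Lp.memLp _).1, lintegral_enorm_fourier_sq]
  have hfinL : ∀ h : L2Space n, (C₂ : ℝ≥0∞) * ∫⁻ x, ‖h x‖ₑ ^ 2 ≠ ∞ := fun h =>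
    ENNReal.mul_ne_top ENNReal.coe_ne_top (lintegral_enorm_sq_ne_top (Lp.memLp h))
  have hcoarse : Tendsto (fun J : ℕ => ∑' k : Fin n → ℤ,
      ‖∫ x, f x * conj (waveletAtom lam φ (-J) k x)‖ₑ ^ 2) atTop (𝓝 0) := by
    refine tendsto_tsum_coarse hn hlam φ (C := C₂) (fun h J hh => ?_) (Lp.memLp f)
    have hae := hh.coeFn_toLp
    have e1 : ∀ k : Fin n → ℤ, ∫ x, h x * conj (waveletAtom lam φ (-J) k x) =
        ∫ x, hh.toLp h x * conj (waveletAtom lam φ (-J) k x) := fun k =>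
      integral_congr_ae (by filter_upwards [hae] with x hx; rw [hx])
    have e2 : ∫⁻ x, ‖h x‖ₑ ^ 2 = ∫⁻ x, ‖hh.toLp h x‖ₑ ^ 2 :=
      lintegral_congr_ae (by filter_upwards [hae] with x hx; rw [hx])
    simp_rw [e1]
    rw [e2, tsum_enorm_sq_waveletAtom _ _ _ (ne_top_of_le_ne_top (hfinL _) (hbr _ _))]
    exact hbr _ _
  have hbot : Tendsto (fun J : ℕ => E (-J)) atTop (𝓝 0) := by
    have h3 := ENNReal.Tendsto.const_mul (a := (C₁ : ℝ≥0∞)) hcoarse (Or.inr ENNReal.coe_ne_top)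
    rw [mul_zero] at h3
    refine tendsto_of_tendsto_of_tendsto_of_le_of_le tendsto_const_nhds h3 (fun _ => zero_le)
      fun J => ?_
    simp only []
    rw [tsum_enorm_sq_waveletAtom _ _ _ (ne_top_of_le_ne_top (hfinL _) (hbr _ _)),
      ← lintegral_const_mul' _ _ ENNReal.coe_ne_top]
    refine lintegral_mono_ae (ae_restrict_of_ae ?_)
    filter_upwards [h1] with ξ hξ
    gcongr
  have hsum := tsum_int_of_telescope hstep hbot htop
  have hall : ∑' a : ι × ℤ × (Fin n → ℤ),
      ‖∫ x, f x * conj (waveletAtom lam (Ψ a.1) a.2.1 a.2.2 x)‖ₑ ^ 2 = ‖f‖ₑ ^ 2 := by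
    rw [ENNReal.tsum_prod (f := fun l (b : ℤ × (Fin n → ℤ)) =>
        ‖∫ x, f x * conj (waveletAtom lam (Ψ l) b.1 b.2 x)‖ₑ ^ 2)]
    simp_rw [fun l => ENNReal.tsum_prod (f := fun j k =>
        ‖∫ x, f x * conj (waveletAtom lam (Ψ l) j k x)‖ₑ ^ 2), hcoef]
    rw [ENNReal.tsum_comm, enorm_sq_eq_lintegral, ← lintegral_enorm_fourier_sq, ← hF, ← hsum]
    simp_rw [tsum_fintype]
    rfl
  have hs := ENNReal.hasSum_toReal (f := fun a : ι × ℤ × (Fin n → ℤ) =>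
    ‖∫ x, f x * conj (waveletAtom lam (Ψ a.1) a.2.1 a.2.2 x)‖ₑ ^ 2) (by rw [hall]; simp)
  rw [← ENNReal.tsum_toReal_eq (fun _ => by simp), hall] at hs
  simpa using hs

end Extension

/-! ### The infinite product -/

section InfiniteProduct

variable {n lam : ℕ} {f : RSpace n → ℂ}

/-- If `f(ξ) - 1 = O(ξ)` at the origin, then the factors of the infinite product tend to `1`
geometrically fast. -/
lemma summable_norm_dilate_sub_one (hlam : 2 ≤ lam)
    (hf : (fun ξ => f ξ - 1) =O[𝓝 0] fun ξ : RSpace n => ξ) (ξ : RSpace n) :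
    Summable fun j : ℕ => ‖f (((lam : ℝ) ^ (j + 1))⁻¹ • ξ) - 1‖ := by
  have hl : (1 : ℝ) < lam := by exact_mod_cast hlam
  have hz : Tendsto (fun j : ℕ => ((lam : ℝ) ^ (j + 1))⁻¹ • ξ) atTop (𝓝 0) := by
    have h1 : Tendsto (fun J : ℕ => ((lam : ℝ) ^ (J + 1))⁻¹) atTop (𝓝 0) :=
      tendsto_inv_atTop_zero.comp ((tendsto_pow_atTop_atTop_of_one_lt hl).comp
        (tendsto_add_atTop_nat 1))
    simpa using h1.smul_const ξ
  have hg : Summable fun j : ℕ => ((lam : ℝ)⁻¹) ^ j :=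
    summable_geometric_of_lt_one (by positivity) (inv_lt_one_of_one_lt₀ hl)
  refine summable_of_isBigO_nat hg ((hf.comp_tendsto hz).norm_left.trans ?_)
  refine Asymptotics.IsBigO.of_bound ((lam : ℝ)⁻¹ * ‖ξ‖) (Eventually.of_forall fun j => ?_)
  simp only [Function.comp_apply, norm_smul, norm_inv, norm_pow, Real.norm_natCast]
  rw [pow_succ, inv_pow, mul_inv]
  exact le_of_eq (by ring)

lemma multipliable_dilate (hlam : 2 ≤ lam)
    (hf : (fun ξ => f ξ - 1) =O[𝓝 0] fun ξ : RSpace n => ξ) (ξ : RSpace n) :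
    Multipliable fun j : ℕ => f (((lam : ℝ) ^ (j + 1))⁻¹ • ξ) := by
  simpa using multipliable_one_add_of_summable (summable_norm_dilate_sub_one hlam hf ξ)

/-- Refinability of the infinite product, at every point. -/
lemma phiHat_smul (hlam : 2 ≤ lam)
    (hf : (fun ξ => f ξ - 1) =O[𝓝 0] fun ξ : RSpace n => ξ) (ξ : RSpace n) :
    phiHat lam f ((lam : ℝ) • ξ) = f ξ * phiHat lam f ξ := by
  have hl : (lam : ℝ) ≠ 0 := by positivity
  have hdil : ∀ j : ℕ, ((lam : ℝ) ^ (j + 1))⁻¹ • (lam : ℝ) • ξ = ((lam : ℝ) ^ j)⁻¹ • ξ := by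
    intro j
    rw [smul_smul, pow_succ]; congr 1; field_simp
  have hm := multipliable_dilate hlam hf ((lam : ℝ) • ξ)
  simp only [phiHat]
  have := (multipliable_dilate hlam hf ξ).hasProd.zero_mul
    (f := fun j : ℕ => f (((lam : ℝ) ^ j)⁻¹ • ξ))
  simp only [pow_zero, inv_one, one_smul] at this
  rw [← this.tprod_eq]
  exact tprod_congr fun j => by rw [hdil]

/-- The infinite product is close to `1` near the origin, since `|∏ (1 + aⱼ) - 1| ≤ exp(∑ |aⱼ|) - 1`
and `∑ |aⱼ| ≤ C |ξ|`. -/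
lemma phiHat_tendsto_one (hlam : 2 ≤ lam)
    (hf : (fun ξ => f ξ - 1) =O[𝓝 0] fun ξ : RSpace n => ξ) :
    Tendsto (phiHat lam f) (𝓝 0) (𝓝 1) := by
  have hl : (1 : ℝ) < lam := by exact_mod_cast hlam
  obtain ⟨C, hC0, hC⟩ := hf.exists_nonneg
  obtain ⟨δ, hδ, hball⟩ := Metric.eventually_nhds_iff_ball.1 hC.bound
  have hgeo : ∀ s : Finset ℕ, ∑ j ∈ s, ((lam : ℝ) ^ (j + 1))⁻¹ ≤ 1 := by
    intro s
    calc ∑ j ∈ s, ((lam : ℝ) ^ (j + 1))⁻¹ ≤ ∑ j ∈ s, (1 / 2 : ℝ) / 2 ^ j := by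
          refine Finset.sum_le_sum fun j _ => ?_
          rw [div_div, ← pow_succ', one_div]
          gcongr
          exact_mod_cast hlam
      _ ≤ 1 := sum_le_hasSum s (fun _ _ => by positivity) (by simpa using hasSum_geometric_two' 1)
  have hbound : ∀ ξ ∈ Metric.ball (0 : RSpace n) δ,
      ‖phiHat lam f ξ - 1‖ ≤ Real.exp (C * ‖ξ‖) - 1 := by
    intro ξ hξ
    have hp := (multipliable_dilate hlam hf ξ).hasProd
    refine le_of_tendsto ((hp.sub_const 1).norm) (Eventually.of_forall fun s => ?_)
    have h1 := s.norm_prod_one_add_sub_one_le fun j => f (((lam : ℝ) ^ (j + 1))⁻¹ • ξ) - 1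
    simp only [add_sub_cancel] at h1
    refine h1.trans ?_
    gcongr
    calc ∑ j ∈ s, ‖f (((lam : ℝ) ^ (j + 1))⁻¹ • ξ) - 1‖
        ≤ ∑ j ∈ s, C * (((lam : ℝ) ^ (j + 1))⁻¹ * ‖ξ‖) := by
          refine Finset.sum_le_sum fun j _ => ?_
          have hnorm : ‖((lam : ℝ) ^ (j + 1))⁻¹ • ξ‖ = ((lam : ℝ) ^ (j + 1))⁻¹ * ‖ξ‖ := by
            rw [norm_smul, norm_inv, norm_pow, Real.norm_natCast]
          rw [← hnorm]
          refine hball _ ?_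
          rw [mem_ball_zero_iff] at hξ ⊢
          rw [hnorm]
          refine lt_of_le_of_lt ?_ hξ
          refine mul_le_of_le_one_left (norm_nonneg _) (inv_le_one_of_one_le₀ ?_)
          exact one_le_pow₀ hl.le
      _ = C * ‖ξ‖ * ∑ j ∈ s, ((lam : ℝ) ^ (j + 1))⁻¹ := by
          rw [Finset.mul_sum]; exact Finset.sum_congr rfl fun j _ => by ring
      _ ≤ C * ‖ξ‖ := mul_le_of_le_one_right (by positivity) (hgeo s)
  rw [tendsto_iff_norm_sub_tendsto_zero]
  have hlim : Tendsto (fun ξ : RSpace n => Real.exp (C * ‖ξ‖) - 1) (𝓝 0) (𝓝 0) := by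
    have : Continuous fun ξ : RSpace n => Real.exp (C * ‖ξ‖) - 1 := by fun_prop
    simpa using this.tendsto 0
  refine tendsto_of_tendsto_of_tendsto_of_le_of_le' tendsto_const_nhds hlim
    (Eventually.of_forall fun _ => norm_nonneg _) ?_
  filter_upwards [Metric.ball_mem_nhds 0 hδ] with ξ hξ using hbound ξ hξ

lemma tendsto_prod_range_phiHat (hlam : 2 ≤ lam)
    (hf : (fun ξ => f ξ - 1) =O[𝓝 0] fun ξ : RSpace n => ξ) (ξ : RSpace n) :
    Tendsto (fun J => ∏ j ∈ Finset.range J, f (((lam : ℝ) ^ (j + 1))⁻¹ • ξ)) atTop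
      (𝓝 (phiHat lam f ξ)) :=
  (multipliable_dilate hlam hf ξ).hasProd.tendsto_prod_nat

lemma measurable_phiHat (hlam : 2 ≤ lam)
    (hf : (fun ξ => f ξ - 1) =O[𝓝 0] fun ξ : RSpace n => ξ) (hm : Measurable f) :
    Measurable (phiHat lam f) :=
  measurable_of_tendsto_metrizable
    (fun J => Finset.measurable_fun_prod (Finset.range J) fun j _ =>
      hm.comp (measurable_const_smul (((lam : ℝ) ^ (j + 1))⁻¹)))
    (tendsto_pi_nhds.2 fun ξ => tendsto_prod_range_phiHat hlam hf ξ)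

end InfiniteProduct

/-! ### Algebra of the masks -/

section Masks

variable {n lam N : ℕ}

/-- The relations between `S, s, p, g` at a point where all of them are defined and `S` does not
vanish, in the form used by the mask computation. -/
structure RegularAt (S s : RatTrigPoly n) (p : Fin (lam ^ n) → RatTrigPoly n)
    (g : Fin N → RatTrigPoly n) (ξ : RSpace n) : Prop where
  real : ((S ξ).re : ℂ) = S ξ
  pos : 0 < (S ξ).re
  mul_s_sq : S ξ * (s ξ * conj (s ξ)) = 1
  mul_sum : S ξ * (∑ l, g l ξ * conj (g l ξ) +
    ((lam : ℂ) ^ n)⁻¹ * ∑ m, p m ξ * conj (p m ξ)) = 1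

/-- Expansion of `∑ q q̄'` for the masks of the construction, at two points `ξ, ξ'` of a fibre. The
letters stand for `SL = S(λξ)`, `t = τ`, `A = S s`, `e m = exp(i ν_m·ξ)`, `L = λⁿ` and
`r = λ^{-n/2}`, while `p m`, `g l` are values at `λξ`; primes mark values at `ξ'`. The cross terms
are evaluated by the definition of `τ`, and `hc` cancels what is left. -/
lemma mask_sum_algebra {κ κ' : Type*} [Fintype κ] [Fintype κ'] {SL t t' A A' s s' r L : ℂ}
    {e e' p : κ → ℂ} {g : κ' → ℂ} (hL : L ≠ 0) (hSL : conj SL = SL) (hr : r ^ 2 = L⁻¹)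
    (hrr : conj r = r) (hA : A * conj s = 1) (hA' : A' * conj s' = 1)
    (h1 : ∑ m, p m * e m = L * (t * conj s)) (h2 : ∑ m, p m * e' m = L * (t' * conj s'))
    (hc : SL * (∑ l, g l * conj (g l) + L⁻¹ * ∑ m, p m * conj (p m)) = 1) :
    SL * t * conj t' + (∑ l, SL * t * conj (g l) * conj (SL * t' * conj (g l)) +
      ∑ m, r * (A * e m - SL * t * conj (p m)) * conj (r * (A' * e' m - SL * t' * conj (p m)))) =
      L⁻¹ * (A * conj A') * ∑ m, e m * conj (e' m) := by
  have e1 : ∑ l, SL * t * conj (g l) * conj (SL * t' * conj (g l)) =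
      SL ^ 2 * t * conj t' * ∑ l, g l * conj (g l) := by
    rw [Finset.mul_sum]
    refine Finset.sum_congr rfl fun l _ => ?_
    simp only [map_mul, Complex.conj_conj, hSL]; ring
  have h2' : ∑ m, conj (p m) * conj (e' m) = conj (L * (t' * conj s')) := by
    rw [← h2, map_sum]; simp only [map_mul]
  have hLc : conj L = L := by
    have := congrArg conj hr
    rw [map_pow, hrr, map_inv₀, hr] at this
    exact (inv_injective this).symm
  have e2 : ∑ m, r * (A * e m - SL * t * conj (p m)) *
      conj (r * (A' * e' m - SL * t' * conj (p m))) =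
      r ^ 2 * (A * conj A' * ∑ m, e m * conj (e' m) - A * SL * conj t' * (∑ m, p m * e m) -
        SL * t * conj A' * (∑ m, conj (p m) * conj (e' m)) +
        SL ^ 2 * t * conj t' * ∑ m, p m * conj (p m)) := by
    simp only [Finset.mul_sum, ← Finset.sum_sub_distrib, ← Finset.sum_add_distrib]
    refine Finset.sum_congr rfl fun m _ => ?_
    simp only [map_mul, map_sub, Complex.conj_conj, hSL, hrr]; ring
  have hA'' : conj A' * s' = 1 := by
    have := congrArg conj hA'
    simpa using this
  rw [e1, e2, h1, h2', hr]
  simp only [map_mul, Complex.conj_conj, hLc]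
  have hLL : L⁻¹ * L = 1 := inv_mul_cancel₀ hL
  linear_combination (SL * t * conj t') * hc - (L⁻¹ * L * SL * t * conj t') * hA -
    (L⁻¹ * L * SL * t * conj t') * hA'' - 2 * SL * t * conj t' * hLL

variable {S s : RatTrigPoly n} {p : Fin (lam ^ n) → RatTrigPoly n} {g : Fin N → RatTrigPoly n}
  {ν : Fin (lam ^ n) → Fin n → Fin lam}

lemma rpow_neg_half_sq (hlam : 0 < lam) :
    ((((lam : ℝ) ^ (-(n : ℝ) / 2) : ℝ) : ℂ)) ^ 2 = ((lam : ℂ) ^ n)⁻¹ := by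
  have hl : (0 : ℝ) < lam := by exact_mod_cast hlam
  have h : ((lam : ℝ) ^ (-(n : ℝ) / 2)) ^ 2 = ((lam : ℝ) ^ n)⁻¹ := by
    rw [← Real.rpow_natCast, ← Real.rpow_mul hl.le, ← Real.rpow_natCast, ← Real.rpow_neg hl.le]
    congr 1
    push_cast; ring
  rw [← Complex.ofReal_pow, h]
  push_cast; rfl

lemma RegularAt.s_ne_zero {ξ : RSpace n} (h : RegularAt S s p g ξ) : s ξ ≠ 0 := by
  intro h0
  have := h.mul_s_sq
  rw [h0] at this
  simp at this

lemma smul_add_two_pi_div (hlam : 0 < lam) (ξ : RSpace n) (k : Fin n → ℤ) :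
    (lam : ℝ) • (ξ + (2 * Real.pi / lam) • intVec k) =
      (lam : ℝ) • ξ + (2 * Real.pi) • intVec k := by
  have hl : (lam : ℝ) ≠ 0 := by exact_mod_cast hlam.ne'
  rw [smul_add, smul_smul, mul_div_cancel₀ _ hl]

lemma refinementMask_mul_conj_s {ξ : RSpace n} (hlam : 0 < lam) (hs : s ξ ≠ 0) :
    ∑ m, p m ((lam : ℝ) • ξ) * expLam (ν m) ξ =
      (lam : ℂ) ^ n * (refinementMask s p ν ξ * conj (s ξ)) := by
  have hl : (lam : ℂ) ^ n ≠ 0 := pow_ne_zero _ (by exact_mod_cast hlam.ne')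
  have hs' : conj (s ξ) ≠ 0 := by simpa using hs
  rw [refinementMask, div_mul_cancel₀ _ hs', mul_inv_cancel_left₀ hl]

/-- The identity of the oblique extension principle for the masks of the construction: the
left-hand side collapses to `λ^{-n} S s(ξ) conj(S s(ξ')) ∑_ν exp(i ν·(ξ - ξ'))`. -/
lemma mask_identity (hlam : 0 < lam) (hν : Function.Injective ν) {ξ : RSpace n} (k k' : Fin n → ℤ)
    (h0 : RegularAt S s p g ((lam : ℝ) • ξ))
    (h1 : RegularAt S s p g (ξ + (2 * Real.pi / lam) • intVec k))
    (h2 : RegularAt S s p g (ξ + (2 * Real.pi / lam) • intVec k')) :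
    S ((lam : ℝ) • ξ) * refinementMask s p ν (ξ + (2 * Real.pi / lam) • intVec k) *
        conj (refinementMask s p ν (ξ + (2 * Real.pi / lam) • intVec k')) +
      ∑ l, waveletMasks S s p g ν l (ξ + (2 * Real.pi / lam) • intVec k) *
        conj (waveletMasks S s p g ν l (ξ + (2 * Real.pi / lam) • intVec k')) =
      if ∀ i, (lam : ℤ) ∣ k i - k' i then S (ξ + (2 * Real.pi / lam) • intVec k) else 0 := by
  have hL : (lam : ℂ) ^ n ≠ 0 := pow_ne_zero _ (by exact_mod_cast hlam.ne')
  set a := ξ + (2 * Real.pi / lam) • intVec k with ha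
  set a' := ξ + (2 * Real.pi / lam) • intVec k' with ha'
  have hla : (lam : ℝ) • a = (lam : ℝ) • ξ + (2 * Real.pi) • intVec k :=
    smul_add_two_pi_div hlam ξ k
  have hla' : (lam : ℝ) • a' = (lam : ℝ) • ξ + (2 * Real.pi) • intVec k' :=
    smul_add_two_pi_div hlam ξ k'
  have hval : ∀ r : RatTrigPoly n, r ((lam : ℝ) • a) = r ((lam : ℝ) • ξ) := fun r => by
    rw [hla, r.eval_add_period]
  have hval' : ∀ r : RatTrigPoly n, r ((lam : ℝ) • a') = r ((lam : ℝ) • ξ) := fun r => by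
    rw [hla', r.eval_add_period]
  have hreal : ∀ {ζ : RSpace n}, RegularAt S s p g ζ → conj (S ζ) = S ζ := fun h => by
    rw [← h.real, Complex.conj_ofReal]
  have e1 := refinementMask_mul_conj_s (p := p) (ν := ν) hlam h1.s_ne_zero
  have e2 := refinementMask_mul_conj_s (p := p) (ν := ν) hlam h2.s_ne_zero
  simp only [hval] at e1
  simp only [hval'] at e2
  have key := mask_sum_algebra (SL := S ((lam : ℝ) • ξ)) (A := S a * s a) (A' := S a' * s a')
    hL (hreal h0) (rpow_neg_half_sq hlam) (Complex.conj_ofReal _)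
    (by rw [mul_assoc]; exact h1.mul_s_sq) (by rw [mul_assoc]; exact h2.mul_s_sq) e1 e2 h0.mul_sum
  simp only [Fintype.sum_sum_type, waveletMasks, Sum.elim_inl, Sum.elim_inr, mask₁, mask₂, hval,
    hval']
  rw [key]
  have hsum : ∑ m, expLam (ν m) a * conj (expLam (ν m) a') =
      if ∀ i, (lam : ℤ) ∣ k i - k' i then (lam : ℂ) ^ n else 0 := by
    have hbij : Function.Bijective ν :=
      (Fintype.bijective_iff_injective_and_card ν).2 ⟨hν, by simp⟩
    rw [hbij.sum_comp (fun μ => expLam μ a * conj (expLam μ a')),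
      ← sum_expLam_eq hlam (fun i => k i - k' i)]
    refine Finset.sum_congr rfl fun μ _ => ?_
    rw [expLam, expLam, expLam, conj_expi, ← expi_add_right]
    congr 1
    have : (fun i => k i - k' i) = k - k' := rfl
    rw [this, intVec_sub, smul_sub, ha, ha']
    abel
  rw [hsum]
  split_ifs with hdvd
  · -- the two points differ by a period, so `S s` takes the same value at both
    choose d hd using hdvd
    have haa : a = a' + (2 * Real.pi) • intVec d := by
      have hl : (lam : ℝ) ≠ 0 := by exact_mod_cast hlam.ne'
      have : k = k' + lam • d := by
        ext i
        have := hd i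
        rw [Pi.add_apply, Pi.smul_apply, nsmul_eq_mul]
        linarith
      rw [ha, ha', this, intVec_add, ← smul_intVec, smul_add, smul_smul, div_mul_cancel₀ _ hl,
        add_assoc]
    have hS : S a' = S a := by rw [haa, S.eval_add_period]
    have hs : s a' = s a := by rw [haa, s.eval_add_period]
    rw [hS, hs, map_mul, hreal h1]
    have h3 := h1.mul_s_sq
    field_simp
    linear_combination (S a) * h3
  · rw [mul_zero]

end Masks

/-! ### Consequences of the hypotheses on `S, s, p, g` -/

section Regularity

variable {n lam N : ℕ} {S s : RatTrigPoly n} {p : Fin (lam ^ n) → RatTrigPoly n}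
  {g : Fin N → RatTrigPoly n} {ν : Fin (lam ^ n) → Fin n → Fin lam}

/-- The hypotheses on `S, s, p, g` give the relations of `RegularAt` off the zero sets of finitely
many trigonometric polynomials. Summing over `l` the relations for `|p_l|²` yields `mul_sum`. -/
lemma ae_regularAt (hlam : 0 < lam) (hN : N ≤ lam ^ n)
    (hS_nonneg : ∀ ξ, S.DefinedAt ξ → (S ξ).im = 0 ∧ 0 ≤ (S ξ).re) (hS_zero : S 0 = 1)
    (hpg : ∀ (l : Fin N) (ξ : RSpace n), S.DefinedAt ξ → S ξ ≠ 0 →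
      (p (Fin.castLE hN l)).DefinedAt ξ → (g l).DefinedAt ξ →
      (S ξ)⁻¹ - (‖p (Fin.castLE hN l) ξ‖ : ℂ) ^ 2 = (lam : ℂ) ^ n * (‖g l ξ‖ : ℂ) ^ 2)
    (hs : ∀ ξ, S.DefinedAt ξ → S ξ ≠ 0 → s.DefinedAt ξ → (‖s ξ‖ : ℂ) ^ 2 = (S ξ)⁻¹)
    (hp_rest : ∀ l : Fin (lam ^ n), N ≤ (l : ℕ) → ∀ ξ, S.DefinedAt ξ → S ξ ≠ 0 →
      (p l).DefinedAt ξ → (‖p l ξ‖ : ℂ) ^ 2 = (S ξ)⁻¹) :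
    ∀ᵐ ξ, RegularAt S s p g ξ := by
  have hL : (lam : ℂ) ^ n ≠ 0 := pow_ne_zero _ (by exact_mod_cast hlam.ne')
  filter_upwards [S.ae_definedAt, S.ae_ne_zero (ξ₀ := 0) (by rw [hS_zero]; exact one_ne_zero),
    s.ae_definedAt, ae_all_iff.2 fun l => (p l).ae_definedAt,
    ae_all_iff.2 fun l => (g l).ae_definedAt] with ξ hSd hS0 hsd hpd hgd
  obtain ⟨him, hre⟩ := hS_nonneg ξ hSd
  have hreal : ((S ξ).re : ℂ) = S ξ := Complex.ext (by simp) (by simp [him])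
  refine ⟨hreal, lt_of_le_of_ne hre fun h0 => hS0 ?_, ?_, ?_⟩
  · rw [← hreal, ← h0, Complex.ofReal_zero]
  · rw [Complex.mul_conj', hs ξ hSd hS0 hsd, mul_inv_cancel₀ hS0]
  · simp only [Complex.mul_conj']
    set G : Fin (lam ^ n) → ℂ := fun m => if h : (m : ℕ) < N then (‖g ⟨m, h⟩ ξ‖ : ℂ) ^ 2 else 0
      with hG
    have hpG : ∀ m, (‖p m ξ‖ : ℂ) ^ 2 = (S ξ)⁻¹ - (lam : ℂ) ^ n * G m := by
      intro m
      by_cases h : (m : ℕ) < N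
      · have h1 := hpg ⟨m, h⟩ ξ hSd hS0 (hpd _) (hgd _)
        have h2 : Fin.castLE hN ⟨m, h⟩ = m := rfl
        rw [h2] at h1
        simp only [hG, h, dif_pos]
        linear_combination -h1
      · simp only [hG, h, dif_neg, not_false_eq_true, mul_zero, sub_zero]
        exact hp_rest m (not_lt.1 h) ξ hSd hS0 (hpd m)
    have hsumG : ∑ l, (‖g l ξ‖ : ℂ) ^ 2 = ∑ m, G m := by
      refine Fintype.sum_of_injective (Fin.castLE hN) (Fin.castLE_injective hN) _ _ ?_ ?_
      · intro m hm
        refine dif_neg fun h => hm ⟨⟨m, h⟩, rfl⟩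
      · intro l
        simp [hG]
    simp only [hpG]
    rw [hsumG, Finset.sum_sub_distrib, ← Finset.mul_sum, Finset.sum_const, Finset.card_univ,
      Fintype.card_fin, nsmul_eq_mul]
    push_cast
    field_simp
    ring

/-- The fibres `ξ + Γ` (and the points `λξ`) avoid the exceptional points for almost every `ξ`. -/
lemma ae_fibre_regularAt (hlam : 0 < lam) (hreg : ∀ᵐ ξ, RegularAt S s p g ξ) :
    ∀ᵐ ξ, RegularAt S s p g ((lam : ℝ) • ξ) ∧
      ∀ k : Fin n → ℤ, RegularAt S s p g (ξ + (2 * Real.pi / lam) • intVec k) :=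
  ((qmp_smul (r := (lam : ℝ)) (by exact_mod_cast hlam.ne')).ae hreg).and
    (ae_all_iff.2 fun _ => (qmp_add _).ae hreg)

/-- Since `|p_l(0)| ≤ 1` for all `l`, the normalisation `τ(0) = 1` forces `p_l(0) ≠ 0`; so the
mask is differentiable at the origin. -/
lemma refinementMask_sub_one_isBigO (hlam : 0 < lam) (hp : ∀ l, ‖p l 0‖ ≤ 1) (hs_zero : s 0 = 1)
    (hτ_zero : refinementMask s p ν 0 = 1) :
    (fun ξ => refinementMask s p ν ξ - 1) =O[𝓝 0] fun ξ : RSpace n => ξ := by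
  have hL : (lam : ℂ) ^ n ≠ 0 := pow_ne_zero _ (by exact_mod_cast hlam.ne')
  have hsum : ∑ l, p l 0 = (lam : ℂ) ^ n := by
    have h := refinementMask_mul_conj_s (p := p) (ν := ν) (s := s) (ξ := 0) hlam
      (by rw [hs_zero]; exact one_ne_zero)
    simpa [hτ_zero, hs_zero, expLam, expi_zero_right] using h
  have hre : ∑ l, (1 - (p l 0).re) = 0 := by
    have := congrArg Complex.re hsum
    rw [Complex.re_sum] at this
    rw [Finset.sum_sub_distrib, this, ← Nat.cast_pow, Complex.natCast_re]
    simp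
  have hle : ∀ l, 0 ≤ 1 - (p l 0).re := fun l =>
    sub_nonneg.2 ((Complex.re_le_norm _).trans (hp l))
  have hpd : ∀ l, (p l).DefinedAt 0 := by
    intro l
    refine (p l).definedAt_of_ne_zero fun h0 => ?_
    have := (Finset.sum_eq_zero_iff_of_nonneg fun l _ => hle l).1 hre l (Finset.mem_univ l)
    simp [h0] at this
  have hsd : s.DefinedAt 0 := s.definedAt_of_ne_zero (by rw [hs_zero]; exact one_ne_zero)
  have hdiff : ContDiffAt ℝ 1 (refinementMask s p ν) 0 := by
    refine ContDiffAt.mul (contDiffAt_const.mul (ContDiffAt.sum fun l _ => ContDiffAt.mul ?_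
      (contDiff_expi _).contDiffAt)) (ContDiffAt.inv ?_ ?_)
    · refine ContDiffAt.comp (g := (p l : RSpace n → ℂ)) _ ?_ (contDiff_const_smul _).contDiffAt
      rw [smul_zero]
      exact (p l).contDiffAt (hpd l)
    · exact Complex.conjCLE.contDiff.contDiffAt.comp (0 : RSpace n) (s.contDiffAt hsd)
    · rw [hs_zero]; simp
  simpa [hτ_zero] using (hdiff.differentiableAt one_ne_zero).isBigO_sub

lemma EssBounded.exists_enorm_le {f : RSpace n → ℂ} (hf : EssBounded f) :
    ∃ C : ℝ≥0, ∀ᵐ ξ, ‖f ξ‖ₑ ≤ C := by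
  have h := hf.2
  rw [eLpNorm_exponent_top] at h
  refine ⟨(eLpNormEssSup f volume).toNNReal, ?_⟩
  rw [ENNReal.coe_toNNReal h.ne]
  exact ae_le_eLpNormEssSup

end Regularity

/-! ### Boundedness of the masks -/

section MaskBounds

variable {n lam N : ℕ} {S s : RatTrigPoly n} {p : Fin (lam ^ n) → RatTrigPoly n}
  {g : Fin N → RatTrigPoly n} {ν : Fin (lam ^ n) → Fin n → Fin lam}

lemma measurable_refinementMask : Measurable (refinementMask s p ν) := by
  unfold refinementMask expLam
  refine Measurable.div (Measurable.const_mul (Finset.measurable_fun_sum _ fun l _ => ?_) _)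
    (Complex.continuous_conj.measurable.comp s.measurable_eval)
  exact ((p l).measurable_eval.comp (measurable_const_smul _)).mul
    (contDiff_expi _).continuous.measurable

lemma measurable_waveletMasks (l : Fin N ⊕ Fin (lam ^ n)) :
    Measurable (waveletMasks S s p g ν l) := by
  have hd : ∀ r : RatTrigPoly n, Measurable fun ξ => r ((lam : ℝ) • ξ) := fun r =>
    r.measurable_eval.comp (measurable_const_smul _)
  have hc : ∀ r : RatTrigPoly n, Measurable fun ξ => conj (r ((lam : ℝ) • ξ)) := fun r =>
    Complex.continuous_conj.measurable.comp (hd r)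
  rcases l with l | l
  · exact ((hd S).mul measurable_refinementMask).mul (hc (g l))
  · refine Measurable.const_mul (Measurable.sub ?_ ?_) _
    · exact (S.measurable_eval.mul s.measurable_eval).mul (contDiff_expi _).continuous.measurable
    · exact ((hd S).mul measurable_refinementMask).mul (hc (p l))

lemma refinementMask_add_period (ξ : RSpace n) (k : Fin n → ℤ) :
    refinementMask s p ν (ξ + (2 * Real.pi) • intVec k) = refinementMask s p ν ξ := by
  have hl : ∀ r : RatTrigPoly n, r ((lam : ℝ) • (ξ + (2 * Real.pi) • intVec k)) =
      r ((lam : ℝ) • ξ) := fun r => by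
    rw [smul_add, smul_comm, smul_intVec, r.eval_add_period]
  simp only [refinementMask, hl, s.eval_add_period, expLam, expi_add_right, expi_intVec, mul_one]

lemma waveletMasks_add_period (l : Fin N ⊕ Fin (lam ^ n)) (ξ : RSpace n) (k : Fin n → ℤ) :
    waveletMasks S s p g ν l (ξ + (2 * Real.pi) • intVec k) = waveletMasks S s p g ν l ξ := by
  have hl : ∀ r : RatTrigPoly n, r ((lam : ℝ) • (ξ + (2 * Real.pi) • intVec k)) =
      r ((lam : ℝ) • ξ) := fun r => by
    rw [smul_add, smul_comm, smul_intVec, r.eval_add_period]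
  rcases l with l | l
  · simp only [waveletMasks, Sum.elim_inl, mask₁, hl, refinementMask_add_period]
  · simp only [waveletMasks, Sum.elim_inr, mask₂, hl, refinementMask_add_period,
      RatTrigPoly.eval_add_period, expLam, expi_add_right, expi_intVec, mul_one]

/-- The diagonal case of the identity bounds all masks by `S`. -/
lemma mask_energy (hlam : 0 < lam) (hν : Function.Injective ν) {ξ : RSpace n}
    (h0 : RegularAt S s p g ((lam : ℝ) • ξ)) (h1 : RegularAt S s p g ξ) :
    (S ((lam : ℝ) • ξ)).re * ‖refinementMask s p ν ξ‖ ^ 2 +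
      ∑ l, ‖waveletMasks S s p g ν l ξ‖ ^ 2 = (S ξ).re := by
  have hz : ξ + (2 * Real.pi / lam) • intVec (0 : Fin n → ℤ) = ξ := by
    rw [intVec_zero, smul_zero, add_zero]
  have h1' : RegularAt S s p g (ξ + (2 * Real.pi / lam) • intVec (0 : Fin n → ℤ)) := by rwa [hz]
  have h := mask_identity hlam hν 0 0 h0 h1' h1'
  simp only [hz, sub_self, dvd_zero, implies_true, if_true, mul_assoc, Complex.mul_conj'] at h
  rw [← h0.real, ← h1.real] at h
  exact_mod_cast h

lemma essBounded_of_sq_le {f : RSpace n → ℂ} (hf : Measurable f) {C : ℝ}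
    (h : ∀ᵐ ξ, ‖f ξ‖ ^ 2 ≤ C) : EssBounded f := by
  refine memLp_top_of_bound hf.aestronglyMeasurable (Real.sqrt C) ?_
  filter_upwards [h] with ξ hξ using Real.le_sqrt_of_sq_le hξ

lemma essBounded_waveletMasks (hlam : 0 < lam) (hν : Function.Injective ν)
    (hreg : ∀ᵐ ξ, RegularAt S s p g ξ) (hS : EssBounded S) (l : Fin N ⊕ Fin (lam ^ n)) :
    EssBounded (waveletMasks S s p g ν l) := by
  obtain ⟨C, hC⟩ := hS.exists_enorm_le
  refine essBounded_of_sq_le (measurable_waveletMasks l) (C := C) ?_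
  filter_upwards [hC, hreg, (qmp_smul (r := (lam : ℝ)) (by exact_mod_cast hlam.ne')).ae hreg]
    with ξ hξ h1 h0
  have h := mask_energy hlam hν h0 h1
  have h2 : ‖waveletMasks S s p g ν l ξ‖ ^ 2 ≤ ∑ l, ‖waveletMasks S s p g ν l ξ‖ ^ 2 :=
    Finset.single_le_sum (f := fun l => ‖waveletMasks S s p g ν l ξ‖ ^ 2)
      (fun _ _ => by positivity) (Finset.mem_univ l)
  have h3 : 0 ≤ (S ((lam : ℝ) • ξ)).re * ‖refinementMask s p ν ξ‖ ^ 2 :=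
    mul_nonneg h0.pos.le (by positivity)
  have h4 : ‖S ξ‖ ≤ C := by exact_mod_cast enorm_le_coe.1 hξ
  linarith [Complex.re_le_norm (S ξ)]

lemma essBounded_refinementMask (hlam : 0 < lam) (hν : Function.Injective ν)
    (hreg : ∀ᵐ ξ, RegularAt S s p g ξ) (hS : EssBounded S)
    (hS' : EssBounded fun ξ => (S ξ)⁻¹) : EssBounded (refinementMask s p ν) := by
  obtain ⟨C, hC⟩ := hS.exists_enorm_le
  obtain ⟨C', hC'⟩ := hS'.exists_enorm_le
  have hl := qmp_smul (n := n) (r := (lam : ℝ)) (by exact_mod_cast hlam.ne')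
  refine essBounded_of_sq_le measurable_refinementMask (C := C' * C) ?_
  filter_upwards [hC, hreg, hl.ae hreg, hl.ae hC'] with ξ hξ h1 h0 hξ'
  have h := mask_energy hlam hν h0 h1
  have h3 : 0 ≤ ∑ l, ‖waveletMasks S s p g ν l ξ‖ ^ 2 := by positivity
  have h4 : ‖S ξ‖ ≤ C := by exact_mod_cast enorm_le_coe.1 hξ
  have h5 : ((S ((lam : ℝ) • ξ)).re)⁻¹ ≤ C' := by
    have : ‖(S ((lam : ℝ) • ξ))⁻¹‖ ≤ C' := by exact_mod_cast enorm_le_coe.1 hξ'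
    rwa [← h0.real, norm_inv, Complex.norm_real, Real.norm_of_nonneg h0.pos.le] at this
  have h6 := Complex.re_le_norm (S ξ)
  calc ‖refinementMask s p ν ξ‖ ^ 2
      = ((S ((lam : ℝ) • ξ)).re)⁻¹ * ((S ((lam : ℝ) • ξ)).re * ‖refinementMask s p ν ξ‖ ^ 2) := by
        rw [inv_mul_cancel_left₀ h0.pos.ne']
    _ ≤ (C' : ℝ) * C := by
        have := h0.pos
        gcongr
        linarith

end MaskBounds

/-! ### The refinable function -/

section Refinable

variable {n lam N : ℕ} {S s : RatTrigPoly n} {p : Fin (lam ^ n) → RatTrigPoly n}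
  {g : Fin N → RatTrigPoly n} {ν : Fin (lam ^ n) → Fin n → Fin lam}

/-- The function `S` as a nonnegative weight in the frequency variable `ξ/(2π)`. -/
noncomputable def weight (S : RatTrigPoly n) (η : RSpace n) : ℝ≥0 :=
  Real.toNNReal (S ((2 * Real.pi) • η)).re

lemma measurable_weight : Measurable (weight S) :=
  measurable_real_toNNReal.comp (Complex.measurable_re.comp
    (S.measurable_eval.comp (measurable_const_smul _)))

lemma weight_add_intVec (η : RSpace n) (k : Fin n → ℤ) : weight S (η + intVec k) = weight S η := by
  rw [weight, weight, smul_add, S.eval_add_period]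

lemma RegularAt.coe_weight {η : RSpace n} (h : RegularAt S s p g ((2 * Real.pi) • η)) :
    (weight S η : ℂ) = S ((2 * Real.pi) • η) := by
  have h1 : ((weight S η : ℝ≥0) : ℝ) = (S ((2 * Real.pi) • η)).re :=
    Real.coe_toNNReal _ h.pos.le
  rw [← h.real, ← h1]

lemma RegularAt.weight_pos {η : RSpace n} (h : RegularAt S s p g ((2 * Real.pi) • η)) :
    0 < weight S η :=
  Real.toNNReal_pos.2 h.pos

lemma RegularAt.coe_weight_eq_enorm {η : RSpace n} (h : RegularAt S s p g ((2 * Real.pi) • η)) :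
    (weight S η : ℝ≥0∞) = ‖S ((2 * Real.pi) • η)‖ₑ := by
  rw [← h.coe_weight, enorm_eq_nnnorm, Complex.nnnorm_real]
  simp

lemma tendsto_weight (hS_cont : ContinuousAt S 0) (hS_zero : S 0 = 1) :
    Tendsto (weight S) (𝓝 0) (𝓝 1) := by
  have h1 : Tendsto (fun η : RSpace n => (2 * Real.pi) • η) (𝓝 0) (𝓝 0) := by
    have : Continuous fun η : RSpace n => (2 * Real.pi) • η := by fun_prop
    simpa using this.tendsto 0
  have h2 : Tendsto (weight S) (𝓝 0) (𝓝 (Real.toNNReal (S 0).re)) :=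
    (continuous_real_toNNReal.tendsto _).comp
    ((Complex.continuous_re.tendsto _).comp (hS_cont.tendsto.comp h1))
  rwa [hS_zero, Complex.one_re, Real.toNNReal_one] at h2

/-- The mask identity in the frequency variable `ξ/(2π)`. -/
lemma ae_weight_identity (hlam : 0 < lam) (hν : Function.Injective ν)
    (hreg : ∀ᵐ ξ, RegularAt S s p g ξ) :
    ∀ᵐ η : RSpace n, 0 < weight S ((lam : ℝ) • η) ∧
      (∀ m : Fin n → Fin lam, 0 < weight S (η + digitVec m)) ∧ ∀ m m' : Fin n → Fin lam,
      (weight S ((lam : ℝ) • η) : ℂ) *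
        (conj (refinementMask s p ν ((2 * Real.pi) • (η + digitVec m))) *
          refinementMask s p ν ((2 * Real.pi) • (η + digitVec m'))) +
      ∑ l, conj (waveletMasks S s p g ν l ((2 * Real.pi) • (η + digitVec m))) *
        waveletMasks S s p g ν l ((2 * Real.pi) • (η + digitVec m')) =
      if m = m' then (weight S (η + digitVec m) : ℂ) else 0 := by
  have h2π : (2 * Real.pi) ≠ 0 := by positivity
  filter_upwards [(qmp_smul h2π).ae (ae_fibre_regularAt hlam hreg)] with η ⟨h0, h⟩
  have hdig : ∀ m : Fin n → Fin lam, (2 * Real.pi) • (η + digitVec m) =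
      (2 * Real.pi) • η + (2 * Real.pi / lam) • intVec fun i => ((m i : ℕ) : ℤ) := fun m => by
    rw [smul_add, digitVec, smul_smul, div_eq_mul_inv]
  rw [smul_comm] at h0
  have hd : ∀ m : Fin n → Fin lam, RegularAt S s p g ((2 * Real.pi) • (η + digitVec m)) :=
    fun m => by rw [hdig]; exact h _
  refine ⟨h0.weight_pos, fun m => (hd m).weight_pos, fun m m' => ?_⟩
  have key := mask_identity hlam hν (fun i => ((m' i : ℕ) : ℤ)) (fun i => ((m i : ℕ) : ℤ))
    (by rw [smul_comm]; exact h0) (h _) (h _)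
  rw [← hdig, ← hdig, smul_comm] at key
  rw [h0.coe_weight, (hd m).coe_weight]
  have hmm : (∀ i, (lam : ℤ) ∣ ((m' i : ℕ) : ℤ) - ((m i : ℕ) : ℤ)) ↔ m = m' := by
    constructor
    · intro hdvd
      ext i
      have h1 : ((m i : ℕ) : ℤ) ≡ ((m' i : ℕ) : ℤ) [ZMOD lam] := Int.modEq_iff_dvd.2 (hdvd i)
      exact Nat.ModEq.eq_of_lt_of_lt (Int.natCast_modEq_iff.1 h1) (m i).2 (m' i).2
    · rintro rfl i
      simp
  simp only [hmm] at key
  split_ifs at key ⊢ with hm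
  · subst hm
    rw [← key]
    congr 1
    · ring
    · exact Finset.sum_congr rfl fun l _ => mul_comm _ _
  · rw [← key]
    congr 1
    · ring
    · exact Finset.sum_congr rfl fun l _ => mul_comm _ _

/-- The function `1/S` is a supersolution of the transfer operator of `|τ|²`: test the quadratic
form of the identity with the vector `τ/S`. -/
lemma sum_mask_sq_div_le {ι : Type} [Fintype ι] {κ : Type*} [Fintype κ] [DecidableEq κ] {s₀ : ℝ≥0}
    {w : κ → ℝ≥0} {t : κ → ℂ} {q : ι → κ → ℂ} (hs₀ : 0 < s₀) (hw : ∀ m, 0 < w m)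
    (hid : ∀ m m', (s₀ : ℂ) * (conj (t m) * t m') + ∑ l, conj (q l m) * q l m' =
      if m = m' then (w m : ℂ) else 0) :
    ∑ m, ‖t m‖ₑ ^ 2 * (w m : ℝ≥0∞)⁻¹ ≤ (s₀ : ℝ≥0∞)⁻¹ := by
  have key := quadratic_identity hid fun m => t m / (w m : ℂ)
  set X : ℝ≥0 := ∑ m, ‖t m‖₊ ^ 2 * (w m)⁻¹ with hX
  have hXe : ∑ m, ‖t m‖ₑ ^ 2 * (w m : ℝ≥0∞)⁻¹ = (X : ℝ≥0∞) := by
    rw [hX]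
    push_cast
    exact Finset.sum_congr rfl fun m _ => by rw [ENNReal.coe_inv (hw m).ne', enorm_eq_nnnorm]
  have h1 : ‖∑ m, conj (t m) * (t m / (w m : ℂ))‖ₑ = (X : ℝ≥0∞) := by
    have : ∑ m, conj (t m) * (t m / (w m : ℂ)) = ((X : ℝ≥0) : ℂ) := by
      rw [hX]
      push_cast
      refine Finset.sum_congr rfl fun m _ => ?_
      rw [← mul_div_assoc, Complex.conj_mul', div_eq_mul_inv]
    rw [this, enorm_eq_nnnorm, Complex.nnnorm_real]
    simp
  have h2 : ∑ m, (w m : ℝ≥0∞) * ‖t m / (w m : ℂ)‖ₑ ^ 2 = (X : ℝ≥0∞) := by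
    rw [hX]
    push_cast
    refine Finset.sum_congr rfl fun m _ => ?_
    have : ‖t m / (w m : ℂ)‖ₑ = ((‖t m‖₊ * (w m)⁻¹ : ℝ≥0) : ℝ≥0∞) := by
      rw [enorm_eq_nnnorm, nnnorm_div, Complex.nnnorm_real, div_eq_mul_inv]
      simp
    rw [this]
    norm_cast
    have := (hw m).ne'
    field_simp
  rw [h1, h2] at key
  have h3 : s₀ * X ^ 2 ≤ X := by
    have : (s₀ : ℝ≥0∞) * X ^ 2 ≤ X := le_self_add.trans_eq key
    exact_mod_cast this
  rw [hXe, ← ENNReal.coe_inv hs₀.ne', ENNReal.coe_le_coe]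
  rcases eq_or_ne X 0 with h0 | h0
  · rw [h0]; exact zero_le
  · rw [← one_div, le_div_iff₀' hs₀]
    have hXp : 0 < X := pos_iff_ne_zero.2 h0
    refine le_of_mul_le_mul_right (a := X) ?_ hXp
    calc s₀ * X * X = s₀ * X ^ 2 := by ring
      _ ≤ 1 * X := by rwa [one_mul]

variable [NeZero lam]

/-- The bracket of the infinite product is bounded by `1/S`. -/
lemma ae_perSq_phiHat_le (hlam : 2 ≤ lam) (hν : Function.Injective ν)
    (hreg : ∀ᵐ ξ, RegularAt S s p g ξ) (hS_cont : ContinuousAt S 0) (hS_zero : S 0 = 1)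
    (hO : (fun ξ => refinementMask s p ν ξ - 1) =O[𝓝 0] fun ξ : RSpace n => ξ) :
    ∀ᵐ η : RSpace n, perSq (fun η => phiHat lam (refinementMask s p ν) ((2 * Real.pi) • η)) η ≤
      (weight S η : ℝ≥0∞)⁻¹ := by
  refine ae_tsum_limit_le (lam := lam)
    (t := fun η => ‖refinementMask s p ν ((2 * Real.pi) • η)‖ₑ ^ 2)
    (v := fun η => (weight S η : ℝ≥0∞)⁻¹)
    (F := fun η => ‖phiHat lam (refinementMask s p ν) ((2 * Real.pi) • η)‖ₑ ^ 2)
    ?_ ?_ ?_ hlam ?_ ?_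
  · intro ξ k
    simp only [smul_add, refinementMask_add_period]
  · intro ξ k
    simp only [weight_add_intVec]
  · filter_upwards [ae_weight_identity (by omega) hν hreg] with η ⟨h0, hd, hid⟩
    exact sum_mask_sq_div_le (t := fun m => refinementMask s p ν ((2 * Real.pi) • (η + digitVec m)))
      (q := fun l m => waveletMasks S s p g ν l ((2 * Real.pi) • (η + digitVec m))) h0 hd hid
  · have h1 : Tendsto (fun η => (weight S η : ℝ≥0∞)) (𝓝 0) (𝓝 1) := by
      have := ENNReal.tendsto_coe.2 (tendsto_weight hS_cont hS_zero)
      rwa [ENNReal.coe_one] at this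
    simpa using tendsto_inv_iff.2 h1
  · intro ξ
    have h1 := tendsto_prod_range_phiHat hlam hO ((2 * Real.pi) • ξ)
    have h2 := ((ENNReal.continuous_pow 2).tendsto _).comp h1.enorm
    refine h2.congr fun J => ?_
    simp only [Function.comp_apply, ← ofReal_norm, norm_prod]
    rw [ENNReal.ofReal_prod_of_nonneg fun _ _ => norm_nonneg _, ← Finset.prod_pow]
    simp only [smul_comm (2 * Real.pi)]

end Refinable

/-! ### Passage to `L²(ℝⁿ)` -/

section Main

variable {n lam N : ℕ} {S s : RatTrigPoly n} {p : Fin (lam ^ n) → RatTrigPoly n}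
  {g : Fin N → RatTrigPoly n} {ν : Fin (lam ^ n) → Fin n → Fin lam}

lemma volume_cube_ne_top : volume (cube n) ≠ ∞ := by
  rw [volume_cube]; exact ENNReal.one_ne_top

lemma exists_fourier_ae_eq {h : RSpace n → ℂ} (hh : MemLp h 2) :
    ∃ f : L2Space n, ((𝓕 f : L2Space n) : RSpace n → ℂ) =ᵐ[volume] h := by
  refine ⟨𝓕⁻ (hh.toLp h), ?_⟩
  rw [FourierTransform.fourier_fourierInv_eq]
  exact hh.coeFn_toLp

lemma ae_comp_smul {r : ℝ} (hr : r ≠ 0) {a b : RSpace n → ℂ} (h : a =ᵐ[volume] b) :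
    ∀ᵐ ξ : RSpace n, a (r • ξ) = b (r • ξ) :=
  (qmp_smul hr).ae h

lemma perSq_congr_ae {a b : RSpace n → ℂ} (h : a =ᵐ[volume] b) :
    ∀ᵐ ξ, perSq a ξ = perSq b ξ := by
  filter_upwards [ae_forall_add_intVec h] with ξ hξ
  exact tsum_congr fun k => by rw [hξ k]

lemma fourierHat_ae_eq {f : L2Space n} {h : RSpace n → ℂ}
    (hf : ((𝓕 f : L2Space n) : RSpace n → ℂ) =ᵐ[volume] h) :
    fourierHat f =ᵐ[volume] fun ξ => h ((2 * Real.pi)⁻¹ • ξ) :=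
  ae_comp_smul (r := (2 * Real.pi)⁻¹) (by positivity) hf

/-- A function with essentially bounded bracket lies in `L²(ℝⁿ)`. -/
lemma memLp_two_of_perSq_le {h : RSpace n → ℂ} (hm : AEStronglyMeasurable h) {C : ℝ≥0}
    (hC : ∀ᵐ ξ, perSq h ξ ≤ C) : MemLp h 2 := by
  refine memLp_two_of_lintegral hm ?_
  rw [← lintegral_perSq hm]
  refine ((lintegral_mono_ae (ae_restrict_of_ae hC)).trans_lt ?_).ne
  rw [setLIntegral_const]
  exact ENNReal.mul_lt_top ENNReal.coe_lt_top (volume_cube_ne_top).lt_top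

lemma ae_inv_weight_le (hreg : ∀ᵐ ξ, RegularAt S s p g ξ)
    (hS' : EssBounded fun ξ => (S ξ)⁻¹) : ∃ C : ℝ≥0, ∀ᵐ η, (weight S η : ℝ≥0∞)⁻¹ ≤ C := by
  obtain ⟨C, hC⟩ := hS'.exists_enorm_le
  have h2π : (2 * Real.pi) ≠ 0 := by positivity
  refine ⟨C, ?_⟩
  filter_upwards [(qmp_smul h2π).ae hreg, (qmp_smul h2π).ae hC] with η h1 h2
  rw [h1.coe_weight_eq_enorm, ← enorm_inv]
  · exact h2
  · intro h0
    have := h1.pos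
    simp [h0] at this

lemma ae_weight_le (hreg : ∀ᵐ ξ, RegularAt S s p g ξ) (hS : EssBounded S) :
    ∃ C : ℝ≥0, ∀ᵐ η, weight S η ≤ C := by
  obtain ⟨C, hC⟩ := hS.exists_enorm_le
  have h2π : (2 * Real.pi) ≠ 0 := by positivity
  refine ⟨C, ?_⟩
  filter_upwards [(qmp_smul h2π).ae hreg, (qmp_smul h2π).ae hC] with η h1 h2
  rw [← ENNReal.coe_le_coe, h1.coe_weight_eq_enorm]
  exact h2

lemma lam_zpow_ne_zero [NeZero lam] (j : ℤ) : ((lam : ℝ) ^ j) ≠ 0 := (zpow_pos lam_pos j).ne'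

/-- The masks of the construction satisfy the conditions of the oblique extension principle. -/
lemma satisfiesOEP [NeZero lam] (hlam : 2 ≤ lam) (hν : Function.Injective ν)
    (hreg : ∀ᵐ ξ, RegularAt S s p g ξ) (hS : EssBounded S) (hS' : EssBounded fun ξ => (S ξ)⁻¹)
    (hS_cont : ContinuousAt S 0) (hS_zero : S 0 = 1)
    (hO : (fun ξ => refinementMask s p ν ξ - 1) =O[𝓝 0] fun ξ : RSpace n => ξ) :
    SatisfiesOEP lam S (refinementMask s p ν) (waveletMasks S s p g ν) where
  bounded_tau := essBounded_refinementMask (by omega) hν hreg hS hS'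
  bounded_q := essBounded_waveletMasks (by omega) hν hreg hS
  phiHat_tendsto := phiHat_tendsto_one hlam hO
  bracket_bounded := by
    obtain ⟨C, hC⟩ := ae_inv_weight_le hreg hS'
    refine ⟨C, ?_⟩
    have h2π : (2 * Real.pi)⁻¹ ≠ 0 := by positivity
    filter_upwards [(qmp_smul h2π).ae hC,
      (qmp_smul h2π).ae (ae_perSq_phiHat_le hlam hν hreg hS_cont hS_zero hO)] with ξ h1 h2
    refine le_trans (le_of_eq (tsum_congr fun k => ?_)) (h2.trans h1)
    beta_reduce
    rw [smul_add, smul_inv_smul₀ (by positivity)]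
  identity := by
    have hl : 0 < lam := by omega
    filter_upwards [ae_fibre_regularAt hl hreg] with ξ ⟨h0, h⟩ _ γ ⟨m, hm⟩
    have hγ : γ = (2 * Real.pi / lam) • intVec fun i => ((m i : ℕ) : ℤ) := by
      ext i
      simp [hm, intVec]
    have hz : ξ + (2 * Real.pi / lam) • intVec (0 : Fin n → ℤ) = ξ := by
      rw [intVec_zero, smul_zero, add_zero]
    have key := mask_identity hl hν 0 (fun i => ((m i : ℕ) : ℤ)) h0 (h 0) (h _)
    rw [← hγ, hz] at key
    have hdvd : (∀ i, (lam : ℤ) ∣ (0 : Fin n → ℤ) i - ((m i : ℕ) : ℤ)) ↔ γ = 0 := by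
      have hc : 2 * Real.pi / lam ≠ 0 := by positivity
      constructor
      · intro hd
        ext i
        have h1 : (lam : ℤ) ∣ ((m i : ℕ) : ℤ) := by simpa using hd i
        have h2 := Nat.eq_zero_of_dvd_of_lt (Int.natCast_dvd_natCast.1 h1) (m i).2
        simp [hm, h2]
      · intro h1 i
        have h2 := hm i
        rw [h1, PiLp.zero_apply, eq_comm, mul_eq_zero, or_iff_right hc] at h2
        have h3 : ((m i : ℕ)) = 0 := Nat.cast_eq_zero.1 h2
        simp [h3]
    rw [key]
    exact ⟨fun h1 => if_pos (hdvd.2 h1), fun h1 => if_neg (mt hdvd.1 h1)⟩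

/-- The masks of the construction generate a tight wavelet frame. -/
lemma isTightWaveletFrameOfMasks [NeZero lam] (hn : 0 < n) (hlam : 2 ≤ lam)
    (hν : Function.Injective ν) (hreg : ∀ᵐ ξ, RegularAt S s p g ξ) (hS : EssBounded S)
    (hS' : EssBounded fun ξ => (S ξ)⁻¹) (hS_cont : ContinuousAt S 0) (hS_zero : S 0 = 1)
    (hO : (fun ξ => refinementMask s p ν ξ - 1) =O[𝓝 0] fun ξ : RSpace n => ξ) :
    IsTightWaveletFrameOfMasks lam (refinementMask s p ν) (waveletMasks S s p g ν) := by
  have hl : (lam : ℝ) ≠ 0 := lam_pos.ne'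
  have h2π : (2 * Real.pi) ≠ 0 := by positivity
  set F : RSpace n → ℂ := phiHat lam (refinementMask s p ν) with hF
  set Q := waveletMasks S s p g ν with hQ
  set Φ : RSpace n → ℂ := fun η => F ((2 * Real.pi) • η) with hΦ
  have hFm : Measurable F := measurable_phiHat hlam hO measurable_refinementMask
  have hΦm : Measurable Φ := hFm.comp (measurable_const_smul _)
  have hFsmul : ∀ ξ, F ((lam : ℝ) • ξ) = refinementMask s p ν ξ * F ξ := phiHat_smul hlam hO
  obtain ⟨C', hC'⟩ := ae_inv_weight_le hreg hS'
  have hper : ∀ᵐ η, perSq Φ η ≤ C' := by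
    filter_upwards [hC', ae_perSq_phiHat_le hlam hν hreg hS_cont hS_zero hO] with η h1 h2
      using h2.trans h1
  have hΦL : MemLp Φ 2 := memLp_two_of_perSq_le hΦm.aestronglyMeasurable hper
  obtain ⟨φ, hφ⟩ := exists_fourier_ae_eq hΦL
  -- the Fourier transforms of the mother wavelets, in the variable `ξ/(2π)`
  set W : Fin N ⊕ Fin (lam ^ n) → RSpace n → ℂ := fun l η =>
    Q l ((2 * Real.pi) • (lam : ℝ)⁻¹ • η) * Φ ((lam : ℝ)⁻¹ • η) with hW
  have hWL : ∀ l, MemLp (W l) 2 := by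
    intro l
    have hd : MemLp (fun η => Φ ((lam : ℝ)⁻¹ • η)) 2 := by
      refine memLp_two_of_lintegral
        (hΦm.comp (measurable_const_smul _)).aestronglyMeasurable fun htop => ?_
      have h1 := lintegral_comp_smul (r := (lam : ℝ)⁻¹) (inv_pos.2 lam_pos)
        (g := fun η => ‖Φ η‖ₑ ^ 2) (hΦm.enorm.pow_const 2).aemeasurable
      rw [htop, ENNReal.mul_top (by simp [lam_pos (lam := lam)])] at h1
      exact lintegral_enorm_sq_ne_top hΦL h1.symm
    have hq : MemLp (fun η => Q l ((2 * Real.pi) • (lam : ℝ)⁻¹ • η)) ∞ := by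
      obtain ⟨C, hC⟩ := (essBounded_waveletMasks (by omega) hν hreg hS l).exists_enorm_le
      refine memLp_top_of_bound (((measurable_waveletMasks l).comp (measurable_const_smul _)).comp
        (measurable_const_smul _)).aestronglyMeasurable C ?_
      filter_upwards [(qmp_smul (inv_ne_zero hl)).ae ((qmp_smul h2π).ae hC)] with η hη
      exact_mod_cast enorm_le_coe.1 hη
    exact hd.mul hq
  choose Ψ hΨ using fun l => exists_fourier_ae_eq (hWL l)
  have hφhat : fourierHat φ =ᵐ[volume] F := by
    filter_upwards [fourierHat_ae_eq hφ] with ξ hξ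
    rw [hξ, hΦ]
    simp only [smul_inv_smul₀ h2π]
  have hΨhat : ∀ l, ∀ᵐ ξ : RSpace n, fourierHat (Ψ l) ((lam : ℝ) • ξ) = Q l ξ * F ξ := by
    intro l
    filter_upwards [ae_comp_smul hl (fourierHat_ae_eq (hΨ l))] with ξ hξ
    have : (lam : ℝ)⁻¹ • (2 * Real.pi)⁻¹ • (lam : ℝ) • ξ = (2 * Real.pi)⁻¹ • ξ := by
      rw [smul_comm (2 * Real.pi)⁻¹, inv_smul_smul₀ hl]
    rw [hξ]
    simp only [hW, hΦ, this, smul_inv_smul₀ h2π]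
  refine ⟨φ, ⟨Eventually.of_forall fun ξ => multipliable_dilate hlam hO ξ, hφhat, ?_⟩, Ψ, ?_, ?_⟩
  · filter_upwards [hφhat, ae_comp_smul hl hφhat] with ξ h1 h2
    rw [h1, h2, hFsmul]
  · intro l
    filter_upwards [hφhat, hΨhat l] with ξ h1 h2
    rw [h1, h2]
  · refine FourierOEP.isTightWaveletFrame (σ := weight S)
      (τ := fun η => refinementMask s p ν ((2 * Real.pi) • η))
      (q := fun l η => Q l ((2 * Real.pi) • η)) hn hlam (φ := φ) ?_
    exact
    { measurable_σ := measurable_weight.aemeasurable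
      period_σ := weight_add_intVec
      period_τ := fun ξ k => by rw [smul_add, refinementMask_add_period]
      period_q := fun l ξ k => by rw [smul_add, hQ, waveletMasks_add_period]
      bound_σ := ae_weight_le hreg hS
      bound_Φ := ⟨C', by filter_upwards [perSq_congr_ae hφ, hper] with ξ h1 h2 using h1 ▸ h2⟩
      memLp_Φ := Lp.memLp _
      memLp_Ψ := fun l => Lp.memLp _
      refine_Φ := by
        filter_upwards [hφ, ae_comp_smul hl hφ] with ξ h1 h2
        rw [h1, h2]
        simp only [hΦ, smul_comm (2 * Real.pi) (lam : ℝ), hFsmul]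
      refine_Ψ := by
        intro l
        filter_upwards [hφ, ae_comp_smul hl (hΨ l)] with ξ h1 h2
        rw [h1, h2]
        simp only [hW, inv_smul_smul₀ hl]
      limit := by
        filter_upwards [ae_all_iff.2 fun J : ℕ =>
          ae_comp_smul (lam_zpow_ne_zero (lam := lam) (-(J : ℤ))) hφ] with ξ hξ
        simp only [hξ]
        have hz := tendsto_zpow_neg_smul hlam ξ
        have h1 : Tendsto (fun η => (weight S η : ℝ≥0∞)) (𝓝 0) (𝓝 1) := by
          have := ENNReal.tendsto_coe.2 (tendsto_weight hS_cont hS_zero)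
          rwa [ENNReal.coe_one] at this
        have h2 : Tendsto Φ (𝓝 0) (𝓝 1) := by
          have hc : Tendsto (fun η : RSpace n => (2 * Real.pi) • η) (𝓝 0) (𝓝 0) := by
            have : Continuous fun η : RSpace n => (2 * Real.pi) • η := by fun_prop
            simpa using this.tendsto 0
          exact (phiHat_tendsto_one hlam hO).comp hc
        have h3 : Tendsto (fun η => ‖Φ η‖ₑ ^ 2) (𝓝 0) (𝓝 1) := by
          have := ((ENNReal.continuous_pow 2).tendsto _).comp h2.enorm
          rwa [enorm_one, one_pow] at this
        have h4 := ENNReal.Tendsto.mul h1 (Or.inl one_ne_zero) h3 (Or.inl one_ne_zero)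
        rw [one_mul] at h4
        exact h4.comp hz
      identity := by
        filter_upwards [ae_weight_identity (by omega) hν hreg] with η ⟨_, _, hid⟩ using hid }

end Main

end ObliqueTWF

open ObliqueTWF

theorem theorem3p2 {n : ℕ} (hn : 0 < n) {lam : ℕ} (hlam : 2 ≤ lam) {N : ℕ} (hN : N ≤ lam ^ n)
    (S : RatTrigPoly n)
    (hS_nonneg : ∀ ξ, S.DefinedAt ξ → (S ξ).im = 0 ∧ 0 ≤ (S ξ).re)
    (hS_cont : ContinuousAt S 0) (hS_zero : S 0 = 1)
    (hS_bdd : EssBounded S) (hS_inv_bdd : EssBounded fun ξ => (S ξ)⁻¹)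
    (p : Fin (lam ^ n) → RatTrigPoly n) (g : Fin N → RatTrigPoly n)
    (hpg : ∀ (l : Fin N) (ξ : RSpace n), S.DefinedAt ξ → S ξ ≠ 0 →
      (p (Fin.castLE hN l)).DefinedAt ξ → (g l).DefinedAt ξ →
      (S ξ)⁻¹ - (‖p (Fin.castLE hN l) ξ‖ : ℂ) ^ 2 = (lam : ℂ) ^ n * (‖g l ξ‖ : ℂ) ^ 2)
    (hp_zero : ∀ l : Fin N, p (Fin.castLE hN l) 0 = 1)
    (s : RatTrigPoly n)
    (hs : ∀ ξ, S.DefinedAt ξ → S ξ ≠ 0 → s.DefinedAt ξ → (‖s ξ‖ : ℂ) ^ 2 = (S ξ)⁻¹)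
    (hs_zero : s 0 = 1)
    (hp_rest : ∀ l : Fin (lam ^ n), N ≤ (l : ℕ) → ∀ ξ, S.DefinedAt ξ → S ξ ≠ 0 →
      (p l).DefinedAt ξ → (‖p l ξ‖ : ℂ) ^ 2 = (S ξ)⁻¹)
    (ν : Fin (lam ^ n) → Fin n → Fin lam) (hν : Function.Injective ν)
    (hτ_zero : refinementMask s p ν 0 = 1) :
    SatisfiesOEP lam S (refinementMask s p ν) (waveletMasks S s p g ν) ∧
      IsTightWaveletFrameOfMasks lam (refinementMask s p ν) (waveletMasks S s p g ν) := by
  have : NeZero lam := ⟨by omega⟩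
  have hl : 0 < lam := by omega
  have hreg : ∀ᵐ ξ, RegularAt S s p g ξ :=
    ae_regularAt hl hN hS_nonneg hS_zero hpg hs hp_rest
  have hSd : S.DefinedAt 0 := S.definedAt_of_ne_zero (by rw [hS_zero]; exact one_ne_zero)
  have hp : ∀ l, ‖p l 0‖ ≤ 1 := by
    intro l
    rcases lt_or_ge (l : ℕ) N with h | h
    · have := hp_zero ⟨l, h⟩
      have h2 : Fin.castLE hN ⟨l, h⟩ = l := rfl
      rw [h2] at this
      rw [this, norm_one]
    · by_cases hd : (p l).DefinedAt 0
      · have := hp_rest l h 0 hSd (by rw [hS_zero]; exact one_ne_zero) hd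
        rw [hS_zero, inv_one] at this
        have h2 : ‖p l 0‖ ^ 2 = 1 := by exact_mod_cast this
        exact ((pow_eq_one_iff_of_nonneg (norm_nonneg _) two_ne_zero).1 h2).le
      · -- where `p l` is not defined its value is `0` by convention
        have : p l 0 = 0 := by
          by_contra h0
          exact hd ((p l).definedAt_of_ne_zero h0)
        rw [this, norm_zero]
        exact zero_le_one
  have hO := refinementMask_sub_one_isBigO hl hp hs_zero hτ_zero
  exact ⟨satisfiesOEP hlam hν hreg hS_bdd hS_inv_bdd hS_cont hS_zero hO,
    isTightWaveletFrameOfMasks hn hlam hν hreg hS_bdd hS_inv_bdd hS_cont hS_zero hO⟩
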